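/- Let $\langle z\rangle=(1+|z|^2)^{1/2}$ and, for $c\in\mathbb R$, $\sigma_c(\tau,\xi,\eta)=\tau-\xi^3-c\,\xi+\eta^2/\xi$ (for $c=0$ this is the usual KP-II modulation $\tau-\xi^3+\eta^2/\xi$). For $b,b_1,s\in\mathbb R$ let $X^{b,b_1,s}_{(c)}$ be the space of tempered distributions $u$ on $\mathbb R_t\times\mathbb R^2_{x,y}$ whose Fourier transform $\hat u$ (in $(\tau,\xi,\eta)$, dual to $(t,x,y)$) is a function with $$\|u\|_{X^{b,b_1,s}_{(c)}}^2=\int_{\mathbb R^3}\Big\langle\frac{\langle\sigma_c\rangle}{\langle\xi\rangle^3}\Big\rangle^{2b_1}\langle(\xi,\eta)\rangle^{2s}\,\langle\sigma_c\rangle^{2b}\,|\hat u(\tau,\xi,\eta)|^2\,d\tau\,d\xi\,d\eta<\infty .$$ There is $\varepsilon_0>0$ such that for all real $b_1,s,\varepsilon$ with $1/4<b_1<3/8$, $s\ge 0$ and $0<\varepsilon<\varepsilon_0$ there is a constant $C$, depending only on $b_1,s,\varepsilon$, such that for all $c\in\mathbb R$ (in particular for $c=0$) and all $u,v\in X^{1/2+\varepsilon,b_1,s}_{(c)}$,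 the distributions $u,v$ are $L^2$ functions, so that $uv\in L^1$, and $$\|\partial_x(uv)\|_{X^{-1/2+2\varepsilon,b_1,s}_{(c)}}\le C\,\|u\|_{X^{1/2+\varepsilon,b_1,s}_{(c)}}\,\|v\|_{X^{1/2+\varepsilon,b_1,s}_{(c)}} .$$ -/

import Mathlib

open MeasureTheory
open scoped SchwartzMap FourierTransform LineDeriv ENNReal NNReal

/-- Points of `ℝ_t × ℝ²_{x,y}`: coordinates `0, 1, 2` are `t, x, y`, and for frequencies
`τ, ξ, η`. -/
abbrev SpaceTime : Type := EuclideanSpace ℝ (Fin 3)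

/-- The Japanese bracket `⟨z⟩ = (1 + |z|²)^{1/2}`. -/
noncomputable def bracket {E : Type*} [Norm E] (z : E) : ℝ := Real.sqrt (1 + ‖z‖ ^ 2)

/-- The modulation `σ(τ, ξ, η) = τ - ξ³ - c ξ + η² / ξ` of the linear KP-II flow seen in a frame
moving with velocity `c`; for `c = 0` it is the usual `τ - ξ³ + η² / ξ`. (The value given to
it on the null set `ξ = 0` is immaterial.) -/
noncomputable def kpModulation (c τ ξ η : ℝ) : ℝ := τ - ξ ^ 3 - c * ξ + η ^ 2 / ξ

/-- The weight `⟨⟨σ⟩ / ⟨ξ⟩³⟩^{2 b₁} ⟨ζ⟩^{2 s} ⟨σ⟩^{2 b}`, `ζ = (ξ, η)`. -/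
noncomputable def bourgainWeight (c b b₁ s τ ξ η : ℝ) : ℝ :=
  bracket (bracket (kpModulation c τ ξ η) / bracket ξ ^ 3) ^ (2 * b₁)
    * bracket (!₂[ξ, η] : EuclideanSpace ℝ (Fin 2)) ^ (2 * s)
    * bracket (kpModulation c τ ξ η) ^ (2 * b)

/-- The Fourier transform of the tempered distribution `U` is the function `g`. The Fourier
transform is Mathlib's: for an integrable `u` it is `k ↦ ∫ e^{-2πi⟨k, z⟩} u(z) dz`. -/
def HasFourierFunction (U : 𝓢'(SpaceTime, ℂ)) (g : SpaceTime → ℂ) : Prop :=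
  AEStronglyMeasurable g ∧
    ∀ φ : 𝓢(SpaceTime, ℂ), Integrable (fun k => φ k * g k) ∧ (𝓕 U) φ = ∫ k, φ k * g k

/-- The norm of the Bourgain space `X^{b,b₁,s}`, with value `∞` on the tempered distributions that
do not belong to the space (in particular if the Fourier transform is not a function).
The function `g` is unique up to null sets, so the infimum runs over at most one value.

The weight is evaluated at the angular frequency `(τ, ξ, η) = 2πk`. By the change of variables
`(τ, ξ, η) = 2πk` this is exactly `(∫ weight(τ, ξ, η) |û(τ, ξ, η)|² dτ dξ dη)^{1/2}` for
`û(τ, ξ, η) = (2π)^{-3/2} ∫ e^{-i(tτ + xξ + yη)} u(t, x, y) dt dx dy`. -/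
noncomputable def bourgainNorm (c b b₁ s : ℝ) (U : 𝓢'(SpaceTime, ℂ)) : ℝ≥0∞ :=
  ⨅ (g : SpaceTime → ℂ) (_ : HasFourierFunction U g),
    (∫⁻ k, ENNReal.ofReal
        (bourgainWeight c b b₁ s (2 * Real.pi * k 0) (2 * Real.pi * k 1) (2 * Real.pi * k 2))
      * ‖g k‖ₑ ^ 2) ^ (1 / 2 : ℝ)

/-- The derivative `∂ₓ` of a tempered distribution. -/
noncomputable def dx (U : 𝓢'(SpaceTime, ℂ)) : 𝓢'(SpaceTime, ℂ) :=
  ∂_{(EuclideanSpace.single 1 1 : SpaceTime)} U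

/-! By Plancherel and duality the estimate says that the trilinear form with squared kernel `ξ²
W_out(p + q) / (W_in(p) W_in(q))` is bounded on `L² × L² × L²`. The factor `⟨ζ⟩^s` splits over the
inputs because `s ≥ 0`. The gain comes from the KP-II resonance identity `modulation_resonance`:
with `ξ = ξ₁ + ξ₂` and the slope gap `θ = η₁/ξ₁ - η₂/ξ₂`, one has `σ₁ + σ₂ - σ = ξ₁ ξ₂ (3ξ + θ²/ξ)`.
The two terms in the bracket have the same sign, so the largest modulation is at least `|ξ ξ₁ ξ₂|`,
and it also controls `|ξ₁ ξ₂| θ²/|ξ|`. The term `cξ` is linear: it cancels here and in every phase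
derivative below, so all bounds are uniform in `c`.

Cauchy-Schwarz reduces a trilinear bound to integrals of the squared kernel with one frequency
fixed. Two modulation factors `G(σ₁) G(σ₂)` with `G` integrable remain, and there are three ways to
use them. With the sum fixed, integration in `η₁` has Jacobian `2|θ|` (good for large `θ`). With the
sum and the slope `η₁/ξ₁` fixed, integration in `ξ₁` has Jacobian `|3ξ(ξ - 2ξ₁) + θ²|` (good when
`θ²` is too small to cancel the other term). With one input fixed, the condition `|θ| ≤ Θ` confines
`η₂` to length `2Θ|ξ₂|` (good when `ξ₂` is confined as well). These are
`trilinearBound_of_slopeGap`, `trilinearBound_of_transverse` and `trilinearBound_of_left`. Each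
frequency regime (low, high-low, comparable, high-high to low) is cut by the size of `θ` so that one
of the three applies; almost orthogonality (`TrilinearBound.of_localized`) supplies the
localizations.

If the output has the largest modulation, this gives `uniformBound_output`. If an input has it, the
shear `(p, q) ↦ (p + q, -q)` makes that input the output, and the weights become those of
`uniformBound_input`. There a quotient of inner weights appears to the power `2b₁`. The bound `2b₁ ≤
3/4` is used when the quotient is large, `2b₁ ≥ 1/2` when it is small. Most regions then reduce to
the output case. The exception is a tiny output frequency, where the full lower bound for the
resonance produces a Poisson kernel in the slope, whose integral does not depend on its width. -/

/-- Frequencies `(τ, ξ, η)`, with the product measure. -/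
abbrev Freq : Type := ℝ × ℝ × ℝ

instance : (volume : Measure (ℝ × ℝ)).IsAddHaarMeasure :=
  inferInstanceAs ((volume : Measure ℝ).prod (volume : Measure ℝ)).IsAddHaarMeasure

instance : (volume : Measure Freq).IsAddHaarMeasure :=
  inferInstanceAs ((volume : Measure ℝ).prod (volume : Measure (ℝ × ℝ))).IsAddHaarMeasure

instance : (volume : Measure Freq).IsNegInvariant :=
  Measure.IsAddHaarMeasure.isNegInvariant_of_regular _

/-! ### Trilinear forms on L²: symmetries, Cauchy-Schwarz criteria, almost orthogonality -/

/-- The trilinear form with squared kernel `κ` is bounded by `B` on `L² × L² × L²`. -/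
def TrilinearBound (κ : Freq × Freq → ℝ≥0∞) (B : ℝ≥0∞) : Prop :=
  ∀ f g h : Freq → ℝ≥0∞, Measurable f → Measurable g → Measurable h →
    ∫⁻ z : Freq × Freq, κ z ^ (1 / 2 : ℝ) * (f z.1 * g z.2 * h (z.1 + z.2)) ≤
      B * ((∫⁻ p, f p ^ 2) ^ (1 / 2 : ℝ) * (∫⁻ p, g p ^ 2) ^ (1 / 2 : ℝ)
        * (∫⁻ p, h p ^ 2) ^ (1 / 2 : ℝ))

theorem MeasurableSet.and {α : Type*} [MeasurableSpace α] {p q : α → Prop}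
    (hp : MeasurableSet {x | p x}) (hq : MeasurableSet {x | q x}) :
    MeasurableSet {x | p x ∧ q x} := by
  convert hp.inter hq using 1
  ext; simp

theorem lintegral_mul_le_sqrt {α : Type*} [MeasurableSpace α] {μ : Measure α} {f g : α → ℝ≥0∞}
    (hf : AEMeasurable f μ) (hg : AEMeasurable g μ) :
    ∫⁻ x, f x * g x ∂μ ≤ (∫⁻ x, f x ^ 2 ∂μ) ^ (1 / 2 : ℝ) * (∫⁻ x, g x ^ 2 ∂μ) ^ (1 / 2 : ℝ) := by
  have h := ENNReal.lintegral_mul_le_Lp_mul_Lq μ Real.HolderConjugate.two_two hf hg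
  simpa using h

theorem ENNReal.sq_rpow_half (x : ℝ≥0∞) : (x ^ 2) ^ (1 / 2 : ℝ) = x := by
  rw [← ENNReal.rpow_natCast, ← ENNReal.rpow_mul]; norm_num

theorem ENNReal.rpow_half_sq (x : ℝ≥0∞) : (x ^ (1 / 2 : ℝ)) ^ 2 = x := by
  rw [← ENNReal.rpow_natCast, ← ENNReal.rpow_mul]; norm_num

theorem ENNReal.mul_rpow_half (x y : ℝ≥0∞) :
    (x * y) ^ (1 / 2 : ℝ) = x ^ (1 / 2 : ℝ) * y ^ (1 / 2 : ℝ) :=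
  ENNReal.mul_rpow_of_nonneg _ _ (by norm_num)

namespace TrilinearBound

variable {κ κ₁ κ₂ : Freq × Freq → ℝ≥0∞} {B B₁ B₂ : ℝ≥0∞}

theorem mono (h : TrilinearBound κ₂ B) (hle : ∀ z, κ₁ z ≤ κ₂ z) : TrilinearBound κ₁ B := by
  intro f g k hf hg hk
  refine le_trans (lintegral_mono fun z => ?_) (h f g k hf hg hk)
  gcongr
  exact hle z

theorem mono_const (h : TrilinearBound κ B₁) (hle : B₁ ≤ B₂) : TrilinearBound κ B₂ := by
  intro f g k hf hg hk
  refine (h f g k hf hg hk).trans ?_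
  gcongr

theorem add (h₁ : TrilinearBound κ₁ B₁) (h₂ : TrilinearBound κ₂ B₂) (hm : Measurable κ₁) :
    TrilinearBound (fun z => κ₁ z + κ₂ z) (B₁ + B₂) := by
  intro f g k hf hg hk
  rw [add_mul]
  refine le_trans ?_ (add_le_add (h₁ f g k hf hg hk) (h₂ f g k hf hg hk))
  rw [← lintegral_add_left (by fun_prop)]
  refine lintegral_mono fun z => ?_
  rw [← add_mul]
  gcongr
  exact ENNReal.rpow_add_le_add_rpow _ _ (by norm_num) (by norm_num)

theorem const_mul (h : TrilinearBound κ B) (C : ℝ≥0∞) (hC : C ≠ ∞) :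
    TrilinearBound (fun z => C * κ z) (C ^ (1 / 2 : ℝ) * B) := by
  intro f g k hf hg hk
  have := h f g k hf hg hk
  simp_rw [ENNReal.mul_rpow_half, mul_assoc]
  rw [lintegral_const_mul']
  · gcongr
    simpa [mul_assoc] using this
  · exact ENNReal.rpow_ne_top_of_nonneg (by norm_num) hC

theorem swap (h : TrilinearBound κ B) : TrilinearBound (fun z => κ z.swap) B := by
  intro f g k hf hg hk
  have := h g f k hg hf hk
  have hs : MeasurePreserving (Prod.swap : Freq × Freq → Freq × Freq) volume volume :=
    Measure.measurePreserving_swap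
  rw [← hs.lintegral_comp_emb MeasurableEquiv.prodComm.measurableEmbedding] at this
  refine le_trans (le_of_eq ?_) (this.trans (le_of_eq ?_))
  · refine lintegral_congr fun z => ?_
    simp only [Prod.fst_swap, Prod.snd_swap, add_comm z.2 z.1, mul_comm (g z.2)]
  · ring

/-- The measure preserving involution `(p, q) ↦ (p + q, -q)`. -/
def shear : Freq × Freq ≃ᵐ Freq × Freq where
  toFun z := (z.1 + z.2, -z.2)
  invFun z := (z.1 + z.2, -z.2)
  left_inv z := by simp
  right_inv z := by simp
  measurable_toFun := by
    simp only [Equiv.coe_fn_mk]; fun_prop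
  measurable_invFun := by
    simp only [Equiv.coe_fn_symm_mk]; fun_prop

theorem measurePreserving_shear : MeasurePreserving shear
    (volume : Measure (Freq × Freq)) volume := by
  have h1 : MeasurePreserving (fun z : Freq × Freq => (z.1 + z.2, z.2)) volume volume := by
    have := measurePreserving_add_prod (volume : Measure Freq) (volume : Measure Freq)
    simpa only [add_comm] using! this
  have h2 : MeasurePreserving (fun z : Freq × Freq => (z.1, -z.2)) volume volume :=
    (MeasurePreserving.id volume).prod (Measure.measurePreserving_neg (volume : Measure Freq))
  exact h2.comp h1

/-- Substituting `(p, q) ↦ (p + q, -q)` exchanges the roles of the output and of the first input.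
This allows every case to be treated as if the output had the largest modulation. -/
theorem of_shear (h : TrilinearBound (fun z => κ (z.1 + z.2, -z.2)) B) : TrilinearBound κ B := by
  intro f g k hf hg hk
  have := h k (fun p => g (-p)) f hk (by fun_prop) hf
  rw [← measurePreserving_shear.lintegral_comp_emb shear.measurableEmbedding]
  refine le_trans (le_of_eq ?_) (this.trans (le_of_eq ?_))
  · refine lintegral_congr fun z => ?_
    simp only [shear, MeasurableEquiv.coe_mk, Equiv.coe_fn_mk, add_neg_cancel_right]
    ring
  · rw [lintegral_neg_eq_self (fun p => g p ^ 2)]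
    ring

/-- Cauchy-Schwarz in `q` at a fixed sum `p`, putting `κ^{1/2}` on one side and `f g` on the other,
then Cauchy-Schwarz in `p` against `k`. By Fubini, `∫∫ f(q)² g(p - q)²` is the product of the two
squared norms. -/
theorem of_sup_sum (hm : Measurable κ) (h : ∀ p, ∫⁻ q, κ (q, p - q) ≤ B ^ 2) :
    TrilinearBound κ B := by
  intro f g k hf hg hk
  have hpres : MeasurePreserving (fun z : Freq × Freq => (z.2, z.1 - z.2)) volume volume := by
    have := measurePreserving_sub_prod (volume : Measure Freq) (volume : Measure Freq)
    exact (Measure.measurePreserving_swap).comp this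
  rw [← hpres.lintegral_comp (by fun_prop), Measure.volume_eq_prod,
    lintegral_prod _ (by fun_prop)]
  have key : ∀ p : Freq, ∫⁻ q, κ (q, p - q) ^ (1 / 2 : ℝ) * (f q * g (p - q) * k (q + (p - q)))
      ≤ B * (k p * (∫⁻ q, f q ^ 2 * g (p - q) ^ 2) ^ (1 / 2 : ℝ)) := by
    intro p
    have : ∀ q, κ (q, p - q) ^ (1 / 2 : ℝ) * (f q * g (p - q) * k (q + (p - q)))
        = k p * (κ (q, p - q) ^ (1 / 2 : ℝ) * (f q * g (p - q))) := by
      intro q; rw [add_sub_cancel]; ring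
    simp_rw [this]
    rw [lintegral_const_mul _ (by fun_prop), mul_left_comm]
    gcongr
    refine (lintegral_mul_le_sqrt (by fun_prop) (by fun_prop)).trans ?_
    simp_rw [ENNReal.rpow_half_sq, mul_pow]
    gcongr
    calc _ ≤ (B ^ 2) ^ (1 / 2 : ℝ) := by gcongr; exact h p
      _ = B := ENNReal.sq_rpow_half B
  refine (lintegral_mono key).trans ?_
  have hF : Measurable fun p => ∫⁻ q, f q ^ 2 * g (p - q) ^ 2 :=
    Measurable.lintegral_prod_right' (f := fun z : Freq × Freq => f z.2 ^ 2 * g (z.1 - z.2) ^ 2)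
      (by fun_prop)
  rw [lintegral_const_mul _ (by fun_prop)]
  gcongr
  refine (lintegral_mul_le_sqrt hk.aemeasurable (by fun_prop)).trans ?_
  simp_rw [ENNReal.rpow_half_sq]
  rw [lintegral_lintegral_swap (by fun_prop)]
  have : ∀ q, ∫⁻ p, f q ^ 2 * g (p - q) ^ 2 = f q ^ 2 * ∫⁻ p, g p ^ 2 := by
    intro q
    rw [lintegral_const_mul _ (by fun_prop), lintegral_sub_right_eq_self (fun p => g p ^ 2)]
  simp_rw [this]
  rw [lintegral_mul_const _ (by fun_prop), ENNReal.mul_rpow_half, mul_comm]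

/-- The shear turns a fixed first input into a fixed sum, so this is `of_sup_sum` up to a
translation. -/
theorem of_sup_left (hm : Measurable κ) (h : ∀ p, ∫⁻ q, κ (p, q) ≤ B ^ 2) :
    TrilinearBound κ B := by
  apply of_shear
  refine of_sup_sum (by fun_prop) fun p => ?_
  refine le_trans (le_of_eq ?_) (h p)
  rw [← lintegral_sub_right_eq_self (fun q => κ (p, q)) p]
  simp

/-- Almost orthogonality: a kernel supported where `ψ₁ p` and `ψ₂ q` are close may be localized
in `ψ₁ p` and `ψ₂ q`. -/
theorem of_localized (hm : Measurable κ) {ψ₁ ψ₂ : Freq → ℝ} (h₁ : Measurable ψ₁)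
    (h₂ : Measurable ψ₂) (hsupp : ∀ z, κ z ≠ 0 → |ψ₁ z.1 - ψ₂ z.2| ≤ 1)
    (hloc : ∀ a : ℝ, TrilinearBound
      ({z | |ψ₁ z.1 - a| ≤ 1 ∧ |ψ₂ z.2 - a| ≤ 2}.indicator κ) B) :
    TrilinearBound κ (2 * B) := by
  classical
  intro f g k hf hg hk
  set E : Set (ℝ × Freq) := {w | |ψ₁ w.2 - w.1| ≤ 1} with hE
  set F : Set (ℝ × Freq) := {w | |ψ₂ w.2 - w.1| ≤ 2} with hF
  have hEm : MeasurableSet E := measurableSet_le (by fun_prop) (by fun_prop)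
  have hFm : MeasurableSet F := measurableSet_le (by fun_prop) (by fun_prop)
  set f' : ℝ → Freq → ℝ≥0∞ := fun a p => E.indicator (fun w => f w.2) (a, p) with hf'
  set g' : ℝ → Freq → ℝ≥0∞ := fun a p => F.indicator (fun w => g w.2) (a, p) with hg'
  have mf' : Measurable fun w : ℝ × Freq => f' w.1 w.2 := by
    simpa [hf'] using! (show Measurable fun w : ℝ × Freq => f w.2 by fun_prop).indicator hEm
  have mg' : Measurable fun w : ℝ × Freq => g' w.1 w.2 := by
    simpa [hg'] using! (show Measurable fun w : ℝ × Freq => g w.2 by fun_prop).indicator hFm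
  have mf1 : ∀ a, Measurable (f' a) := fun a => mf'.comp (by fun_prop : Measurable (Prod.mk a))
  have mg1 : ∀ a, Measurable (g' a) := fun a => mg'.comp (by fun_prop : Measurable (Prod.mk a))
  have hIcc : ∀ x r : ℝ, {a : ℝ | |x - a| ≤ r} = Set.Icc (x - r) (x + r) := by
    intro x r; ext a; simp only [Set.mem_ofPred_eq, Set.mem_Icc, abs_le]
    constructor <;> rintro ⟨u, v⟩ <;> constructor <;> linarith
  have sec : ∀ (ψ : Freq → ℝ) (u : Freq → ℝ≥0∞) (r : ℝ), 0 ≤ r → ∀ p,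
      ∫⁻ a : ℝ, ({w : ℝ × Freq | |ψ w.2 - w.1| ≤ r}.indicator (fun w => u w.2) (a, p)) ^ 2
        = ENNReal.ofReal (2 * r) * u p ^ 2 := by
    intro ψ u r hr p
    have : ∀ a : ℝ, ({w : ℝ × Freq | |ψ w.2 - w.1| ≤ r}.indicator (fun w => u w.2) (a, p)) ^ 2
        = (Set.Icc (ψ p - r) (ψ p + r)).indicator (fun _ => u p ^ 2) a := by
      intro a
      rw [← hIcc]
      by_cases h : |ψ p - a| ≤ r <;> simp [Set.indicator, h]
    simp_rw [this]
    rw [lintegral_indicator measurableSet_Icc, setLIntegral_const, Real.volume_Icc, mul_comm]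
    congr 2; ring
  -- The factor 2 is the length of the interval of `a` with `|ψ₁ - a| ≤ 1`. On the support of `κ`
  -- such an `a` also satisfies `|ψ₂ - a| ≤ 2`.
  have hlow : 2 * ∫⁻ z : Freq × Freq, κ z ^ (1 / 2 : ℝ) * (f z.1 * g z.2 * k (z.1 + z.2)) ≤
      ∫⁻ a : ℝ, ∫⁻ z : Freq × Freq,
        ({z | |ψ₁ z.1 - a| ≤ 1 ∧ |ψ₂ z.2 - a| ≤ 2}.indicator κ) z ^ (1 / 2 : ℝ) *
          (f' a z.1 * g' a z.2 * k (z.1 + z.2)) := by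
    have hS : MeasurableSet
        {w : ℝ × (Freq × Freq) | |ψ₁ w.2.1 - w.1| ≤ 1 ∧ |ψ₂ w.2.2 - w.1| ≤ 2} :=
      MeasurableSet.and (measurableSet_le (by fun_prop) (by fun_prop))
        (measurableSet_le (by fun_prop) (by fun_prop))
    have mK : Measurable fun w : ℝ × (Freq × Freq) =>
        ({z | |ψ₁ z.1 - w.1| ≤ 1 ∧ |ψ₂ z.2 - w.1| ≤ 2}.indicator κ) w.2 := by
      have := (show Measurable fun w : ℝ × (Freq × Freq) => κ w.2 by fun_prop).indicator hS
      simpa [Set.indicator] using! this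
    have mf2 : Measurable fun w : ℝ × (Freq × Freq) => f' w.1 w.2.1 :=
      mf'.comp (by fun_prop : Measurable fun w : ℝ × (Freq × Freq) => (w.1, w.2.1))
    have mg2 : Measurable fun w : ℝ × (Freq × Freq) => g' w.1 w.2.2 :=
      mg'.comp (by fun_prop : Measurable fun w : ℝ × (Freq × Freq) => (w.1, w.2.2))
    rw [lintegral_lintegral_swap]
    swap
    · exact Measurable.aemeasurable (by
        show Measurable fun w : ℝ × (Freq × Freq) => _
        simp only [Function.uncurry]
        fun_prop)
    rw [← lintegral_const_mul _ (by fun_prop)]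
    refine lintegral_mono fun z => ?_
    by_cases hz : κ z = 0
    · simp [hz]
    have hcl := hsupp z hz
    have : ∀ a : ℝ, (Set.Icc (ψ₁ z.1 - 1) (ψ₁ z.1 + 1)).indicator
        (fun _ => κ z ^ (1 / 2 : ℝ) * (f z.1 * g z.2 * k (z.1 + z.2))) a ≤
        ({z | |ψ₁ z.1 - a| ≤ 1 ∧ |ψ₂ z.2 - a| ≤ 2}.indicator κ) z ^ (1 / 2 : ℝ) *
          (f' a z.1 * g' a z.2 * k (z.1 + z.2)) := by
      intro a
      rw [← hIcc]
      by_cases h : |ψ₁ z.1 - a| ≤ 1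
      · have h2 : |ψ₂ z.2 - a| ≤ 2 := by
          rw [abs_le] at *; constructor <;> linarith
        simp [hf', hg', hE, hF, Set.indicator, h, h2]
      · simp [Set.indicator, h]
    refine le_trans (le_of_eq ?_) (lintegral_mono this)
    rw [lintegral_indicator measurableSet_Icc, setLIntegral_const, Real.volume_Icc, mul_comm]
    congr 1
    rw [show ψ₁ z.1 + 1 - (ψ₁ z.1 - 1) = 2 by ring]; simp
  have hup : ∀ a : ℝ, ∫⁻ z : Freq × Freq,
        ({z | |ψ₁ z.1 - a| ≤ 1 ∧ |ψ₂ z.2 - a| ≤ 2}.indicator κ) z ^ (1 / 2 : ℝ) *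
          (f' a z.1 * g' a z.2 * k (z.1 + z.2)) ≤
      (B * (∫⁻ p, k p ^ 2) ^ (1 / 2 : ℝ)) * ((∫⁻ p, f' a p ^ 2) ^ (1 / 2 : ℝ)
        * (∫⁻ p, g' a p ^ 2) ^ (1 / 2 : ℝ)) := by
    intro a
    refine (hloc a _ _ k (mf1 a) (mg1 a) hk).trans (le_of_eq ?_)
    ring
  have mF : Measurable fun a => ∫⁻ p, f' a p ^ 2 :=
    Measurable.lintegral_prod_right' (f := fun w : ℝ × Freq => f' w.1 w.2 ^ 2) (by fun_prop)
  have mG : Measurable fun a => ∫⁻ p, g' a p ^ 2 :=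
    Measurable.lintegral_prod_right' (f := fun w : ℝ × Freq => g' w.1 w.2 ^ 2) (by fun_prop)
  have hFint : ∫⁻ a, ∫⁻ p, f' a p ^ 2 = 2 * ∫⁻ p, f p ^ 2 := by
    rw [lintegral_lintegral_swap (by
      exact Measurable.aemeasurable (by simp only [Function.uncurry_def]; fun_prop))]
    have := fun p => sec ψ₁ f 1 (by norm_num) p
    simp only [hf', hE, this]
    rw [lintegral_const_mul _ (by fun_prop)]; norm_num
  have hGint : ∫⁻ a, ∫⁻ p, g' a p ^ 2 = 4 * ∫⁻ p, g p ^ 2 := by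
    rw [lintegral_lintegral_swap (by
      exact Measurable.aemeasurable (by simp only [Function.uncurry_def]; fun_prop))]
    have := fun p => sec ψ₂ g 2 (by norm_num) p
    simp only [hg', hF, this]
    rw [lintegral_const_mul _ (by fun_prop)]; norm_num
  have h2 := hlow.trans (lintegral_mono hup)
  rw [lintegral_const_mul _ (by fun_prop)] at h2
  -- Cauchy-Schwarz in `a`. Integrated over `a`, the localized pieces have squared norms `2‖f‖²` and
  -- `4‖g‖²`, so the loss after division by 2 is `√2`, rounded up to 2.
  have h3 := lintegral_mul_le_sqrt (μ := (volume : Measure ℝ))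
    (mF.pow_const (1 / 2 : ℝ)).aemeasurable (mG.pow_const (1 / 2 : ℝ)).aemeasurable
  simp_rw [ENNReal.rpow_half_sq] at h3
  replace h2 := h2.trans (mul_le_mul_right h3 _)
  rw [hFint, hGint, ENNReal.mul_rpow_half, ENNReal.mul_rpow_half] at h2
  have h24 : (2 : ℝ≥0∞) ^ (1 / 2 : ℝ) ≤ 2 := by
    calc (2 : ℝ≥0∞) ^ (1 / 2 : ℝ) ≤ 2 ^ (1 : ℝ) :=
          ENNReal.rpow_le_rpow_of_exponent_le (by norm_num) (by norm_num)
      _ = 2 := by simp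
  have h4 : (4 : ℝ≥0∞) ^ (1 / 2 : ℝ) = 2 := by
    rw [show (4 : ℝ≥0∞) = 2 ^ 2 by norm_num, ENNReal.sq_rpow_half]
  rw [h4] at h2
  rw [← ENNReal.mul_le_mul_iff_right (a := 2) (by norm_num) (by norm_num)]
  refine h2.trans ?_
  calc _ ≤ B * (∫⁻ p, k p ^ 2) ^ (1 / 2 : ℝ) * (2 * (∫⁻ p, f p ^ 2) ^ (1 / 2 : ℝ) *
        (2 * (∫⁻ p, g p ^ 2) ^ (1 / 2 : ℝ))) := by gcongr
    _ = _ := by ring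

end TrilinearBound

/-! ### Changes of variables along the phase -/

/-- Strict monotonicity on an interval makes `φ` injective, so the change of variables covers each
value at most once. -/
theorem lintegral_abs_deriv_mul_comp_le_of_pos {s : Set ℝ} (hs : Convex ℝ s) {φ φ' : ℝ → ℝ}
    (hφ : ∀ x ∈ s, HasDerivAt φ (φ' x) x) (hpos : ∀ x ∈ s, 0 < φ' x) (H : ℝ → ℝ≥0∞) :
    ∫⁻ x in s, ENNReal.ofReal |φ' x| * H (φ x) ≤ ∫⁻ y, H y := by
  have hinj : Set.InjOn φ s := by
    refine StrictMonoOn.injOn (strictMonoOn_of_hasDerivWithinAt_pos hs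
      (fun x hx => (hφ x hx).continuousAt.continuousWithinAt) (f' := φ') ?_ ?_)
    · exact fun x hx => (hφ x (interior_subset hx)).hasDerivWithinAt
    · exact fun x hx => hpos x (interior_subset hx)
  rw [← lintegral_image_eq_lintegral_abs_deriv_mul hs.ordConnected.measurableSet
    (fun x hx => (hφ x hx).hasDerivWithinAt) hinj]
  exact setLIntegral_le_lintegral _ _

theorem lintegral_abs_deriv_mul_comp_le_of_neg {s : Set ℝ} (hs : Convex ℝ s) {φ φ' : ℝ → ℝ}
    (hφ : ∀ x ∈ s, HasDerivAt φ (φ' x) x) (hneg : ∀ x ∈ s, φ' x < 0) (H : ℝ → ℝ≥0∞) :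
    ∫⁻ x in s, ENNReal.ofReal |φ' x| * H (φ x) ≤ ∫⁻ y, H y := by
  have := lintegral_abs_deriv_mul_comp_le_of_pos hs (φ := fun x => -φ x) (φ' := fun x => -φ' x)
    (fun x hx => (hφ x hx).neg) (fun x hx => neg_pos.2 (hneg x hx)) (fun y => H (-y))
  simpa [lintegral_neg_eq_self] using this

theorem lintegral_eq_abs_mul_lintegral_comp_mul {a : ℝ} (ha : a ≠ 0) {H : ℝ → ℝ≥0∞} :
    ∫⁻ y, H y = ENNReal.ofReal |a| * ∫⁻ x, H (x * a) := by
  conv_lhs => rw [← Real.smul_map_volume_mul_right ha]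
  rw [lintegral_smul_measure, smul_eq_mul]
  congr 1
  exact (Homeomorph.mulRight₀ a ha).measurableEmbedding.lintegral_map H

/-- The modulation as a function on the frequency space. -/
noncomputable def modulation (c : ℝ) (p : Freq) : ℝ := kpModulation c p.1 p.2.1 p.2.2

@[fun_prop]
theorem measurable_modulation (c : ℝ) : Measurable (modulation c) := by
  unfold modulation kpModulation
  fun_prop

/-- The difference of the slopes `η / ξ`. -/
noncomputable def slopeGap (p q : Freq) : ℝ := p.2.2 / p.2.1 - q.2.2 / q.2.1

@[fun_prop]
theorem measurable_slopeGap : Measurable fun z : Freq × Freq => slopeGap z.1 z.2 := by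
  unfold slopeGap
  fun_prop

/-- Convolution on `ℝ` in `ℝ≥0∞`. -/
noncomputable def selfConv (G : ℝ → ℝ≥0∞) (x : ℝ) : ℝ≥0∞ := ∫⁻ t, G t * G (x - t)

theorem measurable_selfConv {G : ℝ → ℝ≥0∞} (hG : Measurable G) : Measurable (selfConv G) :=
  Measurable.lintegral_prod_right' (f := fun w : ℝ × ℝ => G w.2 * G (w.1 - w.2)) (by fun_prop)

theorem lintegral_selfConv {G : ℝ → ℝ≥0∞} (hG : Measurable G) :
    ∫⁻ x, selfConv G x = (∫⁻ x, G x) ^ 2 := by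
  unfold selfConv
  rw [lintegral_lintegral_swap (by
    exact Measurable.aemeasurable (by simp only [Function.uncurry_def]; fun_prop))]
  have : ∀ t, ∫⁻ x, G t * G (x - t) = G t * ∫⁻ x, G x := by
    intro t
    rw [lintegral_const_mul _ (by fun_prop), lintegral_sub_right_eq_self]
  simp_rw [this]
  rw [lintegral_mul_const _ (by fun_prop), sq]

/-- The modulation is `τ` plus a function of `(ξ, η)`, so the integral in `t` is a translated
convolution. Afterwards only the phase in the spatial frequencies matters. -/
theorem lintegral_modulation_mul {G : ℝ → ℝ≥0∞} (c τ ξ₁ η₁ ξ₂ η₂ : ℝ) :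
    ∫⁻ t, G (modulation c (t, ξ₁, η₁)) * G (modulation c (τ - t, ξ₂, η₂)) =
      selfConv G (kpModulation c τ ξ₁ η₁ + kpModulation c 0 ξ₂ η₂) := by
  unfold selfConv
  rw [← lintegral_add_right_eq_self (μ := volume)
    (fun t => G t * G (kpModulation c τ ξ₁ η₁ + kpModulation c 0 ξ₂ η₂ - t))
    (kpModulation c 0 ξ₁ η₁)]
  refine lintegral_congr fun t => ?_
  unfold modulation kpModulation
  congr 2 <;> ring

theorem lintegral_modulation {G : ℝ → ℝ≥0∞} (c ξ η : ℝ) :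
    ∫⁻ t, G (modulation c (t, ξ, η)) = ∫⁻ x, G x := by
  rw [← lintegral_add_right_eq_self G (kpModulation c 0 ξ η)]
  refine lintegral_congr fun t => ?_
  unfold modulation kpModulation
  congr 1; ring

/-- At a fixed sum `p` of the frequencies, integration of functions of `(ξ₁, η₁)`. -/
theorem lintegral_mul_modulation {G : ℝ → ℝ≥0∞} (hG : Measurable G) (c : ℝ) (p : Freq)
    {K : ℝ → ℝ → ℝ≥0∞}
    (hK : Measurable (Function.uncurry K)) :
    ∫⁻ q : Freq, K q.2.1 q.2.2 * (G (modulation c q) * G (modulation c (p - q))) =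
      ∫⁻ x, ∫⁻ y, K x y *
        selfConv G (kpModulation c p.1 x y + kpModulation c 0 (p.2.1 - x) (p.2.2 - y)) := by
  have hK' : Measurable fun q : ℝ × ℝ => K q.1 q.2 := hK
  have hK2 : Measurable fun q : Freq => K q.2.1 q.2.2 := hK'.comp measurable_snd
  have hs := measurable_selfConv hG
  rw [Measure.volume_eq_prod, lintegral_prod_symm' _ (by fun_prop), Measure.volume_eq_prod,
    lintegral_prod]
  · refine lintegral_congr fun x => lintegral_congr fun y => ?_
    rw [← lintegral_modulation_mul]
    exact lintegral_const_mul (K x y) (f := fun t => G (modulation c (t, x, y)) *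
      G (modulation c (p.1 - t, p.2.1 - x, p.2.2 - y))) (by fun_prop)
  · exact Measurable.aemeasurable (Measurable.lintegral_prod_left'
      (f := fun z : ℝ × (ℝ × ℝ) => K z.2.1 z.2.2 * (G (modulation c (z.1, z.2)) *
        G (modulation c (p - (z.1, z.2))))) (by fun_prop))

theorem hasDerivAt_phase_eta {c τ ξ₁ ξ₂ η y : ℝ} :
    HasDerivAt (fun y => kpModulation c τ ξ₁ y + kpModulation c 0 ξ₂ (η - y))
      (2 * (y / ξ₁ - (η - y) / ξ₂)) y := by
  unfold kpModulation
  have h1 : HasDerivAt (fun y : ℝ => y ^ 2 / ξ₁) (2 * y / ξ₁) y := by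
    simpa using (hasDerivAt_pow 2 y).div_const ξ₁
  have h2 : HasDerivAt (fun y : ℝ => (η - y) ^ 2 / ξ₂) (-(2 * (η - y)) / ξ₂) y := by
    have := (((hasDerivAt_id y).const_sub η).pow 2).div_const ξ₂
    simpa using this
  have := (h1.const_add (τ - ξ₁ ^ 3 - c * ξ₁)).add (h2.const_add (0 - ξ₂ ^ 3 - c * ξ₂))
  refine this.congr_deriv ?_
  ring

/-- The phase is at most quadratic in `y` with derivative `2θ`, and `θ` is affine. It is monotone on
each of the sets `θ > 0` and `θ < 0`, which gives the factor 2; where `θ = 0` the integrand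
vanishes. -/
theorem lintegral_slopeGap_mul_le_inner {G : ℝ → ℝ≥0∞} (hG : Measurable G) (c τ ξ₁ ξ₂ η : ℝ) :
    ∫⁻ y, ENNReal.ofReal |y / ξ₁ - (η - y) / ξ₂| *
      selfConv G (kpModulation c τ ξ₁ y + kpModulation c 0 ξ₂ (η - y)) ≤
      2 * (∫⁻ x, G x) ^ 2 := by
  set H := selfConv G with hH
  have hHm : Measurable H := measurable_selfConv hG
  set θ : ℝ → ℝ := fun y => y / ξ₁ - (η - y) / ξ₂ with hθ
  have hlin : IsLinearMap ℝ fun y : ℝ => (1 / ξ₁ + 1 / ξ₂) * y :=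
    ⟨fun x y => by ring, fun a x => by simp; ring⟩
  have hθm : Measurable θ := by fun_prop
  have e : ∀ y, θ y = (1 / ξ₁ + 1 / ξ₂) * y - η / ξ₂ := fun y => by simp only [hθ]; ring
  have c1 : Convex ℝ {y | 0 < θ y} := by
    have : {y | 0 < θ y} = {w | η / ξ₂ < (1 / ξ₁ + 1 / ξ₂) * w} := by ext y; simp [e]
    rw [this]
    exact convex_halfSpace_gt hlin (η / ξ₂)
  have c2 : Convex ℝ {y | θ y < 0} := by
    have : {y | θ y < 0} = {w | (1 / ξ₁ + 1 / ξ₂) * w < η / ξ₂} := by ext y; simp [e]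
    rw [this]
    exact convex_halfSpace_lt hlin (η / ξ₂)
  set φ : ℝ → ℝ := fun y => kpModulation c τ ξ₁ y + kpModulation c 0 ξ₂ (η - y)
  have i1 := lintegral_abs_deriv_mul_comp_le_of_pos c1 (φ := φ) (φ' := fun y => 2 * θ y)
    (fun x _ => hasDerivAt_phase_eta) (fun x hx => by
      have : 0 < θ x := hx
      positivity) H
  have i2 := lintegral_abs_deriv_mul_comp_le_of_neg c2 (φ := φ) (φ' := fun y => 2 * θ y)
    (fun x _ => hasDerivAt_phase_eta) (fun x hx => by
      have : θ x < 0 := hx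
      linarith) H
  rw [lintegral_selfConv hG] at i1 i2
  have m1 : MeasurableSet {y | 0 < θ y} := measurableSet_lt (by fun_prop) (by fun_prop)
  have m2 : MeasurableSet {y | θ y < 0} := measurableSet_lt (by fun_prop) (by fun_prop)
  rw [← lintegral_indicator m1] at i1
  rw [← lintegral_indicator m2] at i2
  have hφ : Measurable φ := by
    simp only [φ, kpModulation]; fun_prop
  rw [two_mul]
  refine le_trans ?_ (add_le_add i1 i2)
  rw [← lintegral_add_left]
  · refine lintegral_mono fun y => ?_
    have hle : ENNReal.ofReal |θ y| ≤ ENNReal.ofReal |2 * θ y| := by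
      apply ENNReal.ofReal_le_ofReal
      rw [abs_mul, abs_two]; linarith [abs_nonneg (θ y)]
    rcases lt_trichotomy (θ y) 0 with h | h | h
    · simp only [Set.indicator, Set.mem_ofPred_eq, h, not_lt.2 h.le, if_true, if_false, zero_add]
      gcongr
    · simp [hθ] at h
      simp [h]
    · simp only [Set.indicator, Set.mem_ofPred_eq, h, not_lt.2 h.le, if_true, if_false, add_zero]
      gcongr
  · exact Measurable.indicator (by fun_prop) m1

/-- Integration in `η₁` first: the weight `|θ|` is the Jacobian. -/
theorem lintegral_slopeGap_mul_le {G : ℝ → ℝ≥0∞} (hG : Measurable G) (c : ℝ) (p : Freq)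
    {X : ℝ → ℝ≥0∞} (hX : Measurable X) :
    ∫⁻ q : Freq, X q.2.1 * ENNReal.ofReal |slopeGap q (p - q)| *
      (G (modulation c q) * G (modulation c (p - q))) ≤
      2 * (∫⁻ x, G x) ^ 2 * ∫⁻ x, X x := by
  have hK : Measurable (Function.uncurry fun x y : ℝ =>
      X x * ENNReal.ofReal |y / x - (p.2.2 - y) / (p.2.1 - x)|) := by
    simp only [Function.uncurry_def]; fun_prop
  have := lintegral_mul_modulation hG c p hK
  refine le_trans (le_of_eq this) ?_
  rw [mul_comm, ← lintegral_mul_const _ hX]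
  refine lintegral_mono fun x => ?_
  simp_rw [mul_assoc]
  have hs := measurable_selfConv hG
  rw [lintegral_const_mul]
  · gcongr
    exact lintegral_slopeGap_mul_le_inner hG c p.1 x (p.2.1 - x) p.2.2
  · simp only [kpModulation]; fun_prop

/-- At a fixed first frequency, the frequencies with bounded slope gap. -/
theorem lintegral_slopeGap_le_mul_le {G : ℝ → ℝ≥0∞} (hG : Measurable G) (c : ℝ) (p : Freq)
    {X : ℝ → ℝ≥0∞} (hX : Measurable X) (Θ : ℝ) :
    ∫⁻ q : Freq, X q.2.1 * ({q | |slopeGap p q| ≤ Θ}.indicator 1 q * G (modulation c q)) ≤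
      (∫⁻ x, G x) * ∫⁻ x, X x * ENNReal.ofReal (2 * Θ * |x|) := by
  have hS : MeasurableSet {q : Freq | |slopeGap p q| ≤ Θ} := by
    unfold slopeGap
    exact measurableSet_le (by fun_prop) (by fun_prop)
  have hI : Measurable ({q : Freq | |slopeGap p q| ≤ Θ}.indicator (1 : Freq → ℝ≥0∞)) :=
    measurable_one.indicator hS
  rw [Measure.volume_eq_prod, lintegral_prod_symm' _ (by fun_prop)]
  have h1 : ∀ y : ℝ × ℝ, ∫⁻ t, X y.1 * ({q | |slopeGap p q| ≤ Θ}.indicator 1 (t, y) *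
      G (modulation c (t, y))) = X y.1 *
      ({y : ℝ × ℝ | |p.2.2 / p.2.1 - y.2 / y.1| ≤ Θ}.indicator 1 y) * ∫⁻ x, G x := by
    intro y
    have : ∀ t, X y.1 * ({q | |slopeGap p q| ≤ Θ}.indicator 1 (t, y) *
      G (modulation c (t, y))) = (X y.1 *
      ({y : ℝ × ℝ | |p.2.2 / p.2.1 - y.2 / y.1| ≤ Θ}.indicator 1 y)) * G (modulation c (t, y)) := by
      intro t
      by_cases h : |p.2.2 / p.2.1 - y.2 / y.1| ≤ Θ <;> simp [Set.indicator, slopeGap, h]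
    simp_rw [this]
    rw [lintegral_const_mul _ (by fun_prop)]
    congr 1
    exact lintegral_modulation c y.1 y.2
  have hS2 : MeasurableSet {y : ℝ × ℝ | |p.2.2 / p.2.1 - y.2 / y.1| ≤ Θ} :=
    measurableSet_le (by fun_prop) (by fun_prop)
  have hI2 : Measurable ({y : ℝ × ℝ | |p.2.2 / p.2.1 - y.2 / y.1| ≤ Θ}.indicator
      (1 : ℝ × ℝ → ℝ≥0∞)) := measurable_one.indicator hS2
  refine le_trans (le_of_eq (lintegral_congr h1)) ?_
  rw [lintegral_mul_const _ (by fun_prop), mul_comm]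
  gcongr
  rw [Measure.volume_eq_prod, lintegral_prod _ (by fun_prop)]
  refine lintegral_mono_ae ?_
  have hne : ∀ᵐ x : ℝ, x ≠ 0 := by simp [ae_iff]
  filter_upwards [hne] with x hx
  rw [lintegral_const_mul]
  · gcongr
    -- Clearing the denominator, `|s - y/x| ≤ Θ` puts `y` in an interval of radius `Θ|x|` about `s
    -- x`.
    set s := p.2.2 / p.2.1
    calc _ ≤ ∫⁻ y, (Set.Icc (s * x - Θ * |x|) (s * x + Θ * |x|)).indicator 1 y := by
          refine lintegral_mono fun y => ?_
          simp only [Set.indicator, Set.mem_ofPred_eq, Set.mem_Icc, Pi.one_apply]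
          split_ifs with h1 h2
          · exact le_rfl
          · refine absurd ?_ h2
            have h3 : |s * x - y| ≤ Θ * |x| := by
              calc |s * x - y| = |s - y / x| * |x| := by
                    rw [← abs_mul, sub_mul, div_mul_cancel₀ _ hx]
                _ ≤ _ := by gcongr
            rw [abs_le] at h3
            constructor <;> linarith
          · exact zero_le
          · exact le_rfl
      _ = _ := by
          rw [lintegral_indicator_one measurableSet_Icc, Real.volume_Icc]
          congr 1; ring
  · exact hI2.comp (by fun_prop : Measurable fun y : ℝ => (x, y))

/-- Along the line `y = s x` the first modulation becomes a cubic polynomial in `x`, and the terms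
in `c` cancel. The square of the slope gap is what remains of the terms in `η`. -/
theorem hasDerivAt_phase_slope {c τ ξ η s x : ℝ} (hx : ξ - x ≠ 0) :
    HasDerivAt (fun x => τ - x ^ 3 - c * x + s ^ 2 * x + kpModulation c 0 (ξ - x) (η - s * x))
      (3 * ξ * (ξ - 2 * x) + (s - (η - s * x) / (ξ - x)) ^ 2) x := by
  unfold kpModulation
  have h0 : HasDerivAt (fun x : ℝ => ξ - x) (-1) x := by
    simpa using (hasDerivAt_id x).const_sub ξ
  have h1 : HasDerivAt (fun x : ℝ => η - s * x) (-s) x := by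
    simpa using ((hasDerivAt_id x).const_mul s).const_sub η
  have h2 := (h1.pow 2).div h0 hx
  have h3 := (((h0.pow 3).const_sub 0).sub (h0.const_mul c)).add h2
  have h4 : HasDerivAt (fun x : ℝ => τ - x ^ 3 - c * x + s ^ 2 * x)
      (-(3 * x ^ 2) - c + s ^ 2) x := by
    have := (((hasDerivAt_pow 3 x).const_sub τ).sub ((hasDerivAt_id x).const_mul c)).add
      ((hasDerivAt_id x).const_mul (s ^ 2))
    refine this.congr_deriv ?_
    norm_num
  refine (h4.add h3).congr_deriv ?_
  simp only [Pi.pow_apply]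
  field_simp
  ring

/-- The signs `e₁`, `e₂` stand for those of `ξ - x` and `ξ - 2x`. Once they are chosen, all
conditions are affine in `x`, and the region is an interval on which the phase can serve as a
variable. -/
theorem convex_affine_region (ξ A Θ e₁ e₂ : ℝ) :
    Convex ℝ {x : ℝ | (0 < e₁ * (ξ - x) ∧ |A| ≤ Θ * (e₁ * (ξ - x))) ∧
      (0 < e₂ * (ξ - 2 * x) ∧ Θ ^ 2 ≤ |ξ| * (e₂ * (ξ - 2 * x)))} := by
  intro x hx y hy a b ha hb hab
  obtain ⟨⟨h1, h2⟩, h3, h4⟩ := hx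
  obtain ⟨⟨k1, k2⟩, k3, k4⟩ := hy
  have hb' : b = 1 - a := by linarith
  have ha1 : a ≤ 1 := by linarith
  subst hb'
  simp only [smul_eq_mul]
  rcases ha.eq_or_lt with rfl | ha
  · refine ⟨⟨?_, ?_⟩, ?_, ?_⟩
    all_goals simp only [zero_mul, sub_zero, one_mul, zero_add]; assumption
  · refine ⟨⟨?_, ?_⟩, ?_, ?_⟩
    · nlinarith [mul_pos ha h1, mul_nonneg hb k1.le]
    · nlinarith [mul_le_mul_of_nonneg_left h2 ha.le, mul_le_mul_of_nonneg_left k2 hb]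
    · nlinarith [mul_pos ha h3, mul_nonneg hb k3.le]
    · nlinarith [mul_le_mul_of_nonneg_left h4 ha.le, mul_le_mul_of_nonneg_left k4 hb]

/-- The condition `Θ² ≤ |ξ||2x - ξ|` keeps `θ²` from cancelling `3ξ(ξ - 2x)`: the derivative has the
sign of `ξ(ξ - 2x)` and size at least `|ξ||2x - ξ|`. The two signs in `convex_affine_region` give
four intervals, hence the factor 4. -/
theorem lintegral_transverse_inner_le {G : ℝ → ℝ≥0∞} (hG : Measurable G) (c τ ξ η s Θ : ℝ) :
    ∫⁻ x, {x | |s - (η - s * x) / (ξ - x)| ≤ Θ ∧ Θ ^ 2 ≤ |ξ| * |2 * x - ξ|}.indicator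
      (fun x => ENNReal.ofReal (|ξ| * |2 * x - ξ|) * selfConv G
        (τ - x ^ 3 - c * x + s ^ 2 * x + kpModulation c 0 (ξ - x) (η - s * x))) x ≤
      4 * (∫⁻ x, G x) ^ 2 := by
  by_cases hξ : ξ = 0
  · simp [hξ]
  set H := selfConv G
  have hHm : Measurable H := measurable_selfConv hG
  set φ : ℝ → ℝ := fun x => τ - x ^ 3 - c * x + s ^ 2 * x + kpModulation c 0 (ξ - x) (η - s * x)
    with hφdef
  have hφ : Measurable φ := by simp only [hφdef, kpModulation]; fun_prop
  set φ' : ℝ → ℝ := fun x => 3 * ξ * (ξ - 2 * x) + (s - (η - s * x) / (ξ - x)) ^ 2 with hφ'def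
  have hφ' : Measurable φ' := by fun_prop
  set A := η - s * ξ with hA
  set S : ℝ → ℝ → Set ℝ := fun e₁ e₂ => {x : ℝ | (0 < e₁ * (ξ - x) ∧ |A| ≤ Θ * (e₁ * (ξ - x))) ∧
      (0 < e₂ * (ξ - 2 * x) ∧ Θ ^ 2 ≤ |ξ| * (e₂ * (ξ - 2 * x)))} with hS
  have hgap : ∀ x, ξ - x ≠ 0 → s - (η - s * x) / (ξ - x) = -(A / (ξ - x)) := by
    intro x hx; field_simp; simp only [hA]; ring
  have hSθ : ∀ e₁ e₂ x, |e₁| = 1 → x ∈ S e₁ e₂ →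
      (s - (η - s * x) / (ξ - x)) ^ 2 ≤ Θ ^ 2 := by
    intro e₁ e₂ x he hx
    obtain ⟨⟨h1, h2⟩, -⟩ := hx
    have hx0 : ξ - x ≠ 0 := by rintro h; simp [h] at h1
    have h3 : e₁ * (ξ - x) = |ξ - x| := by
      rw [← abs_of_pos h1, abs_mul, he, one_mul]
    rw [h3] at h1 h2
    rw [hgap x hx0, neg_sq, ← sq_abs, abs_div]
    gcongr
    rwa [div_le_iff₀ h1]
  have hSm : ∀ e₁ e₂, MeasurableSet (S e₁ e₂) := fun e₁ e₂ =>
    (convex_affine_region ξ A Θ e₁ e₂).ordConnected.measurableSet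
  have hbound : ∀ e₁ e₂ : ℝ, |e₁| = 1 → |e₂| = 1 →
      ∫⁻ x, (S e₁ e₂).indicator (fun x => ENNReal.ofReal |φ' x| * H (φ x)) x ≤
        (∫⁻ x, G x) ^ 2 := by
    intro e₁ e₂ he₁ he₂
    rw [lintegral_indicator (hSm e₁ e₂), ← lintegral_selfConv hG]
    have hd : ∀ x ∈ S e₁ e₂, HasDerivAt φ (φ' x) x := by
      intro x hx
      refine hasDerivAt_phase_slope ?_
      rintro h
      have := hx.1.1
      simp [h] at this
    have hprod : ∀ x ∈ S e₁ e₂, e₂ * (ξ - 2 * x) = |ξ - 2 * x| := by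
      intro x hx
      rw [← abs_of_pos hx.2.1, abs_mul, he₂, one_mul]
    have hsign : ∀ x ∈ S e₁ e₂, ξ - 2 * x = e₂ * |ξ - 2 * x| := by
      intro x hx
      rw [← hprod x hx, ← mul_assoc, ← sq, ← sq_abs, he₂]; ring
    -- The sign of `ξ e₂` is that of `ξ(ξ - 2x)`. If it is positive both terms of the derivative
    -- help; otherwise `θ² ≤ Θ²` takes away at most a third of the main term.
    rcases lt_or_ge 0 (ξ * e₂) with h | h
    · refine lintegral_abs_deriv_mul_comp_le_of_pos (convex_affine_region ξ A Θ e₁ e₂) hd ?_ H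
      intro x hx
      have h1 : 0 < |ξ - 2 * x| := by rw [← hprod x hx]; exact hx.2.1
      simp only [hφ'def]
      rw [hsign x hx]
      have := mul_pos h h1
      nlinarith [sq_nonneg (s - (η - s * x) / (ξ - x))]
    · refine lintegral_abs_deriv_mul_comp_le_of_neg (convex_affine_region ξ A Θ e₁ e₂) hd ?_ H
      intro x hx
      have h1 : 0 < |ξ - 2 * x| := by rw [← hprod x hx]; exact hx.2.1
      have h2 : ξ * e₂ = -|ξ| := by
        have h3 := abs_of_nonpos h
        rw [abs_mul, he₂, mul_one] at h3
        linarith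
      have h3 : ξ * (ξ - 2 * x) = -(|ξ| * |ξ - 2 * x|) := by
        conv_lhs => rw [hsign x hx]
        rw [← mul_assoc, h2]; ring
      have h4 := hSθ e₁ e₂ x he₁ hx
      have h5 := hx.2.2
      rw [hprod x hx] at h5
      have h6 : 0 < |ξ| * |ξ - 2 * x| := mul_pos (abs_pos.2 hξ) h1
      simp only [hφ'def]
      nlinarith
  have hne : ∀ᵐ x : ℝ, x ≠ ξ := by simp [ae_iff]
  set F : ℝ → ℝ → ℝ → ℝ≥0∞ := fun e₁ e₂ x =>
    (S e₁ e₂).indicator (fun x => ENNReal.ofReal |φ' x| * H (φ x)) x with hF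
  have hFm : ∀ e₁ e₂, Measurable (F e₁ e₂) := fun e₁ e₂ =>
    Measurable.indicator (by fun_prop) (hSm e₁ e₂)
  calc _ ≤ ∫⁻ x, ((F 1 1 x + F 1 (-1) x) + (F (-1) 1 x + F (-1) (-1) x)) := by
        refine lintegral_mono_ae ?_
        filter_upwards [hne] with x hx
        have hx0 : ξ - x ≠ 0 := sub_ne_zero.2 hx.symm
        by_cases hmem : x ∈ {x | |s - (η - s * x) / (ξ - x)| ≤ Θ ∧ Θ ^ 2 ≤ |ξ| * |2 * x - ξ|}
        swap
        · rw [Set.indicator_of_notMem hmem]; exact zero_le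
        rw [Set.indicator_of_mem hmem]
        obtain ⟨h1, h2⟩ := hmem
        by_cases h20 : ξ - 2 * x = 0
        · simp [show 2 * x - ξ = 0 by linarith]
        rw [hgap x hx0, abs_neg, abs_div, div_le_iff₀ (abs_pos.2 hx0)] at h1
        rw [abs_sub_comm] at h2
        obtain ⟨e₁, he₁, hs₁⟩ : ∃ e : ℝ, (e = 1 ∨ e = -1) ∧ e * (ξ - x) = |ξ - x| := by
          rcases le_total 0 (ξ - x) with h | h
          · exact ⟨1, Or.inl rfl, by rw [abs_of_nonneg h, one_mul]⟩
          · exact ⟨-1, Or.inr rfl, by rw [abs_of_nonpos h, neg_one_mul]⟩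
        obtain ⟨e₂, he₂, hs₂⟩ : ∃ e : ℝ, (e = 1 ∨ e = -1) ∧ e * (ξ - 2 * x) = |ξ - 2 * x| := by
          rcases le_total 0 (ξ - 2 * x) with h | h
          · exact ⟨1, Or.inl rfl, by rw [abs_of_nonneg h, one_mul]⟩
          · exact ⟨-1, Or.inr rfl, by rw [abs_of_nonpos h, neg_one_mul]⟩
        have he₁' : |e₁| = 1 := by rcases he₁ with rfl | rfl <;> simp
        have hS' : x ∈ S e₁ e₂ := by
          refine ⟨⟨?_, ?_⟩, ?_, ?_⟩
          · rw [hs₁]; exact abs_pos.2 hx0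
          · rw [hs₁]; exact h1
          · rw [hs₂]; exact abs_pos.2 h20
          · rw [hs₂]; exact h2
        have hle : ENNReal.ofReal (|ξ| * |2 * x - ξ|) * H (φ x) ≤ F e₁ e₂ x := by
          simp only [hF]
          rw [Set.indicator_of_mem hS']
          gcongr
          have h4 := hSθ e₁ e₂ x he₁' hS'
          have h5 : |ξ| * |2 * x - ξ| = |ξ * (ξ - 2 * x)| := by
            rw [abs_mul, abs_sub_comm (2 * x)]
          have h6 : Θ ^ 2 ≤ |ξ * (ξ - 2 * x)| := by rw [abs_mul]; exact h2
          rw [h5]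
          simp only [hφ'def]
          have h7 := sq_nonneg (s - (η - s * x) / (ξ - x))
          rcases abs_cases (ξ * (ξ - 2 * x)) with ⟨h8, h9⟩ | ⟨h8, h9⟩
          · refine le_trans ?_ (le_abs_self _)
            nlinarith
          · refine le_trans ?_ (neg_le_abs _)
            nlinarith
        refine hle.trans ?_
        rcases he₁ with rfl | rfl <;> rcases he₂ with rfl | rfl
        · exact le_add_right (le_add_right le_rfl)
        · exact le_add_right (le_add_left le_rfl)
        · exact le_add_left (le_add_right le_rfl)
        · exact le_add_left (le_add_left le_rfl)
    _ ≤ ((∫⁻ x, G x) ^ 2 + (∫⁻ x, G x) ^ 2) + ((∫⁻ x, G x) ^ 2 + (∫⁻ x, G x) ^ 2) := by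
        have m11 := hFm 1 1
        have m12 := hFm 1 (-1)
        rw [lintegral_add_left (f := fun x => F 1 1 x + F 1 (-1) x) (by fun_prop),
          lintegral_add_left (hFm 1 1), lintegral_add_left (hFm (-1) 1)]
        gcongr <;> apply hbound <;> simp
    _ = _ := by ring

/-- Integration in `ξ₁` first, at a fixed slope `η₁ / ξ₁`, where the gap of the slopes is too
small to cancel the resonance. -/
theorem lintegral_transverse_le {G : ℝ → ℝ≥0∞} (hG : Measurable G) (c : ℝ) (p : Freq)
    {Y : ℝ → ℝ≥0∞} (hY : Measurable Y) (Θ : ℝ) :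
    ∫⁻ q : Freq, {q : Freq | |slopeGap q (p - q)| ≤ Θ ∧
        Θ ^ 2 ≤ |p.2.1| * |2 * q.2.1 - p.2.1|}.indicator
      (fun q => Y (q.2.2 / q.2.1) * ENNReal.ofReal (|p.2.1| * |2 * q.2.1 - p.2.1| / |q.2.1|)) q *
      (G (modulation c q) * G (modulation c (p - q))) ≤
      4 * (∫⁻ x, G x) ^ 2 * ∫⁻ x, Y x := by
  set ξ := p.2.1
  set η := p.2.2
  set T : Set (ℝ × ℝ) := {y | |y.2 / y.1 - (η - y.2) / (ξ - y.1)| ≤ Θ ∧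
    Θ ^ 2 ≤ |ξ| * |2 * y.1 - ξ|} with hT
  have hTm : MeasurableSet T :=
    (measurableSet_le (by fun_prop) (by fun_prop)).and
      (measurableSet_le (by fun_prop) (by fun_prop))
  set K : ℝ → ℝ → ℝ≥0∞ := fun x y => T.indicator
    (fun y => Y (y.2 / y.1) * ENNReal.ofReal (|ξ| * |2 * y.1 - ξ| / |y.1|)) (x, y) with hK
  have hKm : Measurable (Function.uncurry K) := Measurable.indicator (by fun_prop) hTm
  have hKm' : Measurable fun w : ℝ × ℝ => K w.1 w.2 := hKm
  set H := selfConv G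
  have hHm : Measurable H := measurable_selfConv hG
  refine le_trans (le_of_eq (lintegral_mul_modulation hG c p hKm)) ?_
  have hmod : Measurable fun w : ℝ × ℝ => kpModulation c p.1 w.1 w.2
      + kpModulation c 0 (ξ - w.1) (η - w.2) := by
    unfold kpModulation; fun_prop
  have hne : ∀ᵐ x : ℝ, x ≠ 0 := by simp [ae_iff]
  have hmul : Measurable fun w : ℝ × ℝ => (w.1, w.2 * w.1) := by fun_prop
  have hbig : Measurable fun w : ℝ × ℝ => ENNReal.ofReal |w.1| * (K w.1 (w.2 * w.1) *
      H (kpModulation c p.1 w.1 (w.2 * w.1) + kpModulation c 0 (ξ - w.1) (η - w.2 * w.1))) :=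
    Measurable.mul (by fun_prop) ((hKm'.comp hmul).mul (hHm.comp (hmod.comp hmul)))
  calc _ ≤ ∫⁻ x, ∫⁻ s, ENNReal.ofReal |x| * (K x (s * x) *
        H (kpModulation c p.1 x (s * x) + kpModulation c 0 (ξ - x) (η - s * x))) := by
        refine lintegral_mono_ae ?_
        filter_upwards [hne] with x hx
        refine le_of_eq ?_
        -- The substitution `y = s x` trades `η₁` for the slope. Its Jacobian `|x|` cancels the
        -- factor `1/|ξ₁|` in the weight.
        rw [lintegral_eq_abs_mul_lintegral_comp_mul hx, lintegral_const_mul' _ _ (by simp)]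
    _ = ∫⁻ s, ∫⁻ x, ENNReal.ofReal |x| * (K x (s * x) *
        H (kpModulation c p.1 x (s * x) + kpModulation c 0 (ξ - x) (η - s * x))) :=
        lintegral_lintegral_swap hbig.aemeasurable
    _ ≤ ∫⁻ s, Y s * (4 * (∫⁻ x, G x) ^ 2) := by
        refine lintegral_mono fun s => ?_
        refine le_trans ?_ (mul_le_mul_right
          (lintegral_transverse_inner_le hG c p.1 ξ η s Θ) (Y s))
        rw [← lintegral_const_mul]
        swap
        · refine Measurable.indicator ?_ ((measurableSet_le (by fun_prop) (by fun_prop)).and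
            (measurableSet_le (by fun_prop) (by fun_prop)))
          unfold kpModulation
          exact Measurable.mul (by fun_prop) (hHm.comp (by fun_prop))
        refine lintegral_mono_ae ?_
        filter_upwards [hne] with x hx
        have e1 : s * x / x = s := by field_simp
        have e2 : kpModulation c p.1 x (s * x) = p.1 - x ^ 3 - c * x + s ^ 2 * x := by
          unfold kpModulation; field_simp
        by_cases hm : (x, s * x) ∈ T
        · have hm' := hm
          simp only [hT, Set.mem_ofPred_eq, e1] at hm'
          simp only [hK]
          rw [Set.indicator_of_mem hm, Set.indicator_of_mem (by exact hm')]
          simp only [e1, e2]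
          have e3 : ENNReal.ofReal (|ξ| * |2 * x - ξ|) =
              ENNReal.ofReal |x| * ENNReal.ofReal (|ξ| * |2 * x - ξ| / |x|) := by
            rw [← ENNReal.ofReal_mul (abs_nonneg x)]
            congr 1
            have := abs_pos.2 hx
            field_simp
          rw [e3]
          refine le_of_eq ?_
          ring
        · simp only [hK]
          rw [Set.indicator_of_notMem hm]
          simp
    _ = _ := by
        rw [lintegral_mul_const _ hY, mul_comm]

/-! ### The three methods as criteria for kernels supported in a region -/

/-- The product of the two modulation factors. -/
noncomputable def modulationProduct (G : ℝ → ℝ≥0∞) (c : ℝ) (z : Freq × Freq) : ℝ≥0∞ :=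
  G (modulation c z.1) * G (modulation c z.2)

theorem measurable_modulationProduct {G : ℝ → ℝ≥0∞} (hG : Measurable G) (c : ℝ) :
    Measurable (modulationProduct G c) := by
  unfold modulationProduct; fun_prop

/-- The squared kernel `m · G(σ₁) G(σ₂)` on the region `R`. -/
noncomputable def regionKernel (G : ℝ → ℝ≥0∞) (c : ℝ) (R : Set (Freq × Freq))
    (m : Freq × Freq → ℝ) : Freq × Freq → ℝ≥0∞ :=
  R.indicator fun z => ENNReal.ofReal (m z) * modulationProduct G c z

section methods

variable {G : ℝ → ℝ≥0∞} {c : ℝ} {R : Set (Freq × Freq)} {m : Freq × Freq → ℝ}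

theorem measurable_regionKernel (hG : Measurable G) (hR : MeasurableSet R) (hm : Measurable m) :
    Measurable (regionKernel G c R m) := by
  have := measurable_modulationProduct hG c
  exact Measurable.indicator (by fun_prop) hR

theorem lintegral_indicator_closedInterval (x₀ L : ℝ) (C : ℝ≥0∞) :
    ∫⁻ x, {x : ℝ | |x - x₀| ≤ L}.indicator (fun _ => C) x = C * ENNReal.ofReal (2 * L) := by
  have h : {x : ℝ | |x - x₀| ≤ L} = Set.Icc (x₀ - L) (x₀ + L) := by
    ext x; simp only [Set.mem_ofPred_eq, Set.mem_Icc, abs_le]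
    constructor <;> rintro ⟨u, v⟩ <;> constructor <;> linarith
  rw [h, lintegral_indicator measurableSet_Icc, setLIntegral_const, Real.volume_Icc]
  congr 2; ring

theorem measurable_indicator_closedInterval (x₀ L : ℝ) (C : ℝ≥0∞) :
    Measurable ({x : ℝ | |x - x₀| ≤ L}.indicator (fun _ => C)) :=
  measurable_const.indicator (measurableSet_le (by fun_prop) (by fun_prop))

/-- Criterion for large slope gaps. At a fixed sum `ξ₁` must stay in an interval of radius `L`, and
the Jacobian `|θ|` has to absorb the multiplier `m` up to the factor `A`. -/
theorem trilinearBound_of_slopeGap (hG : Measurable G) (hR : MeasurableSet R) (hm : Measurable m)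
    {K : ℝ} (h : ∀ p : Freq, ∃ A x₀ L : ℝ, 0 ≤ A ∧ A * (2 * L) ≤ K ∧ ∀ q, (q, p - q) ∈ R →
      |q.2.1 - x₀| ≤ L ∧ m (q, p - q) ≤ A * |slopeGap q (p - q)|) :
    TrilinearBound (regionKernel G c R m)
      ((2 * (∫⁻ x, G x) ^ 2 * ENNReal.ofReal K) ^ (1 / 2 : ℝ)) := by
  refine TrilinearBound.of_sup_sum (measurable_regionKernel hG hR hm) fun p => ?_
  obtain ⟨A, x₀, L, hA, hK, hb⟩ := h p
  rw [ENNReal.rpow_half_sq]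
  set X : ℝ → ℝ≥0∞ := {x : ℝ | |x - x₀| ≤ L}.indicator (fun _ => ENNReal.ofReal A) with hX
  have key := lintegral_slopeGap_mul_le hG c p (X := X) (measurable_indicator_closedInterval _ _ _)
  have hint : ∫⁻ x, X x ≤ ENNReal.ofReal K := by
    rw [hX, lintegral_indicator_closedInterval, ← ENNReal.ofReal_mul hA]
    exact ENNReal.ofReal_le_ofReal hK
  refine le_trans (lintegral_mono fun q => ?_) (key.trans (mul_le_mul_right hint _))
  by_cases hq : (q, p - q) ∈ R
  · obtain ⟨h1, h2⟩ := hb q hq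
    simp only [regionKernel, Set.indicator_of_mem hq, modulationProduct]
    gcongr
    rw [hX, Set.indicator_of_mem (by exact h1), ← ENNReal.ofReal_mul hA]
    exact ENNReal.ofReal_le_ofReal h2
  · simp [regionKernel, hq]

/-- Criterion for small slope gaps. At a fixed sum it is now the slope `η₁/ξ₁` that stays in an
interval of radius `L`, while `ξ₁` is integrated with the resonance as Jacobian. -/
theorem trilinearBound_of_transverse (hG : Measurable G) (hR : MeasurableSet R)
    (hm : Measurable m) {K : ℝ} (h : ∀ p : Freq, ∃ A s₀ L Θ : ℝ, 0 ≤ A ∧ A * (2 * L) ≤ K ∧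
      ∀ q, (q, p - q) ∈ R → |q.2.2 / q.2.1 - s₀| ≤ L ∧ |slopeGap q (p - q)| ≤ Θ ∧
        Θ ^ 2 ≤ |p.2.1| * |2 * q.2.1 - p.2.1| ∧
        m (q, p - q) ≤ A * (|p.2.1| * |2 * q.2.1 - p.2.1| / |q.2.1|)) :
    TrilinearBound (regionKernel G c R m)
      ((4 * (∫⁻ x, G x) ^ 2 * ENNReal.ofReal K) ^ (1 / 2 : ℝ)) := by
  refine TrilinearBound.of_sup_sum (measurable_regionKernel hG hR hm) fun p => ?_
  obtain ⟨A, s₀, L, Θ, hA, hK, hb⟩ := h p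
  rw [ENNReal.rpow_half_sq]
  set Y : ℝ → ℝ≥0∞ := {x : ℝ | |x - s₀| ≤ L}.indicator (fun _ => ENNReal.ofReal A) with hY
  have key := lintegral_transverse_le hG c p (Y := Y) (measurable_indicator_closedInterval _ _ _) Θ
  have hint : ∫⁻ x, Y x ≤ ENNReal.ofReal K := by
    rw [hY, lintegral_indicator_closedInterval, ← ENNReal.ofReal_mul hA]
    exact ENNReal.ofReal_le_ofReal hK
  refine le_trans (lintegral_mono fun q => ?_) (key.trans (mul_le_mul_right hint _))
  by_cases hq : (q, p - q) ∈ R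
  · obtain ⟨h1, h2, h3, h4⟩ := hb q hq
    simp only [regionKernel, Set.indicator_of_mem hq, modulationProduct]
    gcongr
    rw [Set.indicator_of_mem (by exact ⟨h2, h3⟩), hY, Set.indicator_of_mem (by exact h1),
      ← ENNReal.ofReal_mul hA]
    exact ENNReal.ofReal_le_ofReal h4
  · simp [regionKernel, hq]

/-- Criterion without a change of variables in the phase: `G(σ₁)` is bounded by 1 and only `G(σ₂)`
is integrated. The bound is the multiplier times the measure of the admissible `(ξ₂, η₂)`, at most
`2ΘZ · 2L`. -/
theorem trilinearBound_of_left (hG : Measurable G) (hG1 : ∀ x, G x ≤ 1) (hR : MeasurableSet R)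
    (hm : Measurable m) {K : ℝ} (h : ∀ p : Freq, ∃ A x₀ L Z Θ : ℝ, 0 ≤ A ∧ 0 ≤ Θ ∧ 0 ≤ Z ∧
      A * (2 * Θ * Z) * (2 * L) ≤ K ∧ ∀ q, (p, q) ∈ R → |q.2.1 - x₀| ≤ L ∧ |q.2.1| ≤ Z ∧
        |slopeGap p q| ≤ Θ ∧ m (p, q) ≤ A) :
    TrilinearBound (regionKernel G c R m)
      (((∫⁻ x, G x) * ENNReal.ofReal K) ^ (1 / 2 : ℝ)) := by
  refine TrilinearBound.of_sup_left (measurable_regionKernel hG hR hm) fun p => ?_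
  obtain ⟨A, x₀, L, Z, Θ, hA, hΘ, hZ, hK, hb⟩ := h p
  rw [ENNReal.rpow_half_sq]
  set X : ℝ → ℝ≥0∞ := ({x : ℝ | |x - x₀| ≤ L} ∩ {x | |x| ≤ Z}).indicator
    (fun _ => ENNReal.ofReal A) with hX
  have hXm : Measurable X := measurable_const.indicator
    ((measurableSet_le (by fun_prop) (by fun_prop)).inter
      (measurableSet_le (by fun_prop) (by fun_prop)))
  have key := lintegral_slopeGap_le_mul_le hG c p hXm Θ
  have hint : ∫⁻ x, X x * ENNReal.ofReal (2 * Θ * |x|) ≤ ENNReal.ofReal K := by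
    calc _ ≤ ∫⁻ x, {x : ℝ | |x - x₀| ≤ L}.indicator
          (fun _ => ENNReal.ofReal (A * (2 * Θ * Z))) x := by
          refine lintegral_mono fun x => ?_
          by_cases hx : x ∈ {x : ℝ | |x - x₀| ≤ L} ∩ {x | |x| ≤ Z}
          · have hx2 : |x| ≤ Z := hx.2
            rw [hX, Set.indicator_of_mem hx, Set.indicator_of_mem hx.1, ← ENNReal.ofReal_mul hA]
            gcongr
          · simp [hX, Set.indicator_of_notMem hx]
      _ ≤ _ := by
          rw [lintegral_indicator_closedInterval, ← ENNReal.ofReal_mul (by positivity)]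
          exact ENNReal.ofReal_le_ofReal hK
  refine le_trans (lintegral_mono fun q => ?_) (key.trans (mul_le_mul_right hint _))
  by_cases hq : (p, q) ∈ R
  · obtain ⟨h1, h2, h3, h4⟩ := hb q hq
    simp only [regionKernel, Set.indicator_of_mem hq, modulationProduct]
    rw [Set.indicator_of_mem (by exact h3), hX, Set.indicator_of_mem (by exact ⟨h1, h2⟩)]
    simp only [Pi.one_apply]
    gcongr
    exact hG1 _
  · simp [regionKernel, hq]

theorem TrilinearBound.split {B₁ B₂ : ℝ≥0∞} (hG : Measurable G) (hR : MeasurableSet R)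
    (hm : Measurable m) {T : Set (Freq × Freq)} (hT : MeasurableSet T)
    (h₁ : TrilinearBound (regionKernel G c (R ∩ T) m) B₁)
    (h₂ : TrilinearBound (regionKernel G c (R ∩ Tᶜ) m) B₂) :
    TrilinearBound (regionKernel G c R m) (B₁ + B₂) := by
  refine (h₁.add h₂ (measurable_regionKernel hG (hR.inter hT) hm)).mono fun z => ?_
  unfold regionKernel
  by_cases hz : z ∈ R <;> by_cases hT : z ∈ T <;> simp [hz, hT]

end methods

/-! ### Resonance identity and the weights of a dominant output -/

/-- The sum of the two spatial frequencies. -/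
def sumXi (z : Freq × Freq) : ℝ := z.1.2.1 + z.2.2.1

@[fun_prop]
theorem measurable_sumXi : Measurable sumXi := by unfold sumXi; fun_prop

/-- The cubic terms give `3 ξ₁ ξ₂ (ξ₁ + ξ₂)`, the quotients `η²/ξ` combine to a square of the slope
gap with the same sign, and the linear term `cξ` drops out. -/
theorem modulation_resonance (c : ℝ) {p q : Freq} (h₁ : p.2.1 ≠ 0) (h₂ : q.2.1 ≠ 0)
    (h₃ : p.2.1 + q.2.1 ≠ 0) :
    modulation c p + modulation c q - modulation c (p + q) =
      p.2.1 * q.2.1 * (3 * (p.2.1 + q.2.1) + slopeGap p q ^ 2 / (p.2.1 + q.2.1)) := by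
  unfold modulation kpModulation slopeGap
  simp only [Prod.fst_add, Prod.snd_add]
  field_simp
  ring

/-- The region where the frequencies do not vanish and the output has the largest modulation. -/
def dominantRegion (c : ℝ) : Set (Freq × Freq) :=
  {z | z.1.2.1 ≠ 0 ∧ z.2.2.1 ≠ 0 ∧ sumXi z ≠ 0 ∧
    |modulation c z.1| ≤ |modulation c (z.1 + z.2)| ∧
    |modulation c z.2| ≤ |modulation c (z.1 + z.2)|}

theorem measurableSet_dominantRegion (c : ℝ) : MeasurableSet (dominantRegion c) := by
  unfold dominantRegion
  refine MeasurableSet.and ?_ (MeasurableSet.and ?_ (MeasurableSet.and ?_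
    (MeasurableSet.and ?_ ?_)))
  · exact (measurableSet_eq_fun (by fun_prop) (by fun_prop)).compl
  · exact (measurableSet_eq_fun (by fun_prop) (by fun_prop)).compl
  · exact (measurableSet_eq_fun (by fun_prop) (by fun_prop)).compl
  · exact measurableSet_le (by fun_prop) (by fun_prop)
  · exact measurableSet_le (by fun_prop) (by fun_prop)

theorem one_le_bracket {E : Type*} [Norm E] (x : E) : 1 ≤ bracket x := by
  unfold bracket
  rw [Real.one_le_sqrt]
  nlinarith [sq_nonneg ‖x‖]

theorem abs_le_bracket (x : ℝ) : |x| ≤ bracket x := by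
  unfold bracket
  apply Real.le_sqrt_of_sq_le
  rw [Real.norm_eq_abs]; linarith

theorem bracket_le_one_add (x : ℝ) : bracket x ≤ 1 + |x| := by
  unfold bracket
  rw [Real.sqrt_le_left (by positivity), Real.norm_eq_abs]
  nlinarith [abs_nonneg x]

theorem bracket_pos {E : Type*} [Norm E] (x : E) : 0 < bracket x :=
  lt_of_lt_of_le one_pos (one_le_bracket x)

@[fun_prop]
theorem measurable_bracket : Measurable (bracket : ℝ → ℝ) := by
  unfold bracket; fun_prop

/-- The two terms of the resonance add in absolute value since both carry the sign of the output
frequency. The three modulations on the left are each at most the dominant one, hence the 3. -/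
theorem resonance_le (c : ℝ) {z : Freq × Freq} (hz : z ∈ dominantRegion c) :
    |z.1.2.1| * |z.2.2.1| * (3 * |sumXi z| + slopeGap z.1 z.2 ^ 2 / |sumXi z|) ≤
      3 * |modulation c (z.1 + z.2)| := by
  obtain ⟨h1, h2, h3, h4, h5⟩ := hz
  have h := modulation_resonance c h1 h2 h3
  have e : |z.1.2.1 * z.2.2.1 * (3 * sumXi z + slopeGap z.1 z.2 ^ 2 / sumXi z)| =
      |z.1.2.1| * |z.2.2.1| * (3 * |sumXi z| + slopeGap z.1 z.2 ^ 2 / |sumXi z|) := by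
    rw [abs_mul, abs_mul]
    congr 1
    rcases lt_or_gt_of_ne h3 with h | h
    · rw [abs_of_neg h, abs_of_nonpos]
      · rw [div_neg]; ring
      · have := div_nonpos_of_nonneg_of_nonpos (sq_nonneg (slopeGap z.1 z.2)) h.le
        linarith
    · rw [abs_of_pos h, abs_of_nonneg]
      positivity
  rw [← e]
  unfold sumXi
  rw [← h]
  have h6 := neg_abs_le (modulation c (z.1 + z.2))
  have h7 := le_abs_self (modulation c (z.1 + z.2))
  rw [abs_le] at h4 h5 ⊢
  constructor <;> linarith [h4.1, h4.2, h5.1, h5.2]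

theorem mul_abs_le_bracket_modulation (c : ℝ) {z : Freq × Freq} (hz : z ∈ dominantRegion c) :
    |sumXi z| * (|z.1.2.1| * |z.2.2.1|) ≤ bracket (modulation c (z.1 + z.2)) := by
  have h := resonance_le c hz
  have h2 := abs_le_bracket (modulation c (z.1 + z.2))
  have h3 : 0 ≤ |z.1.2.1| * |z.2.2.1| * (slopeGap z.1 z.2 ^ 2 / |sumXi z|) := by positivity
  nlinarith

/-- At a fixed sum this localizes the slope of an input near the slope of the output, as the
transverse criterion requires. -/
theorem slope_sub_slope_sum {p q : Freq} (h₁ : p.2.1 ≠ 0) (h₂ : q.2.1 ≠ 0)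
    (h₃ : p.2.1 + q.2.1 ≠ 0) :
    p.2.2 / p.2.1 - (p.2.2 + q.2.2) / (p.2.1 + q.2.1) =
      q.2.1 * slopeGap p q / (p.2.1 + q.2.1) := by
  unfold slopeGap
  field_simp
  ring

theorem rpow_neg_le_mul_rpow_neg {X S k e : ℝ} (hX : 0 < X) (hk : 1 ≤ k) (h : X ≤ k * S)
    (he : 0 ≤ e) (he1 : e ≤ 1) : S ^ (-e) ≤ k * X ^ (-e) := by
  have hk0 : 0 < k := by linarith
  have h1 : X / k ≤ S := by rw [div_le_iff₀ hk0]; linarith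
  calc S ^ (-e) ≤ (X / k) ^ (-e) := Real.rpow_le_rpow_of_nonpos (by positivity) h1 (by linarith)
    _ = k ^ e * X ^ (-e) := by
        rw [Real.div_rpow hX.le hk0.le, Real.rpow_neg hk0.le, div_inv_eq_mul, mul_comm]
    _ ≤ k ^ (1 : ℝ) * X ^ (-e) := by gcongr
    _ = _ := by rw [Real.rpow_one]

theorem one_add_div_cube_rpow_le {S J : ℝ} (hS : 0 < S) (hJ : 0 < J) :
    (1 + S / J ^ 3) ^ (3 / 4 : ℝ) ≤ 1 + S ^ (3 / 4 : ℝ) * J ^ (-(9 / 4) : ℝ) := by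
  calc (1 + S / J ^ 3) ^ (3 / 4 : ℝ) ≤ 1 ^ (3 / 4 : ℝ) + (S / J ^ 3) ^ (3 / 4 : ℝ) :=
        Real.rpow_add_le_add_rpow (by norm_num) (by positivity) (by norm_num) (by norm_num)
    _ = _ := by
        rw [Real.one_rpow, Real.div_rpow hS.le (by positivity), ← Real.rpow_natCast J 3,
          ← Real.rpow_mul hJ.le, Real.rpow_neg hJ.le, div_eq_mul_inv]
        norm_num

/-- The bound for the squared modulation weights of the output. -/
noncomputable def outputFactor (c : ℝ) (z : Freq × Freq) : ℝ :=
  (1 + bracket (modulation c (z.1 + z.2)) / bracket (sumXi z) ^ 3) ^ (3 / 4 : ℝ) *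
    bracket (modulation c (z.1 + z.2)) ^ (-(49 / 50) : ℝ)

@[fun_prop]
theorem measurable_outputFactor (c : ℝ) : Measurable (outputFactor c) := by
  unfold outputFactor
  fun_prop

theorem outputFactor_nonneg (c : ℝ) (z : Freq × Freq) : 0 ≤ outputFactor c z := by
  have := bracket_pos (modulation c (z.1 + z.2))
  have := bracket_pos (sumXi z)
  unfold outputFactor
  positivity

/-- The inner weight is at most `1 + S^{3/4} J^{-9/4}`, and `3/4 - 49/50 = -23/100`. Both remaining
powers of `S` are negative, so a lower bound for `S` from the resonance may be inserted. -/
theorem outputFactor_le (c : ℝ) (z : Freq × Freq) {X k : ℝ} (hX : 0 < X) (hk : 1 ≤ k)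
    (h : X ≤ k * bracket (modulation c (z.1 + z.2))) :
    outputFactor c z ≤ k * X ^ (-(49 / 50) : ℝ) +
      k * (bracket (sumXi z) ^ (-(9 / 4) : ℝ) * X ^ (-(23 / 100) : ℝ)) := by
  unfold outputFactor
  set S := bracket (modulation c (z.1 + z.2))
  set J := bracket (sumXi z)
  have hS : 0 < S := bracket_pos _
  have hJ : 0 < J := bracket_pos _
  calc _ ≤ (1 + S ^ (3 / 4 : ℝ) * J ^ (-(9 / 4) : ℝ)) * S ^ (-(49 / 50) : ℝ) := by
        gcongr; exact one_add_div_cube_rpow_le hS hJ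
    _ = S ^ (-(49 / 50) : ℝ) + J ^ (-(9 / 4) : ℝ) * S ^ (-(23 / 100) : ℝ) := by
        have : S ^ (-(23 / 100) : ℝ) = S ^ (3 / 4 : ℝ) * S ^ (-(49 / 50) : ℝ) := by
          rw [← Real.rpow_add hS]; norm_num
        rw [this]; ring
    _ ≤ k * X ^ (-(49 / 50) : ℝ) + J ^ (-(9 / 4) : ℝ) * (k * X ^ (-(23 / 100) : ℝ)) := by
        gcongr
        · exact rpow_neg_le_mul_rpow_neg hX hk h (by norm_num) (by norm_num)
        · exact rpow_neg_le_mul_rpow_neg hX hk h (by norm_num) (by norm_num)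
    _ = _ := by ring

/-! ### Low frequencies, and a low frequency interacting with a high one -/

section
variable {G : ℝ → ℝ≥0∞}

theorem exists_trilinearBound_low (hG : Measurable G) (hG1 : ∀ x, G x ≤ 1)
    (hI : ∫⁻ x, G x ≠ ∞) : ∃ B : ℝ≥0∞, B ≠ ∞ ∧ ∀ c, TrilinearBound
      (regionKernel G c {z | |z.1.2.1| ≤ 16 ∧ |z.2.2.1| ≤ 16} fun _ => 1) B := by
  have hR : MeasurableSet {z : Freq × Freq | |z.1.2.1| ≤ 16 ∧ |z.2.2.1| ≤ 16} :=
    (measurableSet_le (by fun_prop) (by fun_prop)).and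
      (measurableSet_le (by fun_prop) (by fun_prop))
  have hT : MeasurableSet {z : Freq × Freq | 1 ≤ |slopeGap z.1 z.2|} :=
    measurableSet_le (by fun_prop) (by fun_prop)
  refine ⟨_, ?_, fun c => TrilinearBound.split hG hR measurable_const hT
    (trilinearBound_of_slopeGap hG (hR.inter hT) measurable_const (K := 32) fun p =>
      ⟨1, 0, 16, by norm_num, by norm_num, ?_⟩)
    (trilinearBound_of_left hG hG1 (hR.inter hT.compl) measurable_const (K := 2 * 16 * 32)
      fun p => ⟨1, 0, 16, 16, 1, by norm_num, by norm_num, by norm_num, by norm_num, ?_⟩)⟩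
  · finiteness
  · rintro q ⟨⟨h1, h2⟩, h3⟩
    refine ⟨by simpa using h1, by simpa using! h3⟩
  · rintro q ⟨⟨h1, h2⟩, h3⟩
    refine ⟨by simpa using h2, h2, ?_, le_rfl⟩
    have h3' : ¬ 1 ≤ |slopeGap p q| := h3
    exact (not_le.1 h3').le

/-- The second spatial frequency is much smaller than the output frequency. -/
def lowHighRegion (c : ℝ) : Set (Freq × Freq) :=
  dominantRegion c ∩ {z | |z.2.2.1| ≤ |sumXi z| / 4 ∧ 4 ≤ |sumXi z|}

theorem measurableSet_lowHighRegion (c : ℝ) : MeasurableSet (lowHighRegion c) :=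
  (measurableSet_dominantRegion c).inter ((measurableSet_le (by fun_prop) (by fun_prop)).and
    (measurableSet_le (by fun_prop) (by fun_prop)))

/-- The two regimes meet at `S = M³`. Below it the inner weight is bounded and the first entry of
the minimum gives `M^{1/4} S^{1/50}`; above it the powers of `J` cancel and the second entry gives
`M S^{-23/100}`. At `S = M³` both equal `M^{31/100}`. -/
theorem lowHigh_factor_le {S J M : ℝ} (hS : 1 ≤ S) (hM : 1 ≤ M) (hMJ : M ≤ J)
    (hJM : J ≤ 2 * M) :
    J ^ (9 / 4 : ℝ) * ((1 + S / J ^ 3) ^ (3 / 4 : ℝ) * S ^ (-(49 / 50) : ℝ)) *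
      min (2 * S / M ^ 2) M ≤ 32 * M ^ (31 / 100 : ℝ) := by
  have hM0 : 0 < M := by linarith
  have hS0 : 0 < S := by linarith
  have hJ0 : 0 < J := by linarith
  have h1 : J ^ (9 / 4 : ℝ) ≤ 8 * M ^ (9 / 4 : ℝ) := by
    calc J ^ (9 / 4 : ℝ) ≤ (2 * M) ^ (9 / 4 : ℝ) := by gcongr
      _ = 2 ^ (9 / 4 : ℝ) * M ^ (9 / 4 : ℝ) := Real.mul_rpow (by norm_num) hM0.le
      _ ≤ 2 ^ (3 : ℝ) * M ^ (9 / 4 : ℝ) := by gcongr <;> norm_num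
      _ = _ := by norm_num
  have h2 : (1 + S / J ^ 3) ^ (3 / 4 : ℝ) ≤ (1 + S / M ^ 3) ^ (3 / 4 : ℝ) := by gcongr
  have hmin : 0 ≤ min (2 * S / M ^ 2) M := by positivity
  have h22 : ∀ x : ℝ, 0 ≤ x → x ≤ 2 → x ^ (3 / 4 : ℝ) ≤ 2 := by
    intro x hx hx2
    calc x ^ (3 / 4 : ℝ) ≤ 2 ^ (3 / 4 : ℝ) := by gcongr
      _ ≤ 2 ^ (1 : ℝ) := by gcongr <;> norm_num
      _ = 2 := by norm_num
  rcases le_total S (M ^ 3) with h | h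
  · have h3 : (1 + S / M ^ 3) ^ (3 / 4 : ℝ) ≤ 2 := by
      have : S / M ^ 3 ≤ 1 := by rw [div_le_one (by positivity)]; exact h
      exact h22 _ (by positivity) (by linarith)
    calc _ ≤ 8 * M ^ (9 / 4 : ℝ) * (2 * S ^ (-(49 / 50) : ℝ)) * (2 * S / M ^ 2) := by
          gcongr
          · exact h2.trans h3
          · exact min_le_left _ _
      _ = 32 * (M ^ (9 / 4 : ℝ) * M ^ (-2 : ℝ)) * (S ^ (-(49 / 50) : ℝ) * S ^ (1 : ℝ)) := by
          rw [Real.rpow_neg hM0.le, Real.rpow_one, Real.rpow_two]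
          field_simp
          ring
      _ = 32 * M ^ (1 / 4 : ℝ) * S ^ (1 / 50 : ℝ) := by
          rw [← Real.rpow_add hM0, ← Real.rpow_add hS0]; norm_num
      _ ≤ 32 * M ^ (1 / 4 : ℝ) * (M ^ 3) ^ (1 / 50 : ℝ) := by gcongr
      _ = 32 * M ^ (31 / 100 : ℝ) := by
          rw [← Real.rpow_natCast M 3, ← Real.rpow_mul hM0.le, mul_assoc, ← Real.rpow_add hM0]
          norm_num
  · have h3 : (1 + S / M ^ 3) ^ (3 / 4 : ℝ) ≤ 2 * (S ^ (3 / 4 : ℝ) * M ^ (-(9 / 4) : ℝ)) := by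
      have h4 : 1 ≤ S / M ^ 3 := by rw [one_le_div (by positivity)]; exact h
      calc (1 + S / M ^ 3) ^ (3 / 4 : ℝ) ≤ (2 * (S / M ^ 3)) ^ (3 / 4 : ℝ) := by
            gcongr; linarith
        _ = 2 ^ (3 / 4 : ℝ) * (S / M ^ 3) ^ (3 / 4 : ℝ) :=
            Real.mul_rpow (by norm_num) (by positivity)
        _ ≤ 2 * (S / M ^ 3) ^ (3 / 4 : ℝ) := by gcongr; exact h22 2 (by norm_num) le_rfl
        _ = _ := by
            rw [Real.div_rpow hS0.le (by positivity), ← Real.rpow_natCast M 3,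
              ← Real.rpow_mul hM0.le, Real.rpow_neg hM0.le, div_eq_mul_inv]
            norm_num
    calc _ ≤ 8 * M ^ (9 / 4 : ℝ) * (2 * (S ^ (3 / 4 : ℝ) * M ^ (-(9 / 4) : ℝ)) *
          S ^ (-(49 / 50) : ℝ)) * M := by
          gcongr
          · exact h2.trans h3
          · exact min_le_right _ _
      _ = 16 * (M ^ (9 / 4 : ℝ) * M ^ (-(9 / 4) : ℝ)) *
          (S ^ (3 / 4 : ℝ) * S ^ (-(49 / 50) : ℝ)) * M := by ring
      _ = 16 * M * S ^ (-(23 / 100) : ℝ) := by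
          rw [← Real.rpow_add hM0, ← Real.rpow_add hS0]; norm_num; ring
      _ ≤ 16 * M * (M ^ 3) ^ (-(23 / 100) : ℝ) := by
          gcongr 16 * M * ?_
          exact Real.rpow_le_rpow_of_nonpos (by positivity) h (by norm_num)
      _ = 16 * (M ^ (1 : ℝ) * M ^ (-(69 / 100) : ℝ)) := by
          rw [← Real.rpow_natCast M 3, ← Real.rpow_mul hM0.le, Real.rpow_one]; norm_num; ring
      _ = 16 * M ^ (31 / 100 : ℝ) := by rw [← Real.rpow_add hM0]; norm_num
      _ ≤ _ := by gcongr; norm_num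

/-- The multiplier depends only on the sum `p`. At fixed `p` the resonance confines `ξ₂` to length
about `S/M²`, which offsets the multiplier. The power `9/4` of `⟨ξ⟩`, more than the two derivatives,
is what the input case needs. -/
theorem exists_trilinearBound_lowHigh (hG : Measurable G)
    (hI : ∫⁻ x, G x ≠ ∞) : ∃ B : ℝ≥0∞, B ≠ ∞ ∧ ∀ c, TrilinearBound
      (regionKernel G c (lowHighRegion c)
        fun z => bracket (sumXi z) ^ (9 / 4 : ℝ) * outputFactor c z) B := by
  have hR := measurableSet_lowHighRegion
  have hT : MeasurableSet {z : Freq × Freq | |sumXi z| ^ (1 / 2 : ℝ) ≤ |slopeGap z.1 z.2|} :=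
    measurableSet_le (by fun_prop) (by fun_prop)
  have hm : ∀ c, Measurable fun z => bracket (sumXi z) ^ (9 / 4 : ℝ) * outputFactor c z :=
    fun c => by fun_prop
  -- Since `|ξ₁| ≥ M/2`, the resonance bound `M |ξ₁| |ξ₂| ≤ S` gives `|ξ₂| ≤ 2S/M²`.
  have hmain : ∀ (c : ℝ) (p q : Freq), (q, p - q) ∈ lowHighRegion c →
      4 ≤ |p.2.1| ∧ |p.2.1 - q.2.1| ≤ min (2 * bracket (modulation c p) / |p.2.1| ^ 2) |p.2.1| ∧
      |p.2.1 - q.2.1| ≤ |p.2.1| / 4 ∧ q.2.1 ≠ 0 ∧ p.2.1 - q.2.1 ≠ 0 := by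
    rintro c p q ⟨hd, h1, h2⟩
    have hx : sumXi (q, p - q) = p.2.1 := by simp [sumXi]
    rw [hx] at h1 h2
    simp only [Prod.snd_sub, Prod.fst_sub] at h1
    have hres := mul_abs_le_bracket_modulation c hd
    rw [hx] at hres
    simp only [add_sub_cancel, Prod.snd_sub, Prod.fst_sub] at hres
    have hne1 : q.2.1 ≠ 0 := hd.1
    have hne2 : p.2.1 - q.2.1 ≠ 0 := hd.2.1
    have ha : |p.2.1| / 2 ≤ |q.2.1| := by
      have := abs_sub_abs_le_abs_sub p.2.1 q.2.1
      linarith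
    refine ⟨h2, ?_, h1, hne1, hne2⟩
    rw [le_min_iff]
    refine ⟨?_, by linarith⟩
    rw [le_div_iff₀ (by positivity)]
    have hd0 := abs_nonneg (p.2.1 - q.2.1)
    nlinarith [mul_le_mul_of_nonneg_right ha hd0]
  set W : ℝ → Freq → ℝ := fun c p => bracket p.2.1 ^ (9 / 4 : ℝ) *
    ((1 + bracket (modulation c p) / bracket p.2.1 ^ 3) ^ (3 / 4 : ℝ) *
      bracket (modulation c p) ^ (-(49 / 50) : ℝ)) with hW
  have hWm : ∀ c p q, bracket (sumXi (q, p - q)) ^ (9 / 4 : ℝ) * outputFactor c (q, p - q)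
      = W c p := by
    intro c p q
    simp [outputFactor, sumXi, hW]
  have hW0 : ∀ c p, 0 ≤ W c p := by
    intro c p
    have h1 := bracket_pos (modulation c p)
    have h2 := bracket_pos p.2.1
    simp only [hW]
    positivity
  have hWle : ∀ (c : ℝ) (p : Freq), 1 ≤ |p.2.1| →
      W c p * min (2 * bracket (modulation c p) / |p.2.1| ^ 2) |p.2.1| ≤
        32 * |p.2.1| ^ (31 / 100 : ℝ) := by
    intro c p hp
    refine lowHigh_factor_le (one_le_bracket _) hp (abs_le_bracket _) ?_
    have := bracket_le_one_add p.2.1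
    linarith
  refine ⟨_, ?_, fun c => TrilinearBound.split hG (hR c) (hm c) hT
    (trilinearBound_of_slopeGap hG ((hR c).inter hT) (hm c) (K := 64) fun p => ?_)
    (trilinearBound_of_transverse hG ((hR c).inter hT.compl) (hm c) (K := 320)
      fun p => ?_)⟩
  · finiteness
  · by_cases hp : 4 ≤ |p.2.1|
    swap
    · refine ⟨0, 0, 0, le_rfl, by norm_num, fun q hq => absurd (hmain c p q hq.1).1 hp⟩
    have hM0 : 0 < |p.2.1| := by linarith
    -- The slope gap is at least `M^{1/2}`, more than the loss `M^{31/100}` of `lowHigh_factor_le`.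
    refine ⟨W c p / |p.2.1| ^ (1 / 2 : ℝ), p.2.1,
      min (2 * bracket (modulation c p) / |p.2.1| ^ 2) |p.2.1|, ?_, ?_, ?_⟩
    · have := hW0 c p
      positivity
    · have h1 := hWle c p (by linarith)
      have h2 : |p.2.1| ^ (31 / 100 : ℝ) ≤ |p.2.1| ^ (1 / 2 : ℝ) := by
        exact Real.rpow_le_rpow_of_exponent_le (by linarith) (by norm_num)
      rw [div_mul_eq_mul_div, div_le_iff₀ (by positivity)]
      linarith
    · rintro q ⟨hq, hθ⟩
      obtain ⟨-, h2, -⟩ := hmain c p q hq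
      rw [abs_sub_comm]
      refine ⟨h2, ?_⟩
      rw [hWm, div_mul_eq_mul_div, le_div_iff₀ (by positivity)]
      have h3 : |p.2.1| ^ (1 / 2 : ℝ) ≤ |slopeGap q (p - q)| := by
        simpa [sumXi] using! hθ
      exact mul_le_mul_of_nonneg_left h3 (hW0 c p)
  · by_cases hp : 4 ≤ |p.2.1|
    swap
    · refine ⟨0, 0, 0, 0, le_rfl, by norm_num, fun q hq => absurd (hmain c p q hq.1).1 hp⟩
    have hM0 : 0 < |p.2.1| := by linarith
    set M := |p.2.1| with hM
    set D := min (2 * bracket (modulation c p) / M ^ 2) M with hD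
    have hD0 : 0 ≤ D := by
      have := bracket_pos (modulation c p)
      positivity
    -- The slope differs from that of `p` by `|ξ₂ θ|/M ≤ D M^{1/2}/M`. The Jacobian `M |2ξ₁ -
    -- ξ|/|ξ₁|` is at least `2M/5`, which the constant 5 more than compensates.
    refine ⟨5 * W c p / M, p.2.2 / p.2.1, D * M ^ (1 / 2 : ℝ) / M, M ^ (1 / 2 : ℝ), ?_, ?_, ?_⟩
    · have := hW0 c p
      positivity
    · have h1 := hWle c p (by linarith)
      have h2 : M ^ (31 / 100 : ℝ) * M ^ (1 / 2 : ℝ) ≤ M ^ (2 : ℝ) := by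
        rw [← Real.rpow_add hM0]
        exact Real.rpow_le_rpow_of_exponent_le (by linarith) (by norm_num)
      rw [Real.rpow_two] at h2
      have e : 5 * W c p / M * (2 * (D * M ^ (1 / 2 : ℝ) / M)) =
          10 * (W c p * D) * M ^ (1 / 2 : ℝ) / M ^ 2 := by
        field_simp
        try ring
      rw [e, div_le_iff₀ (by positivity)]
      have h3 := mul_le_mul_of_nonneg_right h1 (by positivity : (0:ℝ) ≤ M ^ (1 / 2 : ℝ))
      nlinarith
    · rintro q ⟨hq, hθ⟩
      obtain ⟨-, h2, h3, hne1, hne2⟩ := hmain c p q hq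
      have hθ' : |slopeGap q (p - q)| ≤ M ^ (1 / 2 : ℝ) := by
        have : ¬ |sumXi (q, p - q)| ^ (1 / 2 : ℝ) ≤ |slopeGap q (p - q)| := hθ
        simp only [sumXi, Prod.snd_sub, Prod.fst_sub, add_sub_cancel] at this
        exact (not_le.1 this).le
      have hpne : p.2.1 ≠ 0 := by rintro h; rw [h] at hM; simp at hM; linarith
      have hq1 : |q.2.1| ≤ 5 / 4 * M := by
        have := abs_sub_abs_le_abs_sub q.2.1 p.2.1
        rw [abs_sub_comm] at this
        linarith
      have hq2 : M / 2 ≤ |2 * q.2.1 - p.2.1| := by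
        have e : 2 * q.2.1 - p.2.1 = p.2.1 - 2 * (p.2.1 - q.2.1) := by ring
        rw [e]
        have := abs_sub_abs_le_abs_sub p.2.1 (2 * (p.2.1 - q.2.1))
        rw [abs_mul, abs_two] at this
        linarith
      refine ⟨?_, hθ', ?_, ?_⟩
      · have := slope_sub_slope_sum (p := q) (q := p - q) hne1 hne2 (by simpa using hpne)
        simp only [Prod.snd_sub, Prod.fst_sub, add_sub_cancel] at this
        rw [this, abs_div, abs_mul]
        gcongr
      · rw [← Real.rpow_natCast, ← Real.rpow_mul hM0.le]
        norm_num
        nlinarith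
      · rw [hWm]
        have hq0 : 0 < |q.2.1| := abs_pos.2 hne1
        have h4 : M * (M / 2) / (5 / 4 * M) ≤ M * |2 * q.2.1 - p.2.1| / |q.2.1| := by
          gcongr
        have e : M * (M / 2) / (5 / 4 * M) = 2 / 5 * M := by field_simp; norm_num
        rw [e] at h4
        calc W c p ≤ 5 * W c p / M * (2 / 5 * M) := by
              rw [show 5 * W c p / M * (2 / 5 * M) = 2 * W c p by field_simp]
              linarith [hW0 c p]
          _ ≤ _ := by
              have := hW0 c p
              gcongr

end

/-! ### Three large comparable frequencies -/

section
variable {G : ℝ → ℝ≥0∞}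

/-- All three spatial frequencies are large and comparable. -/
def comparableRegion (c : ℝ) : Set (Freq × Freq) :=
  dominantRegion c ∩ {z | |z.1.2.1| ≤ 4 * |sumXi z| ∧ |z.2.2.1| ≤ 4 * |sumXi z| ∧
    |sumXi z| ≤ 4 * |z.1.2.1| ∧ |sumXi z| ≤ 4 * |z.2.2.1| ∧ 4 ≤ |sumXi z|}

theorem measurableSet_comparableRegion (c : ℝ) : MeasurableSet (comparableRegion c) :=
  (measurableSet_dominantRegion c).inter ((measurableSet_le (by fun_prop) (by fun_prop)).and
    ((measurableSet_le (by fun_prop) (by fun_prop)).and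
    ((measurableSet_le (by fun_prop) (by fun_prop)).and
    ((measurableSet_le (by fun_prop) (by fun_prop)).and
    (measurableSet_le (by fun_prop) (by fun_prop))))))

/-- The dominant modulation is at least `M³/16`. Both terms of `outputFactor_le` then give the same
power: `2 - 147/50 = 2 - 9/4 - 69/100 = -47/50`. -/
theorem comparable_factor_le {c : ℝ} {z : Freq × Freq} (hz : z ∈ comparableRegion c) :
    sumXi z ^ 2 * outputFactor c z ≤ 32 * |sumXi z| ^ (-(47 / 50) : ℝ) := by
  obtain ⟨hd, -, -, h1, h2, h3⟩ := hz
  set M := |sumXi z| with hM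
  have hM0 : 0 < M := by linarith
  have hres := mul_abs_le_bracket_modulation c hd
  have hS : M ^ 3 ≤ 16 * bracket (modulation c (z.1 + z.2)) := by
    have h4 : M * M ≤ (4 * |z.1.2.1|) * (4 * |z.2.2.1|) := mul_le_mul h1 h2 hM0.le (by positivity)
    nlinarith [mul_le_mul_of_nonneg_left h4 hM0.le]
  have hF := outputFactor_le c z (by positivity) (by norm_num) hS
  have hJ : bracket (sumXi z) ^ (-(9 / 4) : ℝ) ≤ M ^ (-(9 / 4) : ℝ) :=
    Real.rpow_le_rpow_of_nonpos hM0 (abs_le_bracket _) (by norm_num)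
  have e : ∀ a : ℝ, (M ^ 3) ^ a = M ^ (3 * a) := fun a => by
    rw [← Real.rpow_natCast M 3, ← Real.rpow_mul hM0.le]; norm_num
  rw [e, e] at hF
  have e2 : sumXi z ^ 2 = M ^ (2 : ℝ) := by rw [hM, Real.rpow_two, sq_abs]
  rw [e2]
  calc _ ≤ M ^ (2 : ℝ) * (16 * M ^ (3 * (-(49 / 50) : ℝ)) +
        16 * (M ^ (-(9 / 4) : ℝ) * M ^ (3 * (-(23 / 100) : ℝ)))) := by
        refine mul_le_mul_of_nonneg_left (hF.trans ?_) (by positivity)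
        gcongr
    _ = 16 * (M ^ (2 : ℝ) * M ^ (3 * (-(49 / 50) : ℝ))) +
        16 * (M ^ (2 : ℝ) * M ^ (-(9 / 4) : ℝ) * M ^ (3 * (-(23 / 100) : ℝ))) := by ring
    _ = _ := by
        rw [← Real.rpow_add hM0, ← Real.rpow_add hM0, ← Real.rpow_add hM0]
        norm_num
        ring

theorem rpow_mul_rpow_le_one {N x y : ℝ} (hN : 1 ≤ N) (h : x + y ≤ 0) : N ^ x * N ^ y ≤ 1 := by
  rw [← Real.rpow_add (by linarith)]
  exact Real.rpow_le_one_of_one_le_of_nonpos hN h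

theorem four_mul_rpow_le {x e : ℝ} (hx : 0 ≤ x) (he1 : e ≤ 1) :
    (4 * x) ^ e ≤ 4 * x ^ e := by
  rw [Real.mul_rpow (by norm_num) hx]
  gcongr
  calc (4 : ℝ) ^ e ≤ 4 ^ (1 : ℝ) := Real.rpow_le_rpow_of_exponent_le (by norm_num) he1
    _ = 4 := Real.rpow_one 4

theorem exists_trilinearBound_comparable (hG : Measurable G) (hG1 : ∀ x, G x ≤ 1)
    (hI : ∫⁻ x, G x ≠ ∞) : ∃ B : ℝ≥0∞, B ≠ ∞ ∧ ∀ c, TrilinearBound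
      (regionKernel G c (comparableRegion c) fun z => sumXi z ^ 2 * outputFactor c z) B := by
  have hR := measurableSet_comparableRegion
  -- A gap `|θ| ≥ M^{1/10}` beats the length `M` of the range of `ξ₁`, as `-47/50 - 1/10 + 1 < 0`.
  -- For smaller gaps the transverse Jacobian works unless `ξ₁` and `ξ₂` nearly coincide; the
  -- threshold `M^{-1/5}` leaves a set small enough for the third criterion.
  have hT : MeasurableSet {z : Freq × Freq | |sumXi z| ^ (1 / 10 : ℝ) ≤ |slopeGap z.1 z.2|} :=
    measurableSet_le (by fun_prop) (by fun_prop)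
  have hT' : MeasurableSet {z : Freq × Freq |
      |sumXi z| ^ (-(1 / 5) : ℝ) ≤ |z.1.2.1 - z.2.2.1|} :=
    measurableSet_le (by fun_prop) (by fun_prop)
  have hm : ∀ c, Measurable fun z => sumXi z ^ 2 * outputFactor c z :=
    fun c => by fun_prop
  have hx : ∀ p q : Freq, sumXi (q, p - q) = p.2.1 := fun p q => by simp [sumXi]
  have hgap : ∀ z ∈ {z : Freq × Freq | |sumXi z| ^ (1 / 10 : ℝ) ≤ |slopeGap z.1 z.2|}ᶜ,
      |slopeGap z.1 z.2| ≤ |sumXi z| ^ (1 / 10 : ℝ) := by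
    intro z hz
    have : ¬ |sumXi z| ^ (1 / 10 : ℝ) ≤ |slopeGap z.1 z.2| := hz
    exact (not_le.1 this).le
  refine ⟨_, ?_, fun c => TrilinearBound.split hG (hR c) (hm c) hT
    (trilinearBound_of_slopeGap hG ((hR c).inter hT) (hm c) (K := 256) fun p => ?_)
    (TrilinearBound.split hG ((hR c).inter hT.compl) (hm c) hT'
      (trilinearBound_of_transverse hG (((hR c).inter hT.compl).inter hT') (hm c) (K := 1024)
        fun p => ?_)
      (trilinearBound_of_left hG hG1 (((hR c).inter hT.compl).inter hT'.compl) (hm c)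
        (K := 128 * 8 * 8 * 16) fun p => ?_))⟩
  · finiteness
  · by_cases hp : 4 ≤ |p.2.1|
    swap
    · refine ⟨0, 0, 0, le_rfl, by norm_num, ?_⟩
      rintro q ⟨⟨-, -, -, -, -, h⟩, -⟩
      rw [hx] at h
      exact absurd h hp
    set M := |p.2.1| with hM
    have hM0 : 0 < M := by linarith
    refine ⟨32 * M ^ (-(47 / 50) : ℝ) * M ^ (-(1 / 10) : ℝ), 0, 4 * M, by positivity, ?_, ?_⟩
    · calc _ = 256 * (M ^ (-(47 / 50) : ℝ) * M ^ (-(1 / 10) : ℝ) * M ^ (1 : ℝ)) := by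
            rw [Real.rpow_one]; ring
        _ ≤ 256 * 1 := by
            rw [← Real.rpow_add hM0]
            gcongr
            exact rpow_mul_rpow_le_one (by linarith) (by norm_num)
        _ = _ := by norm_num
    · rintro q ⟨hq, hθ⟩
      have h1 := comparable_factor_le hq
      have h2 := hq.2.1
      have h3 : |sumXi (q, p - q)| ^ (1 / 10 : ℝ) ≤ |slopeGap q (p - q)| := hθ
      rw [hx] at h1 h2 h3 ⊢
      refine ⟨by simpa using h2, h1.trans ?_⟩
      have h4 : 1 ≤ M ^ (-(1 / 10) : ℝ) * |slopeGap q (p - q)| := by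
        rw [Real.rpow_neg hM0.le, inv_mul_eq_div, one_le_div (by positivity)]
        exact h3
      have : 0 ≤ 32 * M ^ (-(47 / 50) : ℝ) := by positivity
      nlinarith
  · by_cases hp : 4 ≤ |p.2.1|
    swap
    · refine ⟨0, 0, 0, 0, le_rfl, by norm_num, ?_⟩
      rintro q ⟨⟨⟨-, -, -, -, -, h⟩, -⟩, -⟩
      rw [hx] at h
      exact absurd h hp
    set M := |p.2.1| with hM
    have hM0 : 0 < M := by linarith
    -- The separation makes the Jacobian at least `M^{-1/5}/4`, which turns the power `-47/50` into
    -- `-37/50`. The slope lies within `4 M^{1/10}` of the slope of the sum.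
    refine ⟨128 * M ^ (-(37 / 50) : ℝ), p.2.2 / p.2.1, 4 * M ^ (1 / 10 : ℝ), M ^ (1 / 10 : ℝ),
      by positivity, ?_, ?_⟩
    · calc _ = 1024 * (M ^ (-(37 / 50) : ℝ) * M ^ (1 / 10 : ℝ)) := by ring
        _ ≤ 1024 * 1 := by
            gcongr
            exact rpow_mul_rpow_le_one (by linarith) (by norm_num)
        _ = _ := by norm_num
    · rintro q ⟨⟨hq, hθ⟩, hsep⟩
      have h1 := comparable_factor_le hq
      obtain ⟨hd, h2, h3, -⟩ := hq
      have h4 := hgap _ hθ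
      have h5 : |sumXi (q, p - q)| ^ (-(1 / 5) : ℝ) ≤ |q.2.1 - (p - q).2.1| := hsep
      have hne1 : q.2.1 ≠ 0 := hd.1
      have hne2 : p.2.1 - q.2.1 ≠ 0 := hd.2.1
      have hne3 : sumXi (q, p - q) ≠ 0 := hd.2.2.1
      simp only [hx, Prod.snd_sub, Prod.fst_sub] at h1 h2 h3 h4 h5 hne3 ⊢
      have e5 : q.2.1 - (p.2.1 - q.2.1) = 2 * q.2.1 - p.2.1 := by ring
      rw [e5] at h5
      refine ⟨?_, h4, ?_, ?_⟩
      · have := slope_sub_slope_sum (p := q) (q := p - q) hne1 hne2 (by simpa using hne3)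
        simp only [Prod.snd_sub, Prod.fst_sub, add_sub_cancel] at this
        rw [this, abs_div, abs_mul, div_le_iff₀ hM0]
        calc _ ≤ 4 * M * M ^ (1 / 10 : ℝ) := by gcongr
          _ = _ := by ring
      · calc (M ^ (1 / 10 : ℝ)) ^ 2 = M ^ (1 / 5 : ℝ) := by
              rw [← Real.rpow_natCast, ← Real.rpow_mul hM0.le]; norm_num
          _ ≤ M ^ (4 / 5 : ℝ) := Real.rpow_le_rpow_of_exponent_le (by linarith) (by norm_num)
          _ = M ^ (1 : ℝ) * M ^ (-(1 / 5) : ℝ) := by rw [← Real.rpow_add hM0]; norm_num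
          _ ≤ _ := by rw [Real.rpow_one]; gcongr
      · have hq0 : 0 < |q.2.1| := abs_pos.2 hne1
        have h6 : M * M ^ (-(1 / 5) : ℝ) / (4 * M) ≤ M * |2 * q.2.1 - p.2.1| / |q.2.1| := by
          gcongr
        refine h1.trans ?_
        calc 32 * M ^ (-(47 / 50) : ℝ) =
              128 * M ^ (-(37 / 50) : ℝ) * (M * M ^ (-(1 / 5) : ℝ) / (4 * M)) := by
              have : M ^ (-(47 / 50) : ℝ) = M ^ (-(37 / 50) : ℝ) * M ^ (-(1 / 5) : ℝ) := by
                rw [← Real.rpow_add hM0]; norm_num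
              rw [this]
              field_simp
              norm_num
          _ ≤ _ := by gcongr
  · by_cases hp : 1 ≤ |p.2.1|
    swap
    · refine ⟨0, 0, 0, 0, 0, le_rfl, le_rfl, le_rfl, by norm_num, ?_⟩
      rintro q ⟨⟨⟨-, -, -, h, -, h'⟩, -⟩, -⟩
      simp only at h h'
      exact absurd (by linarith) hp
    set a := |p.2.1| with ha
    have ha0 : 0 < a := by linarith
    -- Here the first input is fixed, so `M` is replaced by the comparable `a = |ξ₁|`. The exponents
    -- add up to `-47/50 + 1/10 + 1 - 1/5 = -1/25`.
    refine ⟨128 * a ^ (-(47 / 50) : ℝ), p.2.1, 4 * a ^ (-(1 / 5) : ℝ), 16 * a,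
      4 * a ^ (1 / 10 : ℝ), by positivity, by positivity, by positivity, ?_, ?_⟩
    · calc _ = 128 * 8 * 8 * 16 * (a ^ (-(47 / 50) : ℝ) * a ^ (1 / 10 : ℝ) * a ^ (1 : ℝ) *
            a ^ (-(1 / 5) : ℝ)) := by rw [Real.rpow_one]; ring
        _ ≤ 128 * 8 * 8 * 16 * 1 := by
            rw [← Real.rpow_add ha0, ← Real.rpow_add ha0]
            gcongr
            exact rpow_mul_rpow_le_one (by linarith) (by norm_num)
        _ = _ := by norm_num
    · rintro q ⟨⟨hq, hθ⟩, hsep⟩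
      have h1 := comparable_factor_le hq
      obtain ⟨hd, h2, h3, h2', -, h7⟩ := hq
      have h4 := hgap _ hθ
      have h5 : ¬ |sumXi (p, q)| ^ (-(1 / 5) : ℝ) ≤ |p.2.1 - q.2.1| := hsep
      simp only at h1 h2 h3 h4 h7 h2'
      set M := |sumXi (p, q)| with hM
      have hM0 : 0 < M := by linarith
      have hMa : ∀ e : ℝ, 0 ≤ e → e ≤ 1 → M ^ (-e) ≤ 4 * a ^ (-e) := fun e he he1 =>
        rpow_neg_le_mul_rpow_neg ha0 (by norm_num) (by linarith) he he1
      refine ⟨?_, by linarith, h4.trans ?_, h1.trans ?_⟩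
      · rw [abs_sub_comm]
        exact (not_le.1 h5).le.trans (hMa _ (by norm_num) (by norm_num))
      · calc M ^ (1 / 10 : ℝ) ≤ (4 * a) ^ (1 / 10 : ℝ) := by gcongr
          _ ≤ _ := four_mul_rpow_le ha0.le (by norm_num)
      · have := hMa (47 / 50) (by norm_num) (by norm_num)
        linarith

end

/-! ### Two high frequencies with a lower output -/

section
variable {G : ℝ → ℝ≥0∞}

theorem indicator_regionKernel (G : ℝ → ℝ≥0∞) (c : ℝ) (R T : Set (Freq × Freq))
    (m : Freq × Freq → ℝ) :
    T.indicator (regionKernel G c R m) = regionKernel G c (R ∩ T) m := by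
  unfold regionKernel
  rw [Set.indicator_indicator, Set.inter_comm]

theorem mem_of_regionKernel_ne_zero {c : ℝ} {R : Set (Freq × Freq)} {m : Freq × Freq → ℝ}
    {z : Freq × Freq} (h : regionKernel G c R m z ≠ 0) : z ∈ R := by
  by_contra hz
  exact h (by simp [regionKernel, hz])

/-- Two large spatial frequencies of size `N` interact to a smaller one. -/
def highHighRegion (c N : ℝ) : Set (Freq × Freq) :=
  dominantRegion c ∩ {z | 3 * |sumXi z| ≤ |z.1.2.1| ∧ |z.1.2.1| ≤ 3 * N ∧ |z.2.2.1| ≤ 4 * N ∧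
    N ≤ 3 * |z.1.2.1| ∧ N ≤ 4 * |z.2.2.1|}

theorem measurableSet_highHighRegion (c N : ℝ) : MeasurableSet (highHighRegion c N) :=
  (measurableSet_dominantRegion c).inter ((measurableSet_le (by fun_prop) (by fun_prop)).and
    ((measurableSet_le (by fun_prop) (by fun_prop)).and
    ((measurableSet_le (by fun_prop) (by fun_prop)).and
    ((measurableSet_le (by fun_prop) (by fun_prop)).and
    (measurableSet_le (by fun_prop) (by fun_prop))))))

/-- Crude bound from `J ≥ 1`, for output frequencies at most 1, where negative powers of `J` bring
nothing. -/
theorem outputFactor_le_two_mul (c : ℝ) (z : Freq × Freq) :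
    outputFactor c z ≤ 2 * bracket (modulation c (z.1 + z.2)) ^ (-(23 / 100) : ℝ) := by
  unfold outputFactor
  have hS := one_le_bracket (modulation c (z.1 + z.2))
  set S := bracket (modulation c (z.1 + z.2))
  have hJ := one_le_bracket (sumXi z)
  set J := bracket (sumXi z)
  have hS0 : 0 < S := by linarith
  have h1 : S / J ^ 3 ≤ S := div_le_self hS0.le (one_le_pow₀ hJ)
  calc _ ≤ (2 * S) ^ (3 / 4 : ℝ) * S ^ (-(49 / 50) : ℝ) := by
        gcongr
        linarith
    _ = 2 ^ (3 / 4 : ℝ) * (S ^ (3 / 4 : ℝ) * S ^ (-(49 / 50) : ℝ)) := by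
        rw [Real.mul_rpow (by norm_num) hS0.le]; ring
    _ = 2 ^ (3 / 4 : ℝ) * S ^ (-(23 / 100) : ℝ) := by
        rw [← Real.rpow_add hS0]; norm_num
    _ ≤ 2 ^ (1 : ℝ) * S ^ (-(23 / 100) : ℝ) := by
        gcongr <;> norm_num
    _ = _ := by norm_num

theorem highHigh_modulation {c N : ℝ} (hN : 1 ≤ N) {z : Freq × Freq}
    (hz : z ∈ highHighRegion c N) :
    |sumXi z| * N ^ 2 ≤ 12 * bracket (modulation c (z.1 + z.2)) := by
  obtain ⟨hd, -, -, -, h1, h2⟩ := hz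
  have hres := mul_abs_le_bracket_modulation c hd
  have h4 : N * N ≤ (3 * |z.1.2.1|) * (4 * |z.2.2.1|) :=
    mul_le_mul h1 h2 (by linarith) (by positivity)
  nlinarith [mul_le_mul_of_nonneg_left h4 (abs_nonneg (sumXi z))]

theorem mul_sq_rpow {M N : ℝ} (hM : 0 < M) (hN : 0 < N) (e : ℝ) :
    (M * N ^ 2) ^ e = M ^ e * N ^ (2 * e) := by
  rw [Real.mul_rpow hM.le (by positivity), ← Real.rpow_natCast N 2, ← Real.rpow_mul hN.le]
  norm_num

/-- The dominant modulation is at least `M N²/12`. The second term of `outputFactor_le` gives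
exactly the stated powers, and the first is reduced to them by `M ≤ N`. -/
theorem highHigh_factor_le {c N : ℝ} (hN : 1 ≤ N) {z : Freq × Freq}
    (hz : z ∈ highHighRegion c N) (hM1 : 1 ≤ |sumXi z|) :
    sumXi z ^ 2 * outputFactor c z ≤
      24 * (|sumXi z| ^ (-(12 / 25) : ℝ) * N ^ (-(23 / 50) : ℝ)) := by
  have hN0 : 0 < N := by linarith
  have hmod := highHigh_modulation hN hz
  obtain ⟨hd, h1, h2, -⟩ := hz
  set M := |sumXi z| with hM
  have hM0 : 0 < M := by linarith
  have hF := outputFactor_le c z (by positivity) (by norm_num) hmod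
  have hJ : bracket (sumXi z) ^ (-(9 / 4) : ℝ) ≤ M ^ (-(9 / 4) : ℝ) :=
    Real.rpow_le_rpow_of_nonpos hM0 (abs_le_bracket _) (by norm_num)
  rw [mul_sq_rpow hM0 hN0, mul_sq_rpow hM0 hN0] at hF
  have e2 : sumXi z ^ 2 = M ^ (2 : ℝ) := by rw [hM, Real.rpow_two, sq_abs]
  have hMN : M ^ (3 / 2 : ℝ) ≤ N ^ (3 / 2 : ℝ) := by gcongr; linarith
  rw [e2]
  calc _ ≤ M ^ (2 : ℝ) * (12 * (M ^ (-(49 / 50) : ℝ) * N ^ (2 * (-(49 / 50)) : ℝ)) +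
        12 * (M ^ (-(9 / 4) : ℝ) * (M ^ (-(23 / 100) : ℝ) * N ^ (2 * (-(23 / 100)) : ℝ)))) := by
        refine mul_le_mul_of_nonneg_left (hF.trans ?_) (by positivity)
        gcongr
    _ = 12 * (M ^ (2 : ℝ) * M ^ (-(49 / 50) : ℝ) * N ^ (2 * (-(49 / 50)) : ℝ)) +
        12 * (M ^ (2 : ℝ) * M ^ (-(9 / 4) : ℝ) * M ^ (-(23 / 100) : ℝ) *
          N ^ (2 * (-(23 / 100)) : ℝ)) := by ring
    _ = 12 * (M ^ (3 / 2 : ℝ) * M ^ (-(12 / 25) : ℝ) * N ^ (-(49 / 25) : ℝ)) +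
        12 * (M ^ (-(12 / 25) : ℝ) * N ^ (-(23 / 50) : ℝ)) := by
        rw [← Real.rpow_add hM0, ← Real.rpow_add hM0, ← Real.rpow_add hM0, ← Real.rpow_add hM0]
        norm_num
    _ ≤ 12 * (N ^ (3 / 2 : ℝ) * M ^ (-(12 / 25) : ℝ) * N ^ (-(49 / 25) : ℝ)) +
        12 * (M ^ (-(12 / 25) : ℝ) * N ^ (-(23 / 50) : ℝ)) := by gcongr
    _ = 12 * (M ^ (-(12 / 25) : ℝ) * (N ^ (3 / 2 : ℝ) * N ^ (-(49 / 25) : ℝ))) +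
        12 * (M ^ (-(12 / 25) : ℝ) * N ^ (-(23 / 50) : ℝ)) := by ring
    _ = _ := by rw [← Real.rpow_add hN0]; norm_num; ring

theorem highHigh_factor_le_min {c N : ℝ} (hN : 1 ≤ N) {z : Freq × Freq}
    (hz : z ∈ highHighRegion c N) :
    sumXi z ^ 2 * outputFactor c z ≤ 24 * (min 1 |sumXi z| * N ^ (-(23 / 50) : ℝ)) := by
  have hN0 : 0 < N := by linarith
  have hM0 : 0 < |sumXi z| := abs_pos.2 hz.1.2.2.1
  rcases le_total 1 |sumXi z| with h | h
  · refine (highHigh_factor_le hN hz h).trans ?_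
    rw [min_eq_left h]
    gcongr
    exact Real.rpow_le_one_of_one_le_of_nonpos h (by norm_num)
  · rw [min_eq_right h]
    have hmod := highHigh_modulation hN hz
    set M := |sumXi z| with hM
    have e2 : sumXi z ^ 2 = M ^ 2 := by rw [hM, sq_abs]
    rw [e2]
    have h1 := rpow_neg_le_mul_rpow_neg (by positivity) (by norm_num) hmod
      (show (0 : ℝ) ≤ 23 / 100 by norm_num) (by norm_num)
    rw [mul_sq_rpow hM0 hN0] at h1
    calc _ ≤ M ^ 2 * (2 * (12 * (M ^ (-(23 / 100) : ℝ) * N ^ (2 * (-(23 / 100)) : ℝ)))) := by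
          gcongr
          exact (outputFactor_le_two_mul c z).trans (by gcongr)
      _ = 24 * ((M ^ (2 : ℝ) * M ^ (-(23 / 100) : ℝ)) * N ^ (2 * (-(23 / 100)) : ℝ)) := by
          rw [Real.rpow_two]; ring
      _ ≤ 24 * (M ^ (1 : ℝ) * N ^ (-(23 / 50) : ℝ)) := by
          rw [← Real.rpow_add hM0]
          gcongr 24 * (?_ * ?_)
          · exact Real.rpow_le_rpow_of_exponent_ge hM0 h (by norm_num)
          · norm_num
      _ = _ := by rw [Real.rpow_one]

theorem highHigh_two_mul_sub {c N : ℝ} {z : Freq × Freq} (hz : z ∈ highHighRegion c N) :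
    |z.1.2.1| ≤ |2 * z.1.2.1 - sumXi z| := by
  obtain ⟨-, h1, -⟩ := hz
  have := abs_sub_abs_le_abs_sub (2 * z.1.2.1) (sumXi z)
  rw [abs_mul, abs_two] at this
  linarith [abs_nonneg (sumXi z)]

/-- High-high interactions with an output frequency that is not too small. -/
theorem exists_trilinearBound_highHigh_medium (hG : Measurable G)
    (hI : ∫⁻ x, G x ≠ ∞) : ∃ B : ℝ≥0∞, B ≠ ∞ ∧ ∀ c N : ℝ, 1 ≤ N → TrilinearBound
      (regionKernel G c (highHighRegion c N ∩ {z | N ^ (2 / 5 : ℝ) ≤ |sumXi z|})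
        fun z => sumXi z ^ 2 * outputFactor c z) B := by
  have hR : ∀ c N, MeasurableSet (highHighRegion c N ∩ {z | N ^ (2 / 5 : ℝ) ≤ |sumXi z|}) :=
    fun c N => (measurableSet_highHighRegion c N).inter
      (measurableSet_le (by fun_prop) (by fun_prop))
  have hT : ∀ N : ℝ, MeasurableSet {z : Freq × Freq | N ^ (2 / 5 : ℝ) / 6 ≤ |slopeGap z.1 z.2|} :=
    fun N => measurableSet_le (by fun_prop) (by fun_prop)
  have hm : ∀ c, Measurable fun z => sumXi z ^ 2 * outputFactor c z :=
    fun c => by fun_prop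
  have hx : ∀ p q : Freq, sumXi (q, p - q) = p.2.1 := fun p q => by simp [sumXi]
  have hfac : ∀ (c N : ℝ) (z), 1 ≤ N → z ∈ highHighRegion c N → N ^ (2 / 5 : ℝ) ≤ |sumXi z| →
      sumXi z ^ 2 * outputFactor c z ≤ 24 * N ^ (-(163 / 250) : ℝ) := by
    intro c N z hN hz h
    have hN0 : 0 < N := by linarith
    have h1 : 1 ≤ N ^ (2 / 5 : ℝ) := Real.one_le_rpow hN (by norm_num)
    refine (highHigh_factor_le hN hz (h1.trans h)).trans ?_
    calc _ ≤ 24 * ((N ^ (2 / 5 : ℝ)) ^ (-(12 / 25) : ℝ) * N ^ (-(23 / 50) : ℝ)) := by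
          gcongr 24 * (?_ * _)
          exact Real.rpow_le_rpow_of_nonpos (by positivity) h (by norm_num)
      _ = _ := by
          rw [← Real.rpow_mul hN0.le, ← Real.rpow_add hN0]; norm_num
  refine ⟨_, ?_, fun c N hN => TrilinearBound.split hG (hR c N) (hm c) (hT N)
    (trilinearBound_of_slopeGap hG ((hR c N).inter (hT N)) (hm c) (K := 864) fun p => ?_)
    (trilinearBound_of_transverse hG ((hR c N).inter (hT N).compl) (hm c) (K := 32)
      fun p => ?_)⟩
  · finiteness
  · have hN0 : 0 < N := by linarith
    -- Here `-163/250` is `-(12/25)(2/5) - 23/50`. The full range `|ξ₁| ≤ 3N` costs `N`, and the gap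
    -- returns `N^{2/5}`.
    refine ⟨24 * N ^ (-(163 / 250) : ℝ) * (6 * N ^ (-(2 / 5) : ℝ)), 0, 3 * N, by positivity, ?_, ?_⟩
    · calc _ = 864 * (N ^ (-(163 / 250) : ℝ) * N ^ (-(2 / 5) : ℝ) * N ^ (1 : ℝ)) := by
            rw [Real.rpow_one]; ring
        _ ≤ 864 * 1 := by
            rw [← Real.rpow_add hN0]
            gcongr
            exact rpow_mul_rpow_le_one hN (by norm_num)
        _ = _ := by norm_num
    · rintro q ⟨⟨hq, hM⟩, hθ⟩
      have h3 : N ^ (2 / 5 : ℝ) / 6 ≤ |slopeGap q (p - q)| := hθ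
      refine ⟨by simpa using hq.2.2.1, (hfac c N _ hN hq hM).trans ?_⟩
      have h4 : 1 ≤ 6 * N ^ (-(2 / 5) : ℝ) * |slopeGap q (p - q)| := by
        rw [Real.rpow_neg hN0.le, mul_assoc, inv_mul_eq_div, ← mul_div_assoc,
          one_le_div (by positivity)]
        linarith
      have : 0 ≤ 24 * N ^ (-(163 / 250) : ℝ) := by positivity
      nlinarith
  · have hN0 : 0 < N := by linarith
    by_cases hp : N ^ (2 / 5 : ℝ) ≤ |p.2.1|
    swap
    · refine ⟨0, 0, 0, 0, le_rfl, by norm_num, ?_⟩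
      rintro q ⟨⟨-, h⟩, -⟩
      have h' : N ^ (2 / 5 : ℝ) ≤ |sumXi (q, p - q)| := h
      rw [hx] at h'
      exact absurd h' hp
    set M := |p.2.1| with hM
    have hM1 : 1 ≤ M := (Real.one_le_rpow hN (by norm_num)).trans hp
    have hM0 : 0 < M := by linarith
    -- The slope of the first input may be as far as `4NΘ/M` from that of the sum. The factor `1/M²`
    -- from this and the Jacobian, with `M ≥ N^{2/5}`, makes the total power of `N` negative.
    refine ⟨24 * N ^ (-(163 / 250) : ℝ) / M, p.2.2 / p.2.1, 4 * N * (N ^ (2 / 5 : ℝ) / 6) / M,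
      N ^ (2 / 5 : ℝ) / 6, by positivity, ?_, ?_⟩
    · have h1 : N ^ (4 / 5 : ℝ) ≤ M ^ 2 := by
        calc N ^ (4 / 5 : ℝ) = (N ^ (2 / 5 : ℝ)) ^ 2 := by
              rw [← Real.rpow_natCast, ← Real.rpow_mul hN0.le]; norm_num
          _ ≤ _ := by gcongr
      calc _ = 32 * (N ^ (-(163 / 250) : ℝ) * N ^ (2 / 5 : ℝ) * N ^ (1 : ℝ)) / M ^ 2 := by
            rw [Real.rpow_one]; field_simp; norm_num
        _ ≤ 32 * (N ^ (-(163 / 250) : ℝ) * N ^ (2 / 5 : ℝ) * N ^ (1 : ℝ)) / N ^ (4 / 5 : ℝ) := by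
            gcongr
        _ = 32 * (N ^ (-(163 / 250) : ℝ) * N ^ (2 / 5 : ℝ) * N ^ (1 : ℝ) *
              N ^ (-(4 / 5) : ℝ)) := by
            rw [Real.rpow_neg hN0.le (4 / 5)]; field_simp
        _ ≤ 32 * 1 := by
            rw [← Real.rpow_add hN0, ← Real.rpow_add hN0]
            gcongr
            exact rpow_mul_rpow_le_one hN (by norm_num)
        _ = _ := by norm_num
    · rintro q ⟨⟨hq, hMq⟩, hθ⟩
      have h1 := hfac c N _ hN hq hMq
      have h6 := highHigh_two_mul_sub hq
      obtain ⟨hd, h2, h3, h3', h7, -⟩ := hq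
      have h4 : ¬ N ^ (2 / 5 : ℝ) / 6 ≤ |slopeGap q (p - q)| := hθ
      have h4' := (not_le.1 h4).le
      have hne1 : q.2.1 ≠ 0 := hd.1
      have hne2 : p.2.1 - q.2.1 ≠ 0 := hd.2.1
      have hne3 : sumXi (q, p - q) ≠ 0 := hd.2.2.1
      simp only [hx, Prod.snd_sub, Prod.fst_sub] at h1 h2 h3 h3' h6 h7 hne3 ⊢
      have hq0 : 0 < |q.2.1| := abs_pos.2 hne1
      refine ⟨?_, h4', ?_, ?_⟩
      · have := slope_sub_slope_sum (p := q) (q := p - q) hne1 hne2 (by simpa using hne3)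
        simp only [Prod.snd_sub, Prod.fst_sub, add_sub_cancel] at this
        rw [this, abs_div, abs_mul]
        gcongr
      · calc (N ^ (2 / 5 : ℝ) / 6) ^ 2 = N ^ (4 / 5 : ℝ) / 36 := by
              rw [div_pow, ← Real.rpow_natCast, ← Real.rpow_mul hN0.le]; norm_num
          _ ≤ N / 3 := by
              have : N ^ (4 / 5 : ℝ) ≤ N := by
                simpa using Real.rpow_le_rpow_of_exponent_le hN (show (4 / 5 : ℝ) ≤ 1 by norm_num)
              linarith
          _ ≤ 1 * |q.2.1| := by linarith
          _ ≤ _ := by gcongr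
      · have h8 : 1 ≤ |2 * q.2.1 - p.2.1| / |q.2.1| := by rwa [one_le_div hq0]
        refine h1.trans ?_
        calc 24 * N ^ (-(163 / 250) : ℝ) = 24 * N ^ (-(163 / 250) : ℝ) / M * (M * 1) := by
              field_simp
          _ ≤ 24 * N ^ (-(163 / 250) : ℝ) / M * (M * (|2 * q.2.1 - p.2.1| / |q.2.1|)) := by gcongr
          _ = _ := by rw [mul_div_assoc M]

/-- High-high interactions with a small output frequency. -/
theorem exists_trilinearBound_highHigh_small (hG : Measurable G) (hG1 : ∀ x, G x ≤ 1)
    (hI : ∫⁻ x, G x ≠ ∞) : ∃ B : ℝ≥0∞, B ≠ ∞ ∧ ∀ c N : ℝ, 1 ≤ N → TrilinearBound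
      (regionKernel G c (highHighRegion c N ∩ {z | N ^ (2 / 5 : ℝ) ≤ |sumXi z|}ᶜ)
        fun z => sumXi z ^ 2 * outputFactor c z) B := by
  have hR : ∀ c N, MeasurableSet (highHighRegion c N ∩ {z | N ^ (2 / 5 : ℝ) ≤ |sumXi z|}ᶜ) :=
    fun c N => (measurableSet_highHighRegion c N).inter
      (MeasurableSet.compl (measurableSet_le (by fun_prop) (by fun_prop)))
  have hT : MeasurableSet {z : Freq × Freq | 1 ≤ |slopeGap z.1 z.2|} :=
    measurableSet_le (by fun_prop) (by fun_prop)
  have hU : ∀ N : ℝ, MeasurableSet {z : Freq × Freq | 3 ≤ |sumXi z| * N} :=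
    fun N => measurableSet_le (by fun_prop) (by fun_prop)
  have hm : ∀ c, Measurable fun z => sumXi z ^ 2 * outputFactor c z :=
    fun c => by fun_prop
  have hx : ∀ p q : Freq, sumXi (q, p - q) = p.2.1 := fun p q => by simp [sumXi]
  have hgap : ∀ z ∈ {z : Freq × Freq | 1 ≤ |slopeGap z.1 z.2|}ᶜ, |slopeGap z.1 z.2| ≤ 1 := by
    intro z hz
    have : ¬ 1 ≤ |slopeGap z.1 z.2| := hz
    exact (not_le.1 this).le
  have hone : ∀ N : ℝ, 1 ≤ N → N ^ (-(23 / 50) : ℝ) ≤ 1 := fun N hN =>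
    Real.rpow_le_one_of_one_le_of_nonpos hN (by norm_num)
  refine ⟨_, ?_, fun c N hN => TrilinearBound.split hG (hR c N) (hm c) hT
    (B₁ := 2 * (2 * (∫⁻ x, G x) ^ 2 * ENNReal.ofReal 48) ^ (1 / 2 : ℝ)) ?_
    (TrilinearBound.split hG ((hR c N).inter hT.compl) (hm c) (hU N)
      (B₁ := 2 * (4 * (∫⁻ x, G x) ^ 2 * ENNReal.ofReal 48) ^ (1 / 2 : ℝ)) ?_
      (trilinearBound_of_left hG hG1 (((hR c N).inter hT.compl).inter (hU N).compl) (hm c)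
        (K := 1152) fun p => ?_))⟩
  · finiteness
  · have hN0 : 0 < N := by linarith
    have hL0 : 0 < N ^ (2 / 5 : ℝ) := by positivity
    -- As `ξ₁ + ξ₂` is below `N^{2/5}`, `ξ₁` and `-ξ₂` may be localized to common intervals of that
    -- length. This costs `N^{2/5}` instead of `N`, less than the gain `N^{-23/50}`.
    refine TrilinearBound.of_localized (measurable_regionKernel hG ((hR c N).inter hT) (hm c))
      (ψ₁ := fun p => p.2.1 / N ^ (2 / 5 : ℝ)) (ψ₂ := fun p => -p.2.1 / N ^ (2 / 5 : ℝ))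
      (by fun_prop) (by fun_prop) ?_ ?_
    · intro z hz
      obtain ⟨⟨-, h⟩, -⟩ := mem_of_regionKernel_ne_zero hz
      have h' : ¬ N ^ (2 / 5 : ℝ) ≤ |sumXi z| := h
      rw [← sub_div, sub_neg_eq_add, abs_div, abs_of_pos hL0, div_le_one hL0]
      exact (not_le.1 h').le
    · intro a
      rw [indicator_regionKernel]
      refine trilinearBound_of_slopeGap hG (((hR c N).inter hT).inter
        ((measurableSet_le (by fun_prop) (by fun_prop)).and
        (measurableSet_le (by fun_prop) (by fun_prop)))) (hm c) fun p => ?_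
      refine ⟨24 * N ^ (-(23 / 50) : ℝ), a * N ^ (2 / 5 : ℝ), N ^ (2 / 5 : ℝ), by positivity,
        ?_, ?_⟩
      · calc _ = 48 * (N ^ (-(23 / 50) : ℝ) * N ^ (2 / 5 : ℝ)) := by ring
          _ ≤ 48 * 1 := by
              gcongr
              exact rpow_mul_rpow_le_one hN (by norm_num)
          _ = _ := by norm_num
      · rintro q ⟨⟨⟨hq, -⟩, hθ⟩, hloc, -⟩
        have hθ' : 1 ≤ |slopeGap q (p - q)| := hθ
        refine ⟨?_, (highHigh_factor_le_min hN hq).trans ?_⟩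
        · have e : q.2.1 - a * N ^ (2 / 5 : ℝ) =
              (q.2.1 / N ^ (2 / 5 : ℝ) - a) * N ^ (2 / 5 : ℝ) := by field_simp
          rw [e, abs_mul, abs_of_pos hL0]
          nlinarith
        · have h1 : min 1 |sumXi (q, p - q)| ≤ 1 := min_le_left _ _
          have h2 : 0 ≤ N ^ (-(23 / 50) : ℝ) := by positivity
          have h3 := mul_le_mul_of_nonneg_right h1 h2
          nlinarith
  · have hN0 : 0 < N := by linarith
    -- A slope gap at most 1 is itself an almost orthogonality condition: both slopes may be
    -- localized to unit scale, so the distance to the slope of the sum is not needed.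
    refine TrilinearBound.of_localized
      (measurable_regionKernel hG (((hR c N).inter hT.compl).inter (hU N)) (hm c))
      (ψ₁ := fun p => p.2.2 / p.2.1) (ψ₂ := fun p => p.2.2 / p.2.1)
      (by fun_prop) (by fun_prop) ?_ ?_
    · intro z hz
      exact hgap z (mem_of_regionKernel_ne_zero hz).1.2
    · intro a
      rw [indicator_regionKernel]
      refine trilinearBound_of_transverse hG ((((hR c N).inter hT.compl).inter (hU N)).inter
        ((measurableSet_le (by fun_prop) (by fun_prop)).and
        (measurableSet_le (by fun_prop) (by fun_prop)))) (hm c) fun p => ?_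
      refine ⟨24, a, 1, 1, by norm_num, by norm_num, ?_⟩
      rintro q ⟨⟨⟨⟨hq, -⟩, hθ⟩, hMN⟩, hloc, -⟩
      have h1 := highHigh_factor_le_min hN hq
      have h6 := highHigh_two_mul_sub hq
      have hMN' : 3 ≤ |sumXi (q, p - q)| * N := hMN
      have hne1 : q.2.1 ≠ 0 := hq.1.1
      have h7 : N ≤ 3 * |q.2.1| := hq.2.2.2.2.1
      simp only [hx] at h1 h6 hMN' ⊢
      have hq0 : 0 < |q.2.1| := abs_pos.2 hne1
      refine ⟨hloc, hgap _ hθ, ?_, ?_⟩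
      -- Since `|2ξ₁ - ξ| ≥ |ξ₁| ≥ N/3`, the threshold `3 ≤ |ξ| N` is exactly what gives `Θ² = 1 ≤
      -- |ξ| |2ξ₁ - ξ|`.
      · nlinarith [mul_le_mul_of_nonneg_left h7 (abs_nonneg p.2.1),
          mul_le_mul_of_nonneg_left h6 (abs_nonneg p.2.1)]
      · have h8 : 1 ≤ |2 * q.2.1 - p.2.1| / |q.2.1| := by rwa [one_le_div hq0]
        refine h1.trans ?_
        gcongr 24 * ?_
        rw [mul_div_assoc]
        calc _ ≤ |p.2.1| * 1 := by
              gcongr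
              · exact min_le_right _ _
              · exact hone N hN
          _ ≤ _ := by gcongr
  · have hN0 : 0 < N := by linarith
    -- For `|ξ| ≤ 3/N` the interval for `ξ₂` has length `6/N`, while the `η₂`-measure is at most
    -- `8N`: the powers of `N` cancel.
    refine ⟨24, -p.2.1, 3 / N, 4 * N, 1, by norm_num, by norm_num, by positivity, ?_, ?_⟩
    · refine le_of_eq ?_
      field_simp
      norm_num
    · rintro q ⟨⟨⟨hq, -⟩, hθ⟩, hMN⟩
      have hMN' : ¬ 3 ≤ |sumXi (p, q)| * N := hMN
      refine ⟨?_, hq.2.2.2.1, hgap _ hθ, (highHigh_factor_le_min hN hq).trans ?_⟩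
      · rw [le_div_iff₀ hN0, sub_neg_eq_add, add_comm]
        exact (not_le.1 hMN').le
      · have h1 : min 1 |sumXi (p, q)| ≤ 1 := min_le_left _ _
        have h2 := mul_le_mul h1 (hone N hN) (by positivity) zero_le_one
        linarith

/-- Two large spatial frequencies interact to a smaller one. -/
def largeRegion (c : ℝ) : Set (Freq × Freq) :=
  dominantRegion c ∩ {z | 3 * |sumXi z| ≤ |z.1.2.1| ∧ 3 * |sumXi z| ≤ |z.2.2.1| ∧
    12 ≤ |z.1.2.1|}

theorem measurableSet_largeRegion (c : ℝ) : MeasurableSet (largeRegion c) :=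
  (measurableSet_dominantRegion c).inter ((measurableSet_le (by fun_prop) (by fun_prop)).and
    ((measurableSet_le (by fun_prop) (by fun_prop)).and
    (measurableSet_le (by fun_prop) (by fun_prop))))

theorem exists_trilinearBound_large (hG : Measurable G) (hG1 : ∀ x, G x ≤ 1)
    (hI : ∫⁻ x, G x ≠ ∞) : ∃ B : ℝ≥0∞, B ≠ ∞ ∧ ∀ c : ℝ, TrilinearBound
      (regionKernel G c (largeRegion c) fun z => sumXi z ^ 2 * outputFactor c z) B := by
  obtain ⟨B₁, hB₁, h₁⟩ := exists_trilinearBound_highHigh_medium hG hI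
  obtain ⟨B₂, hB₂, h₂⟩ := exists_trilinearBound_highHigh_small hG hG1 hI
  have hm : ∀ c, Measurable fun z => sumXi z ^ 2 * outputFactor c z := fun c => by fun_prop
  refine ⟨2 * (B₁ + B₂), by finiteness, fun c => ?_⟩
  have hratio : ∀ z ∈ largeRegion c, |z.1.2.1| ≤ 4 / 3 * |z.2.2.1| ∧
      |z.2.2.1| ≤ 4 / 3 * |z.1.2.1| := by
    rintro z ⟨-, h1, h2, -⟩
    have e1 : z.1.2.1 = sumXi z - z.2.2.1 := by simp [sumXi]
    have e2 : z.2.2.1 = sumXi z - z.1.2.1 := by simp [sumXi]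
    have h3 := abs_sub (sumXi z) z.2.2.1
    have h4 := abs_sub (sumXi z) z.1.2.1
    rw [← e1] at h3
    rw [← e2] at h4
    constructor <;> linarith
  -- Dyadic decomposition with the continuous parameter `N = exp α`. The inputs are comparable
  -- within `4/3`, so their logarithms differ by at most 1.
  refine TrilinearBound.of_localized (measurable_regionKernel hG (measurableSet_largeRegion c)
    (hm c)) (ψ₁ := fun p => Real.log |p.2.1|) (ψ₂ := fun p => Real.log |p.2.1|)
    (by fun_prop) (by fun_prop) ?_ ?_
  · intro z hz
    have hz' := mem_of_regionKernel_ne_zero hz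
    obtain ⟨h1, h2⟩ := hratio z hz'
    have hlog : Real.log (4 / 3) ≤ 1 := by
      have := Real.log_le_sub_one_of_pos (show (0 : ℝ) < 4 / 3 by norm_num)
      linarith
    have ha : 0 < |z.1.2.1| := abs_pos.2 hz'.1.1
    have hb : 0 < |z.2.2.1| := abs_pos.2 hz'.1.2.1
    have h3 := Real.log_le_log ha h1
    have h4 := Real.log_le_log hb h2
    rw [Real.log_mul (by norm_num) hb.ne'] at h3
    rw [Real.log_mul (by norm_num) ha.ne'] at h4
    rw [abs_le]
    constructor <;> linarith
  · intro α
    rw [indicator_regionKernel]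
    have hsub : ∀ z ∈ largeRegion c ∩ {z | |Real.log |z.1.2.1| - α| ≤ 1 ∧
        |Real.log |z.2.2.1| - α| ≤ 2}, 1 ≤ Real.exp α ∧ z ∈ highHighRegion c (Real.exp α) := by
      rintro z ⟨hz, hl, -⟩
      obtain ⟨h1, h2⟩ := hratio z hz
      obtain ⟨hd, h3, -, h4⟩ := hz
      have ha : 0 < |z.1.2.1| := by linarith
      rw [abs_le] at hl
      have he : Real.exp 1 ≤ 3 := Real.exp_one_lt_three.le
      have hu : |z.1.2.1| ≤ 3 * Real.exp α := by
        calc |z.1.2.1| = Real.exp (Real.log |z.1.2.1|) := (Real.exp_log ha).symm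
          _ ≤ Real.exp (1 + α) := by gcongr; linarith
          _ = Real.exp 1 * Real.exp α := Real.exp_add _ _
          _ ≤ _ := by gcongr
      have hl' : Real.exp α ≤ 3 * |z.1.2.1| := by
        calc Real.exp α ≤ Real.exp (1 + Real.log |z.1.2.1|) := by gcongr; linarith
          _ = Real.exp 1 * |z.1.2.1| := by rw [Real.exp_add, Real.exp_log ha]
          _ ≤ _ := by gcongr
      refine ⟨by linarith, hd, h3, hu, ?_, hl', ?_⟩ <;> linarith
    by_cases hN : 1 ≤ Real.exp α
    · have hsplit := TrilinearBound.split hG (measurableSet_highHighRegion c (Real.exp α)) (hm c)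
        (measurableSet_le (f := fun _ => Real.exp α ^ (2 / 5 : ℝ)) (g := fun z => |sumXi z|)
          (by fun_prop) (by fun_prop)) (h₁ c _ hN) (h₂ c _ hN)
      refine hsplit.mono fun z => ?_
      exact Set.indicator_le_indicator_of_subset (fun z hz => (hsub z hz).2) (fun _ => zero_le) z
    -- For `exp α < 1` the localized region is empty, since `|ξ₁| ≥ 12`; any bound will do.
    · refine (h₁ c 1 le_rfl).mono (fun z => ?_) |>.mono_const le_self_add
      unfold regionKernel
      rw [Set.indicator_of_notMem fun hz => hN (hsub z hz).1]
      exact zero_le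

end

/-! ### Bounds uniform in c, and the case of a dominant output -/

/-- A family of squared kernels, dominated by measurable kernels whose trilinear forms are
uniformly bounded. -/
def UniformBound (κ : ℝ → Freq × Freq → ℝ≥0∞) : Prop :=
  ∃ (K : ℝ → Freq × Freq → ℝ≥0∞) (B : ℝ≥0∞), B ≠ ∞ ∧
    ∀ c, Measurable (K c) ∧ (∀ z, κ c z ≤ K c z) ∧ TrilinearBound (K c) B

namespace UniformBound

variable {κ κ₁ κ₂ : ℝ → Freq × Freq → ℝ≥0∞} {G : ℝ → ℝ≥0∞} {R R' R₁ R₂ : ℝ → Set (Freq × Freq)}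
  {m m' : ℝ → Freq × Freq → ℝ}

theorem exists_bound (h : UniformBound κ) : ∃ B : ℝ≥0∞, B ≠ ∞ ∧ ∀ c, TrilinearBound (κ c) B := by
  obtain ⟨K, B, hB, h⟩ := h
  exact ⟨B, hB, fun c => (h c).2.2.mono (h c).2.1⟩

theorem mono (h : UniformBound κ₂) (hle : ∀ c z, κ₁ c z ≤ κ₂ c z) : UniformBound κ₁ := by
  obtain ⟨K, B, hB, h⟩ := h
  exact ⟨K, B, hB, fun c => ⟨(h c).1, fun z => (hle c z).trans ((h c).2.1 z), (h c).2.2⟩⟩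

theorem add (h₁ : UniformBound κ₁) (h₂ : UniformBound κ₂) :
    UniformBound fun c z => κ₁ c z + κ₂ c z := by
  obtain ⟨K₁, B₁, hB₁, h₁⟩ := h₁
  obtain ⟨K₂, B₂, hB₂, h₂⟩ := h₂
  exact ⟨fun c z => K₁ c z + K₂ c z, B₁ + B₂, by finiteness, fun c =>
    ⟨(h₁ c).1.add (h₂ c).1, fun z => add_le_add ((h₁ c).2.1 z) ((h₂ c).2.1 z),
      (h₁ c).2.2.add (h₂ c).2.2 (h₁ c).1⟩⟩

theorem const_mul (h : UniformBound κ) (C : ℝ≥0∞) (hC : C ≠ ∞) :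
    UniformBound fun c z => C * κ c z := by
  obtain ⟨K, B, hB, h⟩ := h
  exact ⟨fun c z => C * K c z, C ^ (1 / 2 : ℝ) * B, by finiteness, fun c =>
    ⟨(h c).1.const_mul C, fun z => mul_le_mul_right ((h c).2.1 z) _, (h c).2.2.const_mul C hC⟩⟩

theorem swap (h : UniformBound κ) : UniformBound fun c z => κ c z.swap := by
  obtain ⟨K, B, hB, h⟩ := h
  exact ⟨fun c z => K c z.swap, B, hB, fun c =>
    ⟨(h c).1.comp measurable_swap, fun z => (h c).2.1 z.swap, (h c).2.2.swap⟩⟩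

/-- The shear is an involution, so a majorant of the sheared kernel, sheared once more, is a
majorant of `κ`. -/
theorem of_shear (h : UniformBound fun c z => κ c (z.1 + z.2, -z.2)) : UniformBound κ := by
  obtain ⟨K, B, hB, h⟩ := h
  refine ⟨fun c z => K c (z.1 + z.2, -z.2), B, hB, fun c => ⟨?_, fun z => ?_, ?_⟩⟩
  · exact (h c).1.comp (by fun_prop)
  · have := (h c).2.1 (z.1 + z.2, -z.2)
    simpa using this
  · apply TrilinearBound.of_shear
    simpa using (h c).2.2

theorem of_exists (hG : Measurable G) (hR : ∀ c, MeasurableSet (R c)) (hm : ∀ c, Measurable (m c))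
    (h : ∃ B : ℝ≥0∞, B ≠ ∞ ∧ ∀ c, TrilinearBound (regionKernel G c (R c) (m c)) B) :
    UniformBound fun c => regionKernel G c (R c) (m c) := by
  obtain ⟨B, hB, h⟩ := h
  exact ⟨_, B, hB, fun c => ⟨measurable_regionKernel hG (hR c) (hm c), fun z => le_rfl, h c⟩⟩

theorem of_union (h₁ : UniformBound fun c => regionKernel G c (R₁ c) (m c))
    (h₂ : UniformBound fun c => regionKernel G c (R₂ c) (m c))
    (h : ∀ c, ∀ z ∈ R c, z ∈ R₁ c ∨ z ∈ R₂ c) :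
    UniformBound fun c => regionKernel G c (R c) (m c) := by
  refine (h₁.add h₂).mono fun c z => ?_
  unfold regionKernel
  by_cases hz : z ∈ R c
  · rcases h c z hz with h' | h'
    · rw [Set.indicator_of_mem hz, Set.indicator_of_mem h']
      exact le_self_add
    · rw [Set.indicator_of_mem hz, Set.indicator_of_mem h']
      exact le_add_self
  · simp [hz]

theorem of_le (h : UniformBound fun c => regionKernel G c (R' c) (m' c)) {C : ℝ} (hC : 0 ≤ C)
    (hle : ∀ c, ∀ z ∈ R c, z ∈ R' c ∧ m c z ≤ C * m' c z) :
    UniformBound fun c => regionKernel G c (R c) (m c) := by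
  refine (h.const_mul (ENNReal.ofReal C) ENNReal.ofReal_ne_top).mono fun c z => ?_
  unfold regionKernel
  by_cases hz : z ∈ R c
  · rw [Set.indicator_of_mem hz, Set.indicator_of_mem (hle c z hz).1, ← mul_assoc,
      ← ENNReal.ofReal_mul hC]
    gcongr
    exact (hle c z hz).2
  · simp [hz]

theorem swap_region (h : UniformBound fun c => regionKernel G c (R c) (m c)) :
    UniformBound fun c => regionKernel G c {z | z.swap ∈ R c} fun z => m c z.swap := by
  refine h.swap.mono fun c z => ?_
  unfold regionKernel
  by_cases hz : z.swap ∈ R c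
  · rw [Set.indicator_of_mem hz, Set.indicator_of_mem (by exact hz)]
    simp [modulationProduct, mul_comm]
  · simp [hz]

end UniformBound

theorem sumXi_swap (z : Freq × Freq) : sumXi z.swap = sumXi z := by
  simp [sumXi, add_comm]

theorem outputFactor_swap (c : ℝ) (z : Freq × Freq) : outputFactor c z.swap = outputFactor c z := by
  simp [outputFactor, sumXi_swap, add_comm]

theorem swap_mem_dominantRegion {c : ℝ} {z : Freq × Freq} :
    z.swap ∈ dominantRegion c ↔ z ∈ dominantRegion c := by
  simp only [dominantRegion, Set.mem_ofPred_eq, sumXi_swap, Prod.fst_swap, Prod.snd_swap,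
    add_comm z.2 z.1]
  tauto

theorem outputFactor_le_two (c : ℝ) (z : Freq × Freq) : outputFactor c z ≤ 2 := by
  refine (outputFactor_le_two_mul c z).trans ?_
  have := Real.rpow_le_one_of_one_le_of_nonpos (one_le_bracket (modulation c (z.1 + z.2)))
    (show (-(23 / 100) : ℝ) ≤ 0 by norm_num)
  linarith

theorem le_abs_sumXi (z : Freq × Freq) : |z.1.2.1| ≤ |sumXi z| + |z.2.2.1| ∧
    |z.2.2.1| ≤ |sumXi z| + |z.1.2.1| ∧ |sumXi z| ≤ |z.1.2.1| + |z.2.2.1| := by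
  have e1 : z.1.2.1 = sumXi z - z.2.2.1 := by simp [sumXi]
  have e2 : z.2.2.1 = sumXi z - z.1.2.1 := by simp [sumXi]
  have h3 := abs_sub (sumXi z) z.2.2.1
  have h4 := abs_sub (sumXi z) z.1.2.1
  rw [← e1] at h3
  rw [← e2] at h4
  exact ⟨h3, h4, abs_add_le _ _⟩

section
variable {G : ℝ → ℝ≥0∞}

theorem uniformBound_low (hG : Measurable G) (hG1 : ∀ x, G x ≤ 1) (hI : ∫⁻ x, G x ≠ ∞) :
    UniformBound fun c => regionKernel G c {z | |z.1.2.1| ≤ 16 ∧ |z.2.2.1| ≤ 16} fun _ => 1 :=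
  .of_exists hG (fun _ => (measurableSet_le (by fun_prop) (by fun_prop)).and
    (measurableSet_le (by fun_prop) (by fun_prop))) (fun _ => measurable_const)
    (exists_trilinearBound_low hG hG1 hI)

theorem uniformBound_lowHigh (hG : Measurable G) (hI : ∫⁻ x, G x ≠ ∞) :
    UniformBound fun c => regionKernel G c (lowHighRegion c)
      fun z => bracket (sumXi z) ^ (9 / 4 : ℝ) * outputFactor c z :=
  .of_exists hG measurableSet_lowHighRegion (fun _ => by fun_prop)
    (exists_trilinearBound_lowHigh hG hI)

theorem uniformBound_highLow (hG : Measurable G) (hI : ∫⁻ x, G x ≠ ∞) :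
    UniformBound fun c => regionKernel G c
      (dominantRegion c ∩ {z | |z.1.2.1| ≤ |sumXi z| / 4 ∧ 4 ≤ |sumXi z|})
      fun z => bracket (sumXi z) ^ (9 / 4 : ℝ) * outputFactor c z := by
  refine (uniformBound_lowHigh hG hI).swap_region.of_le zero_le_one fun c z hz => ⟨?_, ?_⟩
  · refine ⟨swap_mem_dominantRegion.2 hz.1, ?_⟩
    have := hz.2
    simpa [sumXi_swap] using! this
  · simp [sumXi_swap, outputFactor_swap]

/-- The two derivatives are weaker than the multiplier treated in the low-high interaction. -/
theorem sq_le_bracket_rpow (x : ℝ) : x ^ 2 ≤ bracket x ^ (9 / 4 : ℝ) := by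
  calc x ^ 2 = |x| ^ 2 := (sq_abs x).symm
    _ ≤ bracket x ^ 2 := by gcongr; exact abs_le_bracket x
    _ = bracket x ^ (2 : ℝ) := (Real.rpow_two _).symm
    _ ≤ _ := Real.rpow_le_rpow_of_exponent_le (one_le_bracket x) (by norm_num)

/-- The region where the output has the largest modulation, with the weights of the output. -/
theorem uniformBound_output (hG : Measurable G) (hG1 : ∀ x, G x ≤ 1) (hI : ∫⁻ x, G x ≠ ∞) :
    UniformBound fun c => regionKernel G c (dominantRegion c)
      fun z => sumXi z ^ 2 * outputFactor c z := by
  have hm : ∀ c, Measurable fun z => sumXi z ^ 2 * outputFactor c z := fun c => by fun_prop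
  have hle : ∀ c z, sumXi z ^ 2 * outputFactor c z ≤
      1 * (bracket (sumXi z) ^ (9 / 4 : ℝ) * outputFactor c z) := fun c z => by
    rw [one_mul]
    exact mul_le_mul_of_nonneg_right (sq_le_bracket_rpow _) (outputFactor_nonneg c z)
  have h1 : UniformBound fun c => regionKernel G c {z | |z.1.2.1| ≤ 16 ∧ |z.2.2.1| ≤ 16}
      fun z => sumXi z ^ 2 * outputFactor c z := by
    refine (uniformBound_low hG hG1 hI).of_le (C := 2048) (by norm_num) fun c z hz => ⟨hz, ?_⟩
    have h := (le_abs_sumXi z).2.2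
    have h2 : sumXi z ^ 2 ≤ 1024 := by
      rw [← sq_abs]
      nlinarith [hz.1, hz.2, abs_nonneg (sumXi z)]
    have := outputFactor_le_two c z
    have := outputFactor_nonneg c z
    nlinarith
  have h2 := (uniformBound_lowHigh hG hI).of_le zero_le_one
    (R := lowHighRegion) (m := fun c z => sumXi z ^ 2 * outputFactor c z)
    fun c z hz => ⟨hz, hle c z⟩
  have h3 := (uniformBound_highLow hG hI).of_le zero_le_one
    (R := fun c => dominantRegion c ∩ {z | |z.1.2.1| ≤ |sumXi z| / 4 ∧ 4 ≤ |sumXi z|})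
    (m := fun c z => sumXi z ^ 2 * outputFactor c z) fun c z hz => ⟨hz, hle c z⟩
  have h4 := UniformBound.of_exists hG measurableSet_comparableRegion hm
    (exists_trilinearBound_comparable hG hG1 hI)
  have h5 := UniformBound.of_exists hG measurableSet_largeRegion hm
    (exists_trilinearBound_large hG hG1 hI)
  refine h1.of_union (h2.of_union (h3.of_union (h4.of_union h5
    (R := fun c => comparableRegion c ∪ largeRegion c) fun c z hz => hz)
    (R := fun c => dominantRegion c ∩ {z | |z.1.2.1| ≤ |sumXi z| / 4 ∧ 4 ≤ |sumXi z|} ∪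
      (comparableRegion c ∪ largeRegion c)) fun c z hz => hz)
    (R := fun c => lowHighRegion c ∪
      (dominantRegion c ∩ {z | |z.1.2.1| ≤ |sumXi z| / 4 ∧ 4 ≤ |sumXi z|} ∪
      (comparableRegion c ∪ largeRegion c))) fun c z hz => hz) fun c z hz => ?_
  obtain ⟨i1, i2, i3⟩ := le_abs_sumXi z
  by_cases hlow : |z.1.2.1| ≤ 16 ∧ |z.2.2.1| ≤ 16
  · exact Or.inl hlow
  have hmax : 16 < |z.1.2.1| ∨ 16 < |z.2.2.1| := by
    by_contra! h; exact hlow h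
  right
  by_cases hd : |z.2.2.1| ≤ |sumXi z| / 4
  · refine Or.inl ⟨hz, hd, ?_⟩
    rcases hmax with h | h <;> linarith
  by_cases ha : |z.1.2.1| ≤ |sumXi z| / 4
  · refine Or.inr (Or.inl ⟨hz, ha, ?_⟩)
    rcases hmax with h | h <;> linarith
  push Not at hd ha
  refine Or.inr (Or.inr ?_)
  -- If one input exceeds `4|ξ|`, the triangle inequality makes the other exceed `3|ξ|`, and since
  -- one of them exceeds 16, `|ξ₁| ≥ 12`.
  by_cases hM : |z.1.2.1| ≤ 4 * |sumXi z| ∧ |z.2.2.1| ≤ 4 * |sumXi z|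
  · refine Or.inl ⟨hz, hM.1, hM.2, by linarith, by linarith, ?_⟩
    rcases hmax with h | h <;> linarith [hM.1, hM.2]
  · have hM' : 4 * |sumXi z| < |z.1.2.1| ∨ 4 * |sumXi z| < |z.2.2.1| := by
      by_contra! h; exact hM h
    refine Or.inr ⟨hz, ?_⟩
    simp only [Set.mem_ofPred_eq]
    refine ⟨?_, ?_, ?_⟩
    · rcases hM' with h | h <;> linarith
    · rcases hM' with h | h <;> linarith
    · rcases hM' with h | h <;> rcases hmax with h' | h' <;> linarith

end

/-! ### Dominant output of tiny frequency: the Poisson kernel in the slope -/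

theorem lintegral_inv_one_add_sq :
    ∫⁻ x : ℝ, ENNReal.ofReal (1 + x ^ 2)⁻¹ = ENNReal.ofReal Real.pi := by
  rw [← integral_univ_inv_one_add_sq, ofReal_integral_eq_lintegral_ofReal]
  · exact integrable_inv_one_add_sq
  · exact Filter.Eventually.of_forall fun x => by positivity

/-- Integration of a Poisson kernel in the slope variable. -/
theorem lintegral_slope_poisson {M x : ℝ} (hM : 0 < M) (hx : x ≠ 0) (s : ℝ) :
    ∫⁻ y, ENNReal.ofReal (M / (M ^ 2 + (s - y / x) ^ 2)) = ENNReal.ofReal (|x| * Real.pi) := by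
  have hxM : x * M ≠ 0 := mul_ne_zero hx hM.ne'
  rw [lintegral_eq_abs_mul_lintegral_comp_mul hxM]
  have e : ∀ t : ℝ, ENNReal.ofReal (M / (M ^ 2 + (s - t * (x * M) / x) ^ 2)) =
      ENNReal.ofReal M⁻¹ * ENNReal.ofReal (1 + (t - s / M) ^ 2)⁻¹ := by
    intro t
    rw [← ENNReal.ofReal_mul (by positivity), ← mul_inv]
    congr 1
    have e1 : t * (x * M) / x = t * M := by field_simp
    rw [e1, show M ^ 2 + (s - t * M) ^ 2 = M * (M * (1 + (t - s / M) ^ 2)) by field_simp; ring]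
    field_simp
  simp_rw [e]
  rw [lintegral_const_mul _ (by fun_prop),
    lintegral_sub_right_eq_self (fun t : ℝ => ENNReal.ofReal (1 + t ^ 2)⁻¹),
    lintegral_inv_one_add_sq, ← ENNReal.ofReal_mul (by positivity),
    ← ENNReal.ofReal_mul (by positivity), abs_mul, abs_of_pos hM]
  congr 1
  field_simp

/-- At a fixed first frequency, integration against a weight in `(ξ₂, η₂)`. -/
theorem lintegral_mul_modulation_left {G : ℝ → ℝ≥0∞} (hG : Measurable G) (c : ℝ)
    {K : ℝ → ℝ → ℝ≥0∞} (hK : Measurable (Function.uncurry K)) :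
    ∫⁻ q : Freq, K q.2.1 q.2.2 * G (modulation c q) = (∫⁻ x, ∫⁻ y, K x y) * ∫⁻ x, G x := by
  have hK' : Measurable fun q : ℝ × ℝ => K q.1 q.2 := hK
  have hK2 : Measurable fun q : Freq => K q.2.1 q.2.2 := hK'.comp measurable_snd
  rw [Measure.volume_eq_prod, lintegral_prod_symm' _ (by fun_prop)]
  have : ∀ y : ℝ × ℝ, ∫⁻ t, K y.1 y.2 * G (modulation c (t, y)) = K y.1 y.2 * ∫⁻ x, G x := by
    intro y
    rw [lintegral_const_mul _ (by fun_prop)]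
    congr 1
    exact lintegral_modulation c y.1 y.2
  refine (lintegral_congr this).trans ?_
  rw [lintegral_mul_const _ hK', Measure.volume_eq_prod, lintegral_prod _ (by fun_prop)]

theorem lintegral_rpow_unit_interval_ne_top :
    ∫⁻ x : ℝ, {x : ℝ | |x| ≤ 1}.indicator
      (fun x => ENNReal.ofReal (|x| ^ (-(4 / 5) : ℝ))) x ≠ ∞ := by
  have h : {x : ℝ | |x| ≤ 1} = Set.Icc (-1) 1 := by
    ext x; simp only [Set.mem_ofPred_eq, Set.mem_Icc, abs_le]
  rw [h, lintegral_indicator measurableSet_Icc]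
  have h1 : IntervalIntegrable (fun x : ℝ => x ^ (-(4 / 5) : ℝ)) volume 0 1 :=
    intervalIntegral.intervalIntegrable_rpow' (by norm_num)
  have h2 : IntegrableOn (fun x : ℝ => |x| ^ (-(4 / 5) : ℝ)) (Set.Ioc 0 1) := by
    rw [intervalIntegrable_iff_integrableOn_Ioc_of_le zero_le_one] at h1
    refine h1.congr_fun (fun x hx => ?_) measurableSet_Ioc
    simp only [abs_of_pos hx.1]
  have h3 : IntegrableOn (fun x : ℝ => |x| ^ (-(4 / 5) : ℝ)) (Set.Ico (-1) 0) := by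
    have := h2.comp_neg
    simpa using this
  have h4 : IntegrableOn (fun x : ℝ => |x| ^ (-(4 / 5) : ℝ)) (Set.Icc (-1) 1) := by
    have h5 : Set.Icc (-1 : ℝ) 1 ⊆ (Set.Ico (-1) 0 ∪ Set.Ioc 0 1) ∪ {0} := by
      intro x hx
      rcases lt_trichotomy x 0 with h | h | h
      · exact Or.inl (Or.inl ⟨hx.1, h⟩)
      · exact Or.inr h
      · exact Or.inl (Or.inr ⟨h, hx.2⟩)
    exact ((h3.union h2).union (by simp)).mono_set h5
  refine ne_top_of_le_ne_top h4.2.ne (lintegral_mono fun x => ?_)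
  rw [← ofReal_norm]
  gcongr
  exact le_abs_self _

/-- The output frequency is tiny compared to the large inputs. -/
def tinyOutputRegion (c : ℝ) : Set (Freq × Freq) :=
  dominantRegion c ∩ {z | 4 * |sumXi z| ≤ |z.1.2.1| ∧ 1 ≤ |z.1.2.1| ∧
    |sumXi z| * |z.1.2.1| ^ (1 / 8 : ℝ) ≤ 1}

theorem measurableSet_tinyOutputRegion (c : ℝ) : MeasurableSet (tinyOutputRegion c) :=
  (measurableSet_dominantRegion c).inter ((measurableSet_le (by fun_prop) (by fun_prop)).and
    ((measurableSet_le (by fun_prop) (by fun_prop)).and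
    (measurableSet_le (by fun_prop) (by fun_prop))))

/-- Both terms of the resonance are kept: `S ≥ Q` with `Q = a²(M² + θ²)/(4M)`. One full power `Q⁻¹`
cancels `a²` and leaves a Poisson kernel of width `M` in `θ`; the other `12/25` of the exponent only
uses `Q ≥ a² M/4`. -/
theorem tinyOutput_bracket_rpow_le {c : ℝ} {z : Freq × Freq} (hz : z ∈ tinyOutputRegion c) :
    z.1.2.1 ^ 2 * bracket (modulation c (z.1 + z.2)) ^ (-(37 / 25) : ℝ) ≤
      16 * (|sumXi z| / (|sumXi z| ^ 2 + slopeGap z.1 z.2 ^ 2)) *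
        (|z.1.2.1| ^ (-(24 / 25) : ℝ) * |sumXi z| ^ (-(12 / 25) : ℝ)) := by
  obtain ⟨hd, h1, h2, -⟩ := hz
  have hres := resonance_le c hd
  have hM0 : 0 < |sumXi z| := abs_pos.2 hd.2.2.1
  have hd2 : 3 / 4 * |z.1.2.1| ≤ |z.2.2.1| := by
    have := (le_abs_sumXi z).1
    linarith
  have hS := abs_le_bracket (modulation c (z.1 + z.2))
  rw [← sq_abs z.1.2.1]
  set S := bracket (modulation c (z.1 + z.2))
  set M := |sumXi z|
  set a := |z.1.2.1|
  set θ := slopeGap z.1 z.2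
  have ha0 : 0 < a := by linarith
  set Q := a ^ 2 * (M ^ 2 + θ ^ 2) / (4 * M) with hQ
  have hQ0 : 0 < Q := by positivity
  have hQS : Q ≤ S := by
    have h3 : a * (3 / 4 * a) * (M + θ ^ 2 / M) ≤ a * |z.2.2.1| * (3 * M + θ ^ 2 / M) := by
      gcongr; linarith
    have h4 : Q = a * (3 / 4 * a) * (M + θ ^ 2 / M) / 3 := by
      rw [hQ]; field_simp
    rw [h4]; linarith
  have hQ1 : a ^ 2 * M / 4 ≤ Q := by
    rw [hQ, div_le_div_iff₀ (by positivity) (by positivity)]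
    have : 0 ≤ a ^ 2 * θ ^ 2 := by positivity
    nlinarith
  have hS' : S ^ (-(37 / 25) : ℝ) ≤ Q⁻¹ * (a ^ 2 * M / 4) ^ (-(12 / 25) : ℝ) := by
    calc S ^ (-(37 / 25) : ℝ) ≤ Q ^ (-(37 / 25) : ℝ) :=
          Real.rpow_le_rpow_of_nonpos hQ0 hQS (by norm_num)
      _ = Q ^ (-1 : ℝ) * Q ^ (-(12 / 25) : ℝ) := by rw [← Real.rpow_add hQ0]; norm_num
      _ ≤ _ := by
          rw [Real.rpow_neg_one]
          exact mul_le_mul_of_nonneg_left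
            (Real.rpow_le_rpow_of_nonpos (by positivity) hQ1 (by norm_num)) (by positivity)
  have h4 : (a ^ 2 * M / 4) ^ (-(12 / 25) : ℝ) ≤
      4 * (a ^ (-(24 / 25) : ℝ) * M ^ (-(12 / 25) : ℝ)) := by
    have := rpow_neg_le_mul_rpow_neg (X := a ^ 2 * M) (S := a ^ 2 * M / 4) (k := 4) (e := 12 / 25)
      (by positivity) (by norm_num) (by linarith) (by norm_num) (by norm_num)
    refine this.trans_eq ?_
    rw [Real.mul_rpow (by positivity) hM0.le, ← Real.rpow_natCast, ← Real.rpow_mul ha0.le]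
    norm_num
  calc _ ≤ a ^ 2 * (Q⁻¹ * (4 * (a ^ (-(24 / 25) : ℝ) * M ^ (-(12 / 25) : ℝ)))) := by
        gcongr; exact hS'.trans (by gcongr)
    _ = _ := by
        rw [hQ]; field_simp; ring

section
variable {G : ℝ → ℝ≥0∞}

/-- With the first input fixed, `G(σ₁)` absorbs `⟨σ₁⟩^{1/2}` and `G(σ₂)` is integrated in `τ`. The
Poisson kernel integrates in `η₂` to `π|ξ₂|`, independently of its width `M = |ξ|`, and an
integrable singularity in `ξ` is left. -/
theorem uniformBound_tinyOutput (hG : Measurable G)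
    (hG2 : ∀ x, G x * ENNReal.ofReal (bracket x ^ (1 / 2 : ℝ)) ≤ 1) (hI : ∫⁻ x, G x ≠ ∞) :
    UniformBound fun c => regionKernel G c (tinyOutputRegion c) fun z =>
      z.1.2.1 ^ 2 * (bracket (modulation c z.1) ^ (1 / 2 : ℝ) *
        bracket (modulation c (z.1 + z.2)) ^ (-(37 / 25) : ℝ)) := by
  have hm : ∀ c, Measurable fun z : Freq × Freq => z.1.2.1 ^ 2 *
      (bracket (modulation c z.1) ^ (1 / 2 : ℝ) *
        bracket (modulation c (z.1 + z.2)) ^ (-(37 / 25) : ℝ)) := fun c => by fun_prop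
  set I₀ := ∫⁻ x : ℝ, {x : ℝ | |x| ≤ 1}.indicator
      (fun x => ENNReal.ofReal (|x| ^ (-(4 / 5) : ℝ))) x with hI₀
  have hI₀t : I₀ ≠ ∞ := lintegral_rpow_unit_interval_ne_top
  refine .of_exists hG measurableSet_tinyOutputRegion hm
    ⟨((ENNReal.ofReal (20 * Real.pi) * I₀) * ∫⁻ x, G x) ^ (1 / 2 : ℝ), by finiteness, fun c => ?_⟩
  refine TrilinearBound.of_sup_left (measurable_regionKernel hG (measurableSet_tinyOutputRegion c)
    (hm c)) fun p => ?_
  rw [ENNReal.rpow_half_sq]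
  set a := |p.2.1| with ha
  by_cases ha1 : 1 ≤ a
  swap
  · have : ∀ q, regionKernel G c (tinyOutputRegion c) (fun z => z.1.2.1 ^ 2 *
      (bracket (modulation c z.1) ^ (1 / 2 : ℝ) *
        bracket (modulation c (z.1 + z.2)) ^ (-(37 / 25) : ℝ))) (p, q) = 0 := by
      intro q
      by_contra h
      exact ha1 (mem_of_regionKernel_ne_zero h).2.2.1
    rw [lintegral_congr this, lintegral_zero]
    exact zero_le
  have ha0 : 0 < a := by linarith
  set E : Set ℝ := {x | |p.2.1 + x| ≠ 0 ∧ 4 * |p.2.1 + x| ≤ a ∧ x ≠ 0 ∧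
    |p.2.1 + x| * a ^ (1 / 8 : ℝ) ≤ 1} with hE
  have hEm : MeasurableSet E := by
    refine MeasurableSet.and ?_ (MeasurableSet.and ?_ (MeasurableSet.and ?_ ?_))
    · exact (measurableSet_eq_fun (by fun_prop) (by fun_prop)).compl
    · exact measurableSet_le (by fun_prop) (by fun_prop)
    · exact (measurableSet_eq_fun (by fun_prop) (by fun_prop)).compl
    · exact measurableSet_le (by fun_prop) (by fun_prop)
  set H : ℝ → ℝ≥0∞ := E.indicator fun x => ENNReal.ofReal
    (16 * (a ^ (-(24 / 25) : ℝ) * |p.2.1 + x| ^ (-(12 / 25) : ℝ))) with hH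
  have hHm : Measurable H := Measurable.indicator (by fun_prop) hEm
  set K : ℝ → ℝ → ℝ≥0∞ := fun x y => H x * ENNReal.ofReal
    (|p.2.1 + x| / (|p.2.1 + x| ^ 2 + (p.2.2 / p.2.1 - y / x) ^ 2)) with hK
  have hKm : Measurable (Function.uncurry K) := by
    simp only [Function.uncurry_def, hK]; fun_prop
  have hpt : ∀ q, regionKernel G c (tinyOutputRegion c) (fun z => z.1.2.1 ^ 2 *
      (bracket (modulation c z.1) ^ (1 / 2 : ℝ) *
        bracket (modulation c (z.1 + z.2)) ^ (-(37 / 25) : ℝ))) (p, q) ≤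
      K q.2.1 q.2.2 * G (modulation c q) := by
    intro q
    by_cases hq : (p, q) ∈ tinyOutputRegion c
    · have h1 := tinyOutput_bracket_rpow_le hq
      have hqE : q.2.1 ∈ E :=
        ⟨abs_ne_zero.2 hq.1.2.2.1, hq.2.1, hq.1.2.1, hq.2.2.2⟩
      simp only [regionKernel, Set.indicator_of_mem hq, modulationProduct, hK, hH,
        Set.indicator_of_mem hqE]
      have h0 : 0 ≤ bracket (modulation c p) ^ (1 / 2 : ℝ) := by
        have := bracket_pos (modulation c p); positivity
      have h00 := bracket_pos (modulation c (p + q))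
      rw [mul_left_comm, mul_left_comm (p.2.1 ^ 2), ENNReal.ofReal_mul h0]
      calc _ = (G (modulation c p) * ENNReal.ofReal (bracket (modulation c p) ^ (1 / 2 : ℝ))) *
            ENNReal.ofReal (p.2.1 ^ 2 * bracket (modulation c (p + q)) ^ (-(37 / 25) : ℝ)) *
            G (modulation c q) := by ring
        _ ≤ 1 * ENNReal.ofReal (p.2.1 ^ 2 * bracket (modulation c (p + q)) ^ (-(37 / 25) : ℝ)) *
            G (modulation c q) := by gcongr; exact hG2 _
        _ ≤ _ := by
            rw [one_mul, ← ENNReal.ofReal_mul (by positivity)]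
            refine mul_le_mul_left (ENNReal.ofReal_le_ofReal (h1.trans_eq ?_)) _
            simp only [sumXi, slopeGap]
            ring
    · simp [regionKernel, hq]
  refine (lintegral_mono hpt).trans ?_
  rw [lintegral_mul_modulation_left hG c hKm]
  gcongr
  have hin : ∀ x, ∫⁻ y, K x y ≤ ENNReal.ofReal (20 * Real.pi) *
      {x : ℝ | |x| ≤ 1}.indicator (fun x => ENNReal.ofReal (|x| ^ (-(4 / 5) : ℝ))) (x + p.2.1) := by
    intro x
    simp only [hK]
    rw [lintegral_const_mul _ (by fun_prop)]
    by_cases hx : x ∈ E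
    · obtain ⟨h1, h2, h3, h4⟩ := hx
      have hM0 : 0 < |p.2.1 + x| := lt_of_le_of_ne (abs_nonneg _) h1.symm
      have h8 : 1 ≤ a ^ (1 / 8 : ℝ) := Real.one_le_rpow ha1 (by norm_num)
      have hM1 : |p.2.1 + x| ≤ 1 := by nlinarith
      rw [lintegral_slope_poisson hM0 h3, hH, Set.indicator_of_mem (by exact ⟨h1, h2, h3, h4⟩),
        Set.indicator_of_mem (by simpa [add_comm] using! hM1),
        ← ENNReal.ofReal_mul (by positivity), ← ENNReal.ofReal_mul (by positivity)]
      apply ENNReal.ofReal_le_ofReal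
      rw [add_comm x]
      set M := |p.2.1 + x| with hM
      have hxa : |x| ≤ 5 / 4 * a := by
        have := abs_sub (p.2.1 + x) p.2.1
        rw [add_sub_cancel_left] at this
        linarith
      -- Multiplying `a^{-24/25}` by `|ξ₂| ≲ a` leaves an excess `a^{1/25}`. The condition `M
      -- a^{1/8} ≤ 1`, raised to the power `8/25`, converts it into `M^{-8/25}`; with `M^{-12/25}`
      -- this gives the integrable `M^{-4/5}`.
      have h5 : a ^ (1 / 25 : ℝ) * M ^ (8 / 25 : ℝ) ≤ 1 := by
        have : a ^ (1 / 25 : ℝ) * M ^ (8 / 25 : ℝ) = (M * a ^ (1 / 8 : ℝ)) ^ (8 / 25 : ℝ) := by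
          rw [Real.mul_rpow hM0.le (by positivity), ← Real.rpow_mul ha0.le, mul_comm]
          norm_num
        rw [this]
        exact Real.rpow_le_one (by positivity) h4 (by norm_num)
      calc _ ≤ 16 * (a ^ (-(24 / 25) : ℝ) * M ^ (-(12 / 25) : ℝ)) * (5 / 4 * a * Real.pi) := by
            gcongr
        _ = 20 * Real.pi * ((a ^ (-(24 / 25) : ℝ) * a ^ (1 : ℝ)) * M ^ (-(12 / 25) : ℝ)) := by
            rw [Real.rpow_one]; ring
        _ = 20 * Real.pi * ((a ^ (1 / 25 : ℝ) * M ^ (8 / 25 : ℝ)) * M ^ (-(4 / 5) : ℝ)) := by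
            rw [← Real.rpow_add ha0, mul_assoc (a ^ (1 / 25 : ℝ)), ← Real.rpow_add hM0]
            norm_num
        _ ≤ 20 * Real.pi * (1 * M ^ (-(4 / 5) : ℝ)) := by gcongr
        _ = _ := by rw [one_mul]
    · rw [hH, Set.indicator_of_notMem hx, zero_mul]
      exact zero_le
  refine (lintegral_mono hin).trans ?_
  rw [lintegral_const_mul' _ _ ENNReal.ofReal_ne_top,
    lintegral_add_right_eq_self (fun x : ℝ => {x : ℝ | |x| ≤ 1}.indicator
      (fun x => ENNReal.ofReal (|x| ^ (-(4 / 5) : ℝ))) x)]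

end

/-! ### Quotients of inner weights when an input is dominant -/

/-- The inner weight `⟨⟨σ⟩ / ⟨ξ⟩³⟩`. -/
noncomputable def innerWeight (σ ξ : ℝ) : ℝ := bracket (bracket σ / bracket ξ ^ 3)

theorem one_le_innerWeight (σ ξ : ℝ) : 1 ≤ innerWeight σ ξ := one_le_bracket _

theorem innerWeight_pos (σ ξ : ℝ) : 0 < innerWeight σ ξ := bracket_pos _

theorem innerWeight_le (σ ξ : ℝ) : innerWeight σ ξ ≤ 1 + bracket σ / bracket ξ ^ 3 := by
  have h1 := bracket_pos σ
  have h2 := bracket_pos ξ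
  have h := bracket_le_one_add (bracket σ / bracket ξ ^ 3)
  rwa [abs_of_pos (by positivity)] at h

theorem div_le_innerWeight (σ ξ : ℝ) : bracket σ / bracket ξ ^ 3 ≤ innerWeight σ ξ :=
  (le_abs_self _).trans (abs_le_bracket _)

theorem bracket_le_mul_bracket {x y k : ℝ} (hk : 1 ≤ k) (h : |x| ≤ k * |y|) :
    bracket x ≤ k * bracket y := by
  unfold bracket
  rw [Real.norm_eq_abs, Real.norm_eq_abs, Real.sqrt_le_left (by positivity), mul_pow,
    Real.sq_sqrt (by positivity)]
  have := pow_le_pow_left₀ (abs_nonneg x) h 2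
  nlinarith

theorem bracket_le_bracket_of_abs_le {x y : ℝ} (h : |x| ≤ |y|) : bracket x ≤ bracket y := by
  simpa using bracket_le_mul_bracket le_rfl (by simpa using h)

/-- A bound for `x ^ (2 b)` with `1/2 ≤ 2 b ≤ 3/4`. -/
noncomputable def ratioPower (x : ℝ) : ℝ := x ^ (1 / 2 : ℝ) + x ^ (3 / 4 : ℝ)

theorem ratioPower_nonneg {x : ℝ} (hx : 0 ≤ x) : 0 ≤ ratioPower x := by
  unfold ratioPower; positivity

theorem rpow_le_ratioPower {x e : ℝ} (hx : 0 < x) (he : 1 / 2 ≤ e) (he' : e ≤ 3 / 4) :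
    x ^ e ≤ ratioPower x := by
  unfold ratioPower
  rcases le_total x 1 with h | h
  · have := Real.rpow_le_rpow_of_exponent_ge hx h he
    have : 0 ≤ x ^ (3 / 4 : ℝ) := by positivity
    linarith
  · have := Real.rpow_le_rpow_of_exponent_le h he'
    have : 0 ≤ x ^ (1 / 2 : ℝ) := by positivity
    linarith

theorem ratioPower_le {x X : ℝ} (hx : 0 ≤ x) (hX : x ≤ X) (h1 : 1 ≤ X) :
    ratioPower x ≤ 2 * X ^ (3 / 4 : ℝ) := by
  unfold ratioPower
  have i1 : x ^ (1 / 2 : ℝ) ≤ X ^ (1 / 2 : ℝ) := by gcongr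
  have i2 : x ^ (3 / 4 : ℝ) ≤ X ^ (3 / 4 : ℝ) := by gcongr
  have i3 : X ^ (1 / 2 : ℝ) ≤ X ^ (3 / 4 : ℝ) :=
    Real.rpow_le_rpow_of_exponent_le h1 (by norm_num)
  linarith

theorem ratioPower_le_two_mul {x X : ℝ} (hx : 0 ≤ x) (hX : x ≤ X) (h1 : 1 ≤ X) :
    ratioPower x ≤ 2 * X := by
  refine (ratioPower_le hx hX h1).trans ?_
  have : X ^ (3 / 4 : ℝ) ≤ X ^ (1 : ℝ) := Real.rpow_le_rpow_of_exponent_le h1 (by norm_num)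
  rw [Real.rpow_one] at this
  linarith

theorem ratioPower_le_of_le_two {x : ℝ} (hx : 0 ≤ x) (hX : x ≤ 2) :
    ratioPower x ≤ 3 * x ^ (1 / 2 : ℝ) := by
  unfold ratioPower
  rcases hx.eq_or_lt with rfl | hx
  · norm_num
  have e : x ^ (3 / 4 : ℝ) = x ^ (1 / 4 : ℝ) * x ^ (1 / 2 : ℝ) := by
    rw [← Real.rpow_add hx]; norm_num
  have h2 : x ^ (1 / 4 : ℝ) ≤ 2 := by
    calc x ^ (1 / 4 : ℝ) ≤ 2 ^ (1 / 4 : ℝ) := by gcongr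
      _ ≤ 2 ^ (1 : ℝ) := Real.rpow_le_rpow_of_exponent_le (by norm_num) (by norm_num)
      _ = 2 := Real.rpow_one 2
  rw [e]
  have : 0 ≤ x ^ (1 / 2 : ℝ) := by positivity
  nlinarith

/-- The quotient of the inner weights of the first factor and of the output. -/
noncomputable def weightRatio (c : ℝ) (z : Freq × Freq) : ℝ :=
  innerWeight (modulation c z.1) z.1.2.1 / innerWeight (modulation c (z.1 + z.2)) (sumXi z)

theorem weightRatio_pos (c : ℝ) (z : Freq × Freq) : 0 < weightRatio c z :=
  div_pos (innerWeight_pos _ _) (innerWeight_pos _ _)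

/-- The bound for the squared modulation weights when a factor has the derivative. -/
noncomputable def inputFactor (c : ℝ) (z : Freq × Freq) : ℝ :=
  ratioPower (weightRatio c z) * bracket (modulation c (z.1 + z.2)) ^ (-(49 / 50) : ℝ)

theorem bracket_rpow_le_outputFactor (c : ℝ) (z : Freq × Freq) :
    bracket (modulation c (z.1 + z.2)) ^ (-(49 / 50) : ℝ) ≤ outputFactor c z := by
  have h1 := bracket_pos (modulation c (z.1 + z.2))
  have h2 := bracket_pos (sumXi z)
  unfold outputFactor
  apply le_mul_of_one_le_left (by positivity)
  apply Real.one_le_rpow _ (by norm_num)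
  have : 0 ≤ bracket (modulation c (z.1 + z.2)) / bracket (sumXi z) ^ 3 := by positivity
  linarith

/-- The numerator is at most `1 + S/J₁³` because the output modulation dominates. The denominator is
at least 1 and at least `S/J³`, which handles the two summands separately. -/
theorem weightRatio_le (c : ℝ) {z : Freq × Freq} (hz : z ∈ dominantRegion c) :
    weightRatio c z ≤ 1 + (bracket (sumXi z) / bracket z.1.2.1) ^ 3 := by
  have hS : bracket (modulation c z.1) ≤ bracket (modulation c (z.1 + z.2)) :=
    bracket_le_bracket_of_abs_le hz.2.2.2.1
  have h1 := innerWeight_le (modulation c z.1) z.1.2.1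
  have h2 := div_le_innerWeight (modulation c (z.1 + z.2)) (sumXi z)
  have h3 := one_le_innerWeight (modulation c (z.1 + z.2)) (sumXi z)
  have hJ := bracket_pos (sumXi z)
  have hJ1 := bracket_pos z.1.2.1
  unfold weightRatio
  rw [div_le_iff₀ (by linarith)]
  set b := innerWeight (modulation c (z.1 + z.2)) (sumXi z)
  set J := bracket (sumXi z)
  set J1 := bracket z.1.2.1
  set S := bracket (modulation c (z.1 + z.2))
  rw [div_le_iff₀ (by positivity)] at h2
  calc _ ≤ 1 + S / J1 ^ 3 := h1.trans (by gcongr)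
    _ ≤ b + b * J ^ 3 / J1 ^ 3 := by gcongr
    _ = _ := by rw [div_pow]; ring

/-- The derivative falls on the large `ξ₁`, but the weight quotient is small: at most `t⁻¹ +
(J/J₁)³` with `t = S/J³`. Its square root, together with the spare factor `t^{3/4}` of the output
case, pays for replacing `ξ₁²` by `ξ²`, as `t ≳ a² M/J³`. This fails only for very small `M`, which
the last hypothesis excludes. -/
theorem ratioPower_weightRatio_le_of_large {c : ℝ} {z : Freq × Freq} (hz : z ∈ dominantRegion c)
    (h4 : 4 * |sumXi z| ≤ |z.1.2.1|) (h1 : 1 ≤ |z.1.2.1|)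
    (h8 : 1 ≤ |sumXi z| * |z.1.2.1| ^ (1 / 8 : ℝ)) :
    z.1.2.1 ^ 2 * ratioPower (weightRatio c z) ≤ 192 * (sumXi z ^ 2 *
      (1 + bracket (modulation c (z.1 + z.2)) / bracket (sumXi z) ^ 3) ^ (3 / 4 : ℝ)) := by
  have hM0 : 0 < |sumXi z| := abs_pos.2 hz.2.2.1
  have hx0 := weightRatio_pos c z
  have hJ1J : bracket (sumXi z) ≤ bracket z.1.2.1 := bracket_le_bracket_of_abs_le (by linarith)
  have hx2 : weightRatio c z ≤ 2 := by
    have h := weightRatio_le c hz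
    have : (bracket (sumXi z) / bracket z.1.2.1) ^ 3 ≤ 1 := by
      have := bracket_pos (sumXi z)
      have := bracket_pos z.1.2.1
      apply pow_le_one₀ (by positivity)
      rwa [div_le_one (by positivity)]
    linarith
  have hS : bracket (modulation c z.1) ≤ bracket (modulation c (z.1 + z.2)) :=
    bracket_le_bracket_of_abs_le hz.2.2.2.1
  have hres := mul_abs_le_bracket_modulation c hz
  have hd := (le_abs_sumXi z).1
  have i1 := innerWeight_le (modulation c z.1) z.1.2.1
  have i2 := div_le_innerWeight (modulation c (z.1 + z.2)) (sumXi z)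
  have hJ := bracket_pos (sumXi z)
  have hJ1 := bracket_pos z.1.2.1
  have hJM := bracket_le_one_add (sumXi z)
  have hJ1a := abs_le_bracket z.1.2.1
  have hS0 := bracket_pos (modulation c (z.1 + z.2))
  have hr := ratioPower_le_of_le_two hx0.le hx2
  have hx : weightRatio c z ≤
      (bracket (modulation c (z.1 + z.2)) / bracket (sumXi z) ^ 3)⁻¹ +
        (bracket (sumXi z) / bracket z.1.2.1) ^ 3 := by
    unfold weightRatio
    calc _ ≤ (1 + bracket (modulation c (z.1 + z.2)) / bracket z.1.2.1 ^ 3) /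
          (bracket (modulation c (z.1 + z.2)) / bracket (sumXi z) ^ 3) := by
          have := innerWeight_pos (modulation c z.1) z.1.2.1
          gcongr
          exact i1.trans (by gcongr)
      _ = _ := by field_simp
  rw [← sq_abs z.1.2.1, ← sq_abs (sumXi z)]
  set x := weightRatio c z
  set S := bracket (modulation c (z.1 + z.2))
  set J := bracket (sumXi z)
  set J1 := bracket z.1.2.1
  set M := |sumXi z|
  set a := |z.1.2.1|
  have ha0 : 0 < a := by linarith
  set t := S / J ^ 3 with ht
  have ht0 : 0 < t := by positivity
  -- The required powers of `t` are multiples of `1/4`; with `u` they become integral and the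
  -- inequalities can be compared after taking fourth powers.
  set u := t ^ (1 / 4 : ℝ) with hu
  have hu0 : 0 < u := by positivity
  have hu4 : u ^ 4 = t := by
    rw [hu, ← Real.rpow_natCast, ← Real.rpow_mul ht0.le]; norm_num
  have hM8 : 1 ≤ M ^ 8 * a := by
    have : M ^ 8 * a = (M * a ^ (1 / 8 : ℝ)) ^ 8 := by
      rw [mul_pow, ← Real.rpow_natCast (a ^ (1 / 8 : ℝ)), ← Real.rpow_mul ha0.le]; norm_num
    rw [this]
    exact one_le_pow₀ h8
  -- One inequality for both terms of the quotient: `k1` uses the entry `M²` of the minimum, `k2`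
  -- the entry `a²`. For `M ≤ 1` it rests on `M⁸ a ≥ 1`, for `M ≥ 1` on `J ≤ 2M` and `M ≤ a`.
  have hJ15 : J ^ 15 ≤ 2 ^ 15 * (a ^ 2 * M ^ 11 * min (M ^ 2) (a ^ 2)) := by
    have hMa : M ^ 2 ≤ a ^ 2 := by gcongr; linarith
    rw [min_eq_left hMa]
    rcases le_total M 1 with h | h
    · calc J ^ 15 ≤ 2 ^ 15 := by gcongr; linarith
        _ ≤ 2 ^ 15 * ((M ^ 8 * a) ^ 2) := by
            apply le_mul_of_one_le_right (by positivity)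
            exact one_le_pow₀ hM8
        _ = 2 ^ 15 * (a ^ 2 * M ^ 11 * M ^ 2 * M ^ 3) := by ring
        _ ≤ 2 ^ 15 * (a ^ 2 * M ^ 11 * M ^ 2 * 1) := by
            gcongr; exact pow_le_one₀ hM0.le h
        _ = _ := by ring
    · calc J ^ 15 ≤ (2 * M) ^ 15 := by gcongr; linarith
        _ = 2 ^ 15 * (M ^ 2 * M ^ 11 * M ^ 2) := by ring
        _ ≤ _ := by gcongr
  have htT : a ^ 2 * M ≤ 2 * (t * J ^ 3) := by
    have e : t * J ^ 3 = S := by rw [ht]; field_simp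
    rw [e]
    have : M * (a * (a / 2)) ≤ M * (a * |z.2.2.1|) := by gcongr; linarith
    nlinarith
  have k1 : a ^ 2 ≤ 32 * (M ^ 2 * u ^ 5) := by
    rw [← pow_le_pow_iff_left₀ (by positivity) (by positivity) (four_ne_zero)]
    have e1 : (32 * (M ^ 2 * u ^ 5)) ^ 4 = 2 ^ 20 * (M ^ 8 * t ^ 5) := by rw [← hu4]; ring
    rw [e1]
    have j1 : (a ^ 2 * M) ^ 5 ≤ (2 * (t * J ^ 3)) ^ 5 := by gcongr
    have j2 := hJ15.trans (show _ ≤ 2 ^ 15 * (a ^ 2 * M ^ 11 * M ^ 2) by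
      gcongr; exact min_le_left _ _)
    have hpos : 0 < a ^ 2 * M ^ 5 := by positivity
    refine le_of_mul_le_mul_right ?_ hpos
    calc (a ^ 2) ^ 4 * (a ^ 2 * M ^ 5) = (a ^ 2 * M) ^ 5 := by ring
      _ ≤ (2 * (t * J ^ 3)) ^ 5 := j1
      _ = 2 ^ 5 * t ^ 5 * J ^ 15 := by ring
      _ ≤ 2 ^ 5 * t ^ 5 * (2 ^ 15 * (a ^ 2 * M ^ 11 * M ^ 2)) := by gcongr
      _ = _ := by ring
  set ρ := ((J / J1) ^ 3) ^ (1 / 2 : ℝ) with hρ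
  have hρ2 : ρ ^ 2 = (J / J1) ^ 3 := by
    rw [hρ, ← Real.rpow_natCast, ← Real.rpow_mul (by positivity)]; norm_num
  have hρ0 : 0 ≤ ρ := by positivity
  have k2 : a ^ 2 * ρ ≤ 32 * (M ^ 2 * u ^ 3) := by
    rw [← pow_le_pow_iff_left₀ (by positivity) (by positivity) (four_ne_zero)]
    have e1 : (32 * (M ^ 2 * u ^ 3)) ^ 4 = 2 ^ 20 * (M ^ 8 * t ^ 3) := by rw [← hu4]; ring
    have e2 : (a ^ 2 * ρ) ^ 4 = a ^ 8 * (J / J1) ^ 6 := by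
      calc (a ^ 2 * ρ) ^ 4 = a ^ 8 * (ρ ^ 2) ^ 2 := by ring
        _ = _ := by rw [hρ2]; ring
    rw [e1, e2]
    have j0 : a ^ 8 * (J / J1) ^ 6 ≤ a ^ 2 * J ^ 6 := by
      calc a ^ 8 * (J / J1) ^ 6 ≤ a ^ 8 * (J / a) ^ 6 := by gcongr
        _ = _ := by field_simp
    have j1 : (a ^ 2 * M) ^ 3 ≤ (2 * (t * J ^ 3)) ^ 3 := by gcongr
    have j2 := hJ15.trans (show _ ≤ 2 ^ 15 * (a ^ 2 * M ^ 11 * a ^ 2) by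
      gcongr; exact min_le_right _ _)
    refine j0.trans ?_
    have hpos : 0 < J ^ 9 := by positivity
    refine le_of_mul_le_mul_right ?_ hpos
    calc a ^ 2 * J ^ 6 * J ^ 9 = a ^ 2 * J ^ 15 := by ring
      _ ≤ a ^ 2 * (2 ^ 15 * (a ^ 2 * M ^ 11 * a ^ 2)) := by gcongr
      _ = 2 ^ 15 * M ^ 8 * (a ^ 2 * M) ^ 3 := by ring
      _ ≤ 2 ^ 15 * M ^ 8 * (2 * (t * J ^ 3)) ^ 3 := by gcongr
      _ = 2 ^ 18 * (M ^ 8 * t ^ 3) * J ^ 9 := by ring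
      _ ≤ _ := by gcongr <;> norm_num
  have k3 : x ^ (1 / 2 : ℝ) ≤ (u ^ 2)⁻¹ + ρ := by
    calc x ^ (1 / 2 : ℝ) ≤ (t⁻¹ + (J / J1) ^ 3) ^ (1 / 2 : ℝ) := by gcongr
      _ ≤ t⁻¹ ^ (1 / 2 : ℝ) + ρ :=
          Real.rpow_add_le_add_rpow (by positivity) (by positivity) (by norm_num) (by norm_num)
      _ = _ := by
          congr 1
          rw [← hu4, Real.inv_rpow (by positivity), ← Real.rpow_natCast u 4,
            ← Real.rpow_mul hu0.le]
          norm_num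
  have k4 : a ^ 2 * (u ^ 2)⁻¹ ≤ 32 * (M ^ 2 * u ^ 3) := by
    rw [← div_eq_mul_inv, div_le_iff₀ (by positivity)]
    refine k1.trans_eq (by ring)
  have k5 : u ^ 3 ≤ (1 + t) ^ (3 / 4 : ℝ) := by
    calc u ^ 3 = t ^ (3 / 4 : ℝ) := by
          rw [hu, ← Real.rpow_natCast, ← Real.rpow_mul ht0.le]; norm_num
      _ ≤ _ := by gcongr; linarith
  calc a ^ 2 * ratioPower x ≤ a ^ 2 * (3 * ((u ^ 2)⁻¹ + ρ)) := by
        gcongr; exact hr.trans (by gcongr)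
    _ = 3 * (a ^ 2 * (u ^ 2)⁻¹ + a ^ 2 * ρ) := by ring
    _ ≤ 3 * (32 * (M ^ 2 * u ^ 3) + 32 * (M ^ 2 * u ^ 3)) := by gcongr
    _ = 192 * (M ^ 2 * u ^ 3) := by ring
    _ ≤ _ := by gcongr

/-- For a tiny output `J ≤ 2`, so the denominator is at least `S/8` and the quotient at most `16
S₁/S`. Being also at most 2, it is governed by its square root. -/
theorem ratioPower_weightRatio_le_of_tiny {c : ℝ} {z : Freq × Freq}
    (hz : z ∈ tinyOutputRegion c) :
    ratioPower (weightRatio c z) ≤ 12 * (bracket (modulation c z.1) ^ (1 / 2 : ℝ) *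
      bracket (modulation c (z.1 + z.2)) ^ (-(1 / 2) : ℝ)) := by
  obtain ⟨hd, h4, h1, h8⟩ := hz
  have hx0 := weightRatio_pos c z
  have hJ := bracket_pos (sumXi z)
  have hJ1 := one_le_bracket z.1.2.1
  have hJ1J : bracket (sumXi z) ≤ bracket z.1.2.1 :=
    bracket_le_bracket_of_abs_le (by linarith [abs_nonneg (sumXi z)])
  have hx2 : weightRatio c z ≤ 2 := by
    have h := weightRatio_le c hd
    have : (bracket (sumXi z) / bracket z.1.2.1) ^ 3 ≤ 1 := by
      apply pow_le_one₀ (by positivity)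
      rwa [div_le_one (by positivity)]
    linarith
  have hM1 : |sumXi z| ≤ 1 := by
    have := Real.one_le_rpow h1 (show (0 : ℝ) ≤ 1 / 8 by norm_num)
    nlinarith [abs_nonneg (sumXi z)]
  have hJ2 : bracket (sumXi z) ≤ 2 := (bracket_le_one_add _).trans (by linarith)
  have i1 := innerWeight_le (modulation c z.1) z.1.2.1
  have i2 := div_le_innerWeight (modulation c (z.1 + z.2)) (sumXi z)
  have hS1 := one_le_bracket (modulation c z.1)
  have hS0 := bracket_pos (modulation c (z.1 + z.2))
  have hx : weightRatio c z ≤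
      16 * (bracket (modulation c z.1) / bracket (modulation c (z.1 + z.2))) := by
    unfold weightRatio
    set S := bracket (modulation c (z.1 + z.2))
    set S1 := bracket (modulation c z.1)
    calc _ ≤ (2 * S1) / (S / 2 ^ 3) := by
          gcongr
          · have : S1 / bracket z.1.2.1 ^ 3 ≤ S1 := div_le_self (by linarith) (one_le_pow₀ hJ1)
            linarith
          · refine le_trans ?_ i2
            gcongr
      _ = _ := by field_simp; norm_num
  refine (ratioPower_le_of_le_two hx0.le hx2).trans ?_
  calc _ ≤ 3 * (16 * (bracket (modulation c z.1) /
        bracket (modulation c (z.1 + z.2)))) ^ (1 / 2 : ℝ) := by gcongr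
    _ = _ := by
        rw [Real.mul_rpow (by norm_num) (by positivity), Real.div_rpow (by positivity) hS0.le,
          Real.rpow_neg hS0.le, show (16 : ℝ) = 4 ^ (2 : ℝ) by norm_num,
          ← Real.rpow_mul (by norm_num)]
        norm_num
        ring

/-! ### The case of a dominant input -/

section
variable {G : ℝ → ℝ≥0∞}

/-- The region where the output has the largest modulation, with the weights arising when the
roles of the output and of the first factor are exchanged. -/
theorem uniformBound_input (hG : Measurable G) (hG1 : ∀ x, G x ≤ 1)
    (hG2 : ∀ x, G x * ENNReal.ofReal (bracket x ^ (1 / 2 : ℝ)) ≤ 1) (hI : ∫⁻ x, G x ≠ ∞) :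
    UniformBound fun c => regionKernel G c (dominantRegion c)
      fun z => z.1.2.1 ^ 2 * inputFactor c z := by
  set m : ℝ → Freq × Freq → ℝ := fun c z => z.1.2.1 ^ 2 * inputFactor c z with hm
  have hS : ∀ (c : ℝ) (z : Freq × Freq),
      0 < bracket (modulation c (z.1 + z.2)) ^ (-(49 / 50) : ℝ) := fun c z => by
    have := bracket_pos (modulation c (z.1 + z.2))
    positivity
  have h1 : UniformBound fun c => regionKernel G c
      (dominantRegion c ∩ {z | |z.1.2.1| ≤ 16 ∧ |z.2.2.1| ≤ 16}) (m c) := by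
    -- `35938 = 1 + 33³`, from `J ≤ 1 + 32`; the factor 256 bounds `ξ₁²`.
    refine (uniformBound_low hG hG1 hI).of_le (C := 256 * (2 * 35938)) (by norm_num)
      fun c z hz => ⟨hz.2, ?_⟩
    obtain ⟨hd, ha, hb⟩ := hz
    have h := (le_abs_sumXi z).2.2
    have hJ1 := one_le_bracket z.1.2.1
    have hJ0 := bracket_pos (sumXi z)
    have hJ : bracket (sumXi z) / bracket z.1.2.1 ≤ 33 := by
      refine (div_le_self hJ0.le hJ1).trans ((bracket_le_one_add _).trans ?_)
      linarith
    have hx : weightRatio c z ≤ 35938 := by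
      refine (weightRatio_le c hd).trans ?_
      have : (bracket (sumXi z) / bracket z.1.2.1) ^ 3 ≤ 33 ^ 3 := by gcongr
      norm_num at this
      linarith
    have hr := ratioPower_le_two_mul (weightRatio_pos c z).le hx (by norm_num)
    have hS1 : bracket (modulation c (z.1 + z.2)) ^ (-(49 / 50) : ℝ) ≤ 1 :=
      Real.rpow_le_one_of_one_le_of_nonpos (one_le_bracket _) (by norm_num)
    have h2 : z.1.2.1 ^ 2 ≤ 256 := by
      rw [← sq_abs]
      nlinarith [abs_nonneg z.1.2.1]
    simp only [hm, inputFactor]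
    rw [mul_one]
    calc _ ≤ 256 * (2 * 35938 * 1 : ℝ) := by
          have := ratioPower_nonneg (weightRatio_pos c z).le
          have := hS c z
          gcongr
      _ = _ := by ring
  have h2 : UniformBound fun c => regionKernel G c (dominantRegion c ∩
      {z | |sumXi z| ≤ 4 * |z.1.2.1| ∧ |z.1.2.1| ≤ 4 * |sumXi z|}) (m c) := by
    refine (uniformBound_output hG hG1 hI).of_le (C := 16 * 130) (by norm_num)
      fun c z hz => ⟨hz.1, ?_⟩
    obtain ⟨hd, ha, hb⟩ := hz
    have hJ1 := bracket_pos z.1.2.1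
    have hJ0 := bracket_pos (sumXi z)
    have hJ : bracket (sumXi z) / bracket z.1.2.1 ≤ 4 := by
      rw [div_le_iff₀ hJ1]
      exact bracket_le_mul_bracket (by norm_num) ha
    have hx : weightRatio c z ≤ 65 := by
      refine (weightRatio_le c hd).trans ?_
      have : (bracket (sumXi z) / bracket z.1.2.1) ^ 3 ≤ 4 ^ 3 := by gcongr
      norm_num at this
      linarith
    have hr := ratioPower_le_two_mul (weightRatio_pos c z).le hx (by norm_num)
    have h2 : z.1.2.1 ^ 2 ≤ 16 * sumXi z ^ 2 := by
      rw [← sq_abs, ← sq_abs (sumXi z)]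
      nlinarith [abs_nonneg z.1.2.1, abs_nonneg (sumXi z)]
    simp only [hm, inputFactor]
    calc _ ≤ (16 * sumXi z ^ 2) * (2 * 65 * outputFactor c z) := by
          have := ratioPower_nonneg (weightRatio_pos c z).le
          have := hS c z
          gcongr
          exact bracket_rpow_le_outputFactor c z
      _ = _ := by ring
  have h3 : UniformBound fun c => regionKernel G c (dominantRegion c ∩
      {z | |z.1.2.1| ≤ |sumXi z| / 4 ∧ 4 ≤ |sumXi z|}) (m c) := by
    refine (uniformBound_highLow hG hI).of_le (C := 4) (by norm_num)
      fun c z hz => ⟨hz, ?_⟩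
    obtain ⟨hd, ha, hb⟩ := hz
    have hJ1 := one_le_bracket z.1.2.1
    have hJ0 := bracket_pos (sumXi z)
    have hJ1J : bracket z.1.2.1 ≤ bracket (sumXi z) :=
      bracket_le_bracket_of_abs_le (by linarith [abs_nonneg (sumXi z)])
    have ha1 := abs_le_bracket z.1.2.1
    have hr1 := weightRatio_le c hd
    set J := bracket (sumXi z)
    set J1 := bracket z.1.2.1
    have hJ1p : 0 < J1 := by linarith
    have hy : 1 ≤ J / J1 := by rwa [one_le_div hJ1p]
    have hy3 : 1 ≤ (J / J1) ^ 3 := one_le_pow₀ hy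
    have hr : ratioPower (weightRatio c z) ≤ 4 * (J / J1) ^ (9 / 4 : ℝ) := by
      refine (ratioPower_le (weightRatio_pos c z).le (X := 2 * (J / J1) ^ 3) (by linarith)
        (by linarith)).trans ?_
      have h22 : (2 : ℝ) ^ (3 / 4 : ℝ) ≤ 2 := by
        calc (2 : ℝ) ^ (3 / 4 : ℝ) ≤ 2 ^ (1 : ℝ) :=
              Real.rpow_le_rpow_of_exponent_le (by norm_num) (by norm_num)
          _ = 2 := Real.rpow_one 2
      rw [Real.mul_rpow (by norm_num) (by positivity), ← Real.rpow_natCast,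
        ← Real.rpow_mul (by positivity)]
      norm_num
      have : 0 ≤ (J / J1) ^ (9 / 4 : ℝ) := by positivity
      nlinarith
    -- The quotient is at most `2(J/J₁)³`, whose power `3/4` is where the exponent `9/4` of the
    -- low-high estimate comes from; `ξ₁²` cancels the denominator.
    have h2 : z.1.2.1 ^ 2 * (J / J1) ^ (9 / 4 : ℝ) ≤ J ^ (9 / 4 : ℝ) := by
      calc _ ≤ J1 ^ (2 : ℝ) * (J / J1) ^ (9 / 4 : ℝ) := by
            rw [← sq_abs, Real.rpow_two]; gcongr
        _ ≤ J1 ^ (9 / 4 : ℝ) * (J / J1) ^ (9 / 4 : ℝ) := by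
            gcongr ?_ * _
            exact Real.rpow_le_rpow_of_exponent_le hJ1 (by norm_num)
        _ = _ := by
            rw [← Real.mul_rpow (by positivity) (by positivity), mul_div_cancel₀ _ hJ1p.ne']
    simp only [hm, inputFactor]
    calc _ ≤ z.1.2.1 ^ 2 * (4 * (J / J1) ^ (9 / 4 : ℝ) * outputFactor c z) := by
          have := ratioPower_nonneg (weightRatio_pos c z).le
          have := hS c z
          gcongr
          exact bracket_rpow_le_outputFactor c z
      _ = 4 * (z.1.2.1 ^ 2 * (J / J1) ^ (9 / 4 : ℝ) * outputFactor c z) := by ring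
      _ ≤ _ := by
          have := outputFactor_nonneg c z
          gcongr
  have h4 : UniformBound fun c => regionKernel G c (dominantRegion c ∩
      {z | 4 * |sumXi z| ≤ |z.1.2.1| ∧ 1 ≤ |z.1.2.1| ∧
        1 ≤ |sumXi z| * |z.1.2.1| ^ (1 / 8 : ℝ)}) (m c) := by
    refine (uniformBound_output hG hG1 hI).of_le (C := 192) (by norm_num)
      fun c z hz => ⟨hz.1, ?_⟩
    have := ratioPower_weightRatio_le_of_large hz.1 hz.2.1 hz.2.2.1 hz.2.2.2
    have h' := mul_le_mul_of_nonneg_right this (hS c z).le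
    simp only [hm, inputFactor, outputFactor]
    linarith
  have h5 : UniformBound fun c => regionKernel G c (tinyOutputRegion c) (m c) := by
    refine (uniformBound_tinyOutput hG hG2 hI).of_le (C := 12) (by norm_num)
      fun c z hz => ⟨hz, ?_⟩
    have hS0 := bracket_pos (modulation c (z.1 + z.2))
    have := mul_le_mul_of_nonneg_left (mul_le_mul_of_nonneg_right
      (ratioPower_weightRatio_le_of_tiny hz) (hS c z).le) (sq_nonneg z.1.2.1)
    refine this.trans_eq ?_
    have e : bracket (modulation c (z.1 + z.2)) ^ (-(37 / 25) : ℝ) =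
        bracket (modulation c (z.1 + z.2)) ^ (-(1 / 2) : ℝ) *
          bracket (modulation c (z.1 + z.2)) ^ (-(49 / 50) : ℝ) := by
      rw [← Real.rpow_add hS0]; norm_num
    rw [e]; ring
  refine h1.of_union (h2.of_union (h3.of_union (h4.of_union h5
    (R := fun c => _ ∪ tinyOutputRegion c) fun c z hz => hz)
    (R := fun c => _ ∪ (_ ∪ tinyOutputRegion c)) fun c z hz => hz)
    (R := fun c => _ ∪ (_ ∪ (_ ∪ tinyOutputRegion c))) fun c z hz => hz) fun c z hz => ?_
  obtain ⟨i1, i2, i3⟩ := le_abs_sumXi z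
  by_cases hlow : |z.1.2.1| ≤ 16 ∧ |z.2.2.1| ≤ 16
  · exact Or.inl ⟨hz, hlow⟩
  have hmax : 16 < |z.1.2.1| ∨ 16 < |z.2.2.1| := by
    by_contra! h; exact hlow h
  right
  by_cases ha : |z.1.2.1| ≤ |sumXi z| / 4
  · refine Or.inr (Or.inl ⟨hz, ha, ?_⟩)
    rcases hmax with h | h <;> linarith
  push Not at ha
  by_cases hb : |z.1.2.1| ≤ 4 * |sumXi z|
  · exact Or.inl ⟨hz, by linarith, hb⟩
  push Not at hb
  have h1a : 1 ≤ |z.1.2.1| := by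
    rcases hmax with h | h <;> linarith
  refine Or.inr (Or.inr ?_)
  rcases le_total 1 (|sumXi z| * |z.1.2.1| ^ (1 / 8 : ℝ)) with h | h
  · exact Or.inl ⟨hz, hb.le, h1a, h⟩
  · exact Or.inr ⟨hz, hb.le, h1a, h⟩

end

/-! ### The kernel of the bilinear estimate -/

theorem TrilinearBound.mono_ae {κ₁ κ₂ : Freq × Freq → ℝ≥0∞} {B : ℝ≥0∞} (h : TrilinearBound κ₂ B)
    (hle : ∀ᵐ z, κ₁ z ≤ κ₂ z) : TrilinearBound κ₁ B := by
  intro f g k hf hg hk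
  refine le_trans (lintegral_mono_ae ?_) (h f g k hf hg hk)
  filter_upwards [hle] with z hz
  gcongr

theorem ae_freq_ne_zero : ∀ᵐ p : Freq, p.2.1 ≠ 0 := by
  have h0 : ∀ᵐ x : ℝ, x ≠ 0 := by simp [ae_iff]
  have h1 : ∀ᵐ p : ℝ × ℝ, p.1 ≠ 0 :=
    (Measure.quasiMeasurePreserving_fst (μ := (volume : Measure ℝ))
      (ν := (volume : Measure ℝ))).ae h0
  exact (Measure.quasiMeasurePreserving_snd (μ := (volume : Measure ℝ))
    (ν := (volume : Measure (ℝ × ℝ)))).ae h1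

theorem modulation_neg (c : ℝ) (p : Freq) : modulation c (-p) = -modulation c p := by
  unfold modulation kpModulation
  simp only [Prod.fst_neg, Prod.snd_neg, neg_sq, div_neg]
  ring

theorem bracket_neg (x : ℝ) : bracket (-x) = bracket x := by
  unfold bracket; rw [norm_neg]

/-- The modulation part of the weight of the Bourgain space. -/
noncomputable def modulationWeight (c b b₁ : ℝ) (p : Freq) : ℝ :=
  innerWeight (modulation c p) p.2.1 ^ (2 * b₁) * bracket (modulation c p) ^ (2 * b)

theorem modulationWeight_pos (c b b₁ : ℝ) (p : Freq) : 0 < modulationWeight c b b₁ p := by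
  have := innerWeight_pos (modulation c p) p.2.1
  have := bracket_pos (modulation c p)
  unfold modulationWeight
  positivity

@[fun_prop]
theorem measurable_modulationWeight (c b b₁ : ℝ) : Measurable (modulationWeight c b b₁) := by
  unfold modulationWeight innerWeight
  fun_prop

theorem modulationWeight_neg (c b b₁ : ℝ) (p : Freq) :
    modulationWeight c b b₁ (-p) = modulationWeight c b b₁ p := by
  unfold modulationWeight innerWeight
  simp only [modulation_neg, bracket_neg, Prod.fst_neg, Prod.snd_neg]

/-- The squared kernel of the bilinear estimate. -/
noncomputable def bilinearKernel (b₁ ε c : ℝ) (z : Freq × Freq) : ℝ≥0∞ :=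
  ENNReal.ofReal (sumXi z ^ 2 * modulationWeight c (-1 / 2 + 2 * ε) b₁ (z.1 + z.2) /
    (modulationWeight c (1 / 2 + ε) b₁ z.1 * modulationWeight c (1 / 2 + ε) b₁ z.2))

theorem bilinearKernel_swap (b₁ ε c : ℝ) (z : Freq × Freq) :
    bilinearKernel b₁ ε c z.swap = bilinearKernel b₁ ε c z := by
  unfold bilinearKernel
  simp only [sumXi_swap, Prod.fst_swap, Prod.snd_swap, add_comm z.2 z.1]
  rw [mul_comm (modulationWeight _ _ _ z.2)]

/-- The modulation factor `⟨σ⟩^{-1-2ε}`. -/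
noncomputable def modulationDecay (ε x : ℝ) : ℝ≥0∞ := ENNReal.ofReal (bracket x ^ (-(1 + 2 * ε)))

section decay
variable {ε : ℝ}

theorem measurable_modulationDecay : Measurable (modulationDecay ε) := by
  unfold modulationDecay; fun_prop

theorem modulationDecay_mul_le_one (hε : 0 < ε) (x : ℝ) :
    modulationDecay ε x * ENNReal.ofReal (bracket x ^ (1 / 2 : ℝ)) ≤ 1 := by
  have h := bracket_pos x
  unfold modulationDecay
  rw [← ENNReal.ofReal_mul (by positivity), ← Real.rpow_add h]
  exact ENNReal.ofReal_le_one.2 (Real.rpow_le_one_of_one_le_of_nonpos (one_le_bracket x)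
    (by linarith))

theorem modulationDecay_le_one (hε : 0 < ε) (x : ℝ) : modulationDecay ε x ≤ 1 :=
  ENNReal.ofReal_le_one.2 (Real.rpow_le_one_of_one_le_of_nonpos (one_le_bracket x) (by linarith))

theorem lintegral_modulationDecay_ne_top (hε : 0 < ε) : ∫⁻ x, modulationDecay ε x ≠ ∞ := by
  have h := integrable_rpow_neg_one_add_norm_sq (E := ℝ) (μ := volume) (r := 1 + 2 * ε)
    (by simp; linarith)
  refine ne_top_of_le_ne_top h.2.ne (lintegral_mono fun x => ?_)
  rw [← ofReal_norm]
  apply ENNReal.ofReal_le_ofReal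
  refine le_trans (le_of_eq ?_) (le_abs_self _)
  unfold bracket
  rw [Real.sqrt_eq_rpow, ← Real.rpow_mul (by positivity)]
  congr 1; ring

end decay

theorem bracket_rpow_le_of_small {ε : ℝ} (hε : ε < 1 / 200) (x : ℝ) :
    bracket x ^ (-1 + 4 * ε) ≤ bracket x ^ (-(49 / 50) : ℝ) :=
  Real.rpow_le_rpow_of_exponent_le (one_le_bracket x) (by linarith)

section
variable {b₁ ε : ℝ}

theorem modulationWeight_inv (c : ℝ) (p : Freq) :
    (modulationWeight c (1 / 2 + ε) b₁ p)⁻¹ =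
      (innerWeight (modulation c p) p.2.1 ^ (2 * b₁))⁻¹ *
        bracket (modulation c p) ^ (-(1 + 2 * ε)) := by
  unfold modulationWeight
  rw [mul_inv, ← Real.rpow_neg (bracket_pos _).le]
  congr 2; ring

theorem modulationWeight_inv_le (hb : 0 ≤ b₁) (c : ℝ) (p : Freq) :
    (modulationWeight c (1 / 2 + ε) b₁ p)⁻¹ ≤ bracket (modulation c p) ^ (-(1 + 2 * ε)) := by
  rw [modulationWeight_inv]
  have := bracket_pos (modulation c p)
  apply mul_le_of_le_one_left (by positivity)
  exact inv_le_one_of_one_le₀ (Real.one_le_rpow (one_le_innerWeight _ _) (by linarith))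

theorem regionKernel_modulationDecay {c : ℝ} {R : Set (Freq × Freq)} {m : Freq × Freq → ℝ}
    {z : Freq × Freq} (hz : z ∈ R) (hm : 0 ≤ m z) :
    regionKernel (modulationDecay ε) c R m z = ENNReal.ofReal (m z *
      (bracket (modulation c z.1) ^ (-(1 + 2 * ε)) *
        bracket (modulation c z.2) ^ (-(1 + 2 * ε)))) := by
  have h1 := bracket_pos (modulation c z.1)
  have h2 := bracket_pos (modulation c z.2)
  unfold regionKernel modulationProduct modulationDecay
  rw [Set.indicator_of_mem hz, ENNReal.ofReal_mul hm, ENNReal.ofReal_mul (by positivity)]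

/-- The inner weights of the inputs are dropped, being at least 1. For the output, `2b₁ ≤ 3/4` and
`-1 + 4ε ≤ -49/50`, which is where `ε < 1/200` enters. -/
theorem bilinearKernel_le_output (h1 : 0 ≤ b₁) (h2 : b₁ ≤ 3 / 8)
    (hε : ε < 1 / 200) {c : ℝ} {z : Freq × Freq} (hz : z ∈ dominantRegion c) :
    bilinearKernel b₁ ε c z ≤ regionKernel (modulationDecay ε) c (dominantRegion c)
      (fun z => sumXi z ^ 2 * outputFactor c z) z := by
  have hO := outputFactor_nonneg c z
  rw [regionKernel_modulationDecay hz (by positivity)]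
  unfold bilinearKernel
  apply ENNReal.ofReal_le_ofReal
  have i1 := modulationWeight_inv_le (ε := ε) h1 c z.1
  have i2 := modulationWeight_inv_le (ε := ε) h1 c z.2
  have p1 := modulationWeight_pos c (1 / 2 + ε) b₁ z.1
  have p2 := modulationWeight_pos c (1 / 2 + ε) b₁ z.2
  have q1 := bracket_pos (modulation c z.1)
  have q3 := bracket_pos (modulation c (z.1 + z.2))
  rw [div_eq_mul_inv, mul_inv]
  gcongr
  unfold modulationWeight outputFactor
  have h3 := one_le_innerWeight (modulation c (z.1 + z.2)) (z.1 + z.2).2.1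
  have k1 : innerWeight (modulation c (z.1 + z.2)) (z.1 + z.2).2.1 ^ (2 * b₁) ≤
      (1 + bracket (modulation c (z.1 + z.2)) / bracket (sumXi z) ^ 3) ^ (3 / 4 : ℝ) := by
    calc _ ≤ innerWeight (modulation c (z.1 + z.2)) (z.1 + z.2).2.1 ^ (3 / 4 : ℝ) :=
          Real.rpow_le_rpow_of_exponent_le h3 (by linarith)
      _ ≤ _ := by
          gcongr
          exact innerWeight_le _ _
  have k2 : bracket (modulation c (z.1 + z.2)) ^ (2 * (-1 / 2 + 2 * ε)) ≤
      bracket (modulation c (z.1 + z.2)) ^ (-(49 / 50) : ℝ) :=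
    Real.rpow_le_rpow_of_exponent_le (one_le_bracket _) (by linarith)
  exact mul_le_mul k1 k2 (by positivity) ((by positivity : (0 : ℝ) ≤ _).trans k1)

theorem bilinearKernel_shear_le_input (h1 : 1 / 4 ≤ b₁) (h2 : b₁ ≤ 3 / 8)
    (hε0 : 0 < ε) (hε : ε < 1 / 200) {c : ℝ} {z : Freq × Freq} (hz : z ∈ dominantRegion c) :
    bilinearKernel b₁ ε c (z.1 + z.2, -z.2) ≤
      regionKernel (modulationDecay ε) c (dominantRegion c)
        (fun z => z.1.2.1 ^ 2 * inputFactor c z) z := by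
  have hr := ratioPower_nonneg (weightRatio_pos c z).le
  have q3 := bracket_pos (modulation c (z.1 + z.2))
  have q1 := bracket_pos (modulation c z.1)
  have q2 := bracket_pos (modulation c z.2)
  have hI : 0 ≤ inputFactor c z := by unfold inputFactor; positivity
  rw [regionKernel_modulationDecay hz (by positivity)]
  unfold bilinearKernel
  apply ENNReal.ofReal_le_ofReal
  have e1 : sumXi (z.1 + z.2, -z.2) = z.1.2.1 := by simp [sumXi]
  have e2 : (z.1 + z.2, -z.2).1 + (z.1 + z.2, -z.2).2 = z.1 := by simp
  rw [e1, e2, modulationWeight_neg]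
  have i2 := modulationWeight_inv_le (b₁ := b₁) (ε := ε) (by linarith) c z.2
  have p2 := modulationWeight_pos c (1 / 2 + ε) b₁ z.2
  have w1 := innerWeight_pos (modulation c z.1) z.1.2.1
  have w3 := innerWeight_pos (modulation c (z.1 + z.2)) (sumXi z)
  have hS : bracket (modulation c z.1) ≤ bracket (modulation c (z.1 + z.2)) :=
    bracket_le_bracket_of_abs_le hz.2.2.2.1
  have hx := rpow_le_ratioPower (weightRatio_pos c z) (e := 2 * b₁) (by linarith) (by linarith)
  have hX : weightRatio c z ^ (2 * b₁) = innerWeight (modulation c z.1) z.1.2.1 ^ (2 * b₁) *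
      (innerWeight (modulation c (z.1 + z.2)) (sumXi z) ^ (2 * b₁))⁻¹ := by
    unfold weightRatio
    rw [Real.div_rpow w1.le w3.le, div_eq_mul_inv]
  rw [div_eq_mul_inv, mul_inv, modulationWeight_inv]
  have e3 : (z.1 + z.2).2.1 = sumXi z := rfl
  simp only [e3]
  unfold modulationWeight
  set S := bracket (modulation c (z.1 + z.2))
  set S1 := bracket (modulation c z.1)
  -- The shear leaves `⟨σ₁⟩` with the output exponent and `⟨σ⟩` with the input one. As `⟨σ₁⟩ ≤ ⟨σ⟩`,
  -- a factor `⟨σ₁⟩^{6ε}` may be moved to `⟨σ⟩`, which restores the integrable decay in `σ₁`.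
  have k1 : S1 ^ (2 * (-1 / 2 + 2 * ε)) * S ^ (-(1 + 2 * ε)) ≤
      S ^ (-(49 / 50) : ℝ) * S1 ^ (-(1 + 2 * ε)) := by
    calc _ = S1 ^ (-(1 + 2 * ε)) * S1 ^ (6 * ε) * S ^ (-(1 + 2 * ε)) := by
          rw [← Real.rpow_add q1]; congr 2; ring
      _ ≤ S1 ^ (-(1 + 2 * ε)) * S ^ (6 * ε) * S ^ (-(1 + 2 * ε)) := by gcongr
      _ = S ^ (-1 + 4 * ε) * S1 ^ (-(1 + 2 * ε)) := by
          rw [mul_assoc, ← Real.rpow_add q3, mul_comm]; congr 2; ring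
      _ ≤ _ := mul_le_mul_of_nonneg_right (bracket_rpow_le_of_small hε _) (by positivity)
  unfold inputFactor
  calc _ = z.1.2.1 ^ 2 * (weightRatio c z ^ (2 * b₁) *
        (S1 ^ (2 * (-1 / 2 + 2 * ε)) * S ^ (-(1 + 2 * ε)))) *
        (modulationWeight c (1 / 2 + ε) b₁ z.2)⁻¹ := by
        rw [hX]; unfold modulationWeight; ring
    _ ≤ z.1.2.1 ^ 2 * (ratioPower (weightRatio c z) *
        (S ^ (-(49 / 50) : ℝ) * S1 ^ (-(1 + 2 * ε)))) *
        bracket (modulation c z.2) ^ (-(1 + 2 * ε)) := by gcongr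
    _ = _ := by ring

/-- One of the three modulations is the largest. The output is covered directly, the first input by
the shear, and the second by the symmetry of the kernel under swapping. -/
theorem exists_trilinearBound_bilinearKernel (h1 : 1 / 4 < b₁) (h2 : b₁ < 3 / 8)
    (hε0 : 0 < ε) (hε : ε < 1 / 200) :
    ∃ B : ℝ≥0∞, B ≠ ∞ ∧ ∀ c, TrilinearBound (bilinearKernel b₁ ε c) B := by
  have hG := measurable_modulationDecay (ε := ε)
  have hA := uniformBound_output hG (modulationDecay_le_one hε0)
    (lintegral_modulationDecay_ne_top hε0)
  have hB := uniformBound_input hG (modulationDecay_le_one hε0)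
    (modulationDecay_mul_le_one hε0) (lintegral_modulationDecay_ne_top hε0)
  set Ω : Set (Freq × Freq) := {z | z.1.2.1 ≠ 0 ∧ z.2.2.1 ≠ 0 ∧ sumXi z ≠ 0} with hΩ
  set RB : ℝ → Set (Freq × Freq) := fun c => Ω ∩
    {z | |modulation c z.2| ≤ |modulation c z.1| ∧
      |modulation c (z.1 + z.2)| ≤ |modulation c z.1|} with hRB
  have hB' : UniformBound fun c => (RB c).indicator (bilinearKernel b₁ ε c) := by
    apply UniformBound.of_shear
    refine hB.mono fun c z => ?_
    by_cases hz : (z.1 + z.2, -z.2) ∈ RB c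
    · rw [Set.indicator_of_mem hz]
      apply bilinearKernel_shear_le_input h1.le h2.le hε0 hε
      obtain ⟨⟨j1, j2, j3⟩, j4, j5⟩ := hz
      simp only [sumXi, Prod.snd_add, Prod.fst_add, Prod.snd_neg, Prod.fst_neg, ne_eq, neg_eq_zero,
        add_neg_cancel_right, modulation_neg, abs_neg] at j1 j2 j3 j4 j5
      exact ⟨j3, j2, j1, j5, j4⟩
    · rw [Set.indicator_of_notMem hz]; exact zero_le
  obtain ⟨B, hBt, hbd⟩ := ((hA.add hB').add hB'.swap).exists_bound
  refine ⟨B, hBt, fun c => (hbd c).mono_ae ?_⟩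
  have n1 : ∀ᵐ z : Freq × Freq, z.1.2.1 ≠ 0 :=
    (Measure.quasiMeasurePreserving_fst (μ := (volume : Measure Freq))
      (ν := (volume : Measure Freq))).ae ae_freq_ne_zero
  have n2 : ∀ᵐ z : Freq × Freq, z.2.2.1 ≠ 0 :=
    (Measure.quasiMeasurePreserving_snd (μ := (volume : Measure Freq))
      (ν := (volume : Measure Freq))).ae ae_freq_ne_zero
  filter_upwards [n1, n2] with z hz1 hz2
  -- The set `ξ₁ + ξ₂ = 0` needs no measure argument: the factor `ξ²` of the derivative makes the
  -- kernel vanish there.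
  by_cases hz3 : sumXi z = 0
  · simp [bilinearKernel, hz3]
  have hz : z ∈ Ω := ⟨hz1, hz2, hz3⟩
  by_cases hD : |modulation c z.1| ≤ |modulation c (z.1 + z.2)| ∧
      |modulation c z.2| ≤ |modulation c (z.1 + z.2)|
  · refine (bilinearKernel_le_output (by linarith) h2.le hε ?_).trans
      (le_self_add.trans le_self_add)
    exact ⟨hz1, hz2, hz3, hD.1, hD.2⟩
  have hS : z.swap ∈ Ω := ⟨hz2, hz1, by rwa [sumXi_swap]⟩
  rcases le_total |modulation c z.2| |modulation c z.1| with h | h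
  · have hmem : z ∈ RB c := ⟨hz, h, by
      by_contra! hc
      exact hD ⟨hc.le, h.trans hc.le⟩⟩
    rw [Set.indicator_of_mem hmem]
    exact le_add_self.trans le_self_add
  · have hmem : z.swap ∈ RB c := ⟨hS, h, by
      simp only [Prod.fst_swap, Prod.snd_swap, add_comm z.2 z.1]
      by_contra! hc
      exact hD ⟨h.trans hc.le, hc.le⟩⟩
    rw [Set.indicator_of_mem hmem, bilinearKernel_swap]
    exact le_add_self

end

/-! ### Duality and the weighted convolution estimate -/

/-- The converse of the Cauchy-Schwarz inequality. -/
theorem lintegral_sq_le_of_forall_lintegral_mul_le {A : Freq → ℝ≥0∞} (hA : Measurable A)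
    {B : ℝ≥0∞} (h : ∀ k : Freq → ℝ≥0∞, Measurable k →
      ∫⁻ p, A p * k p ≤ B * (∫⁻ p, k p ^ 2) ^ (1 / 2 : ℝ)) :
    ∫⁻ p, A p ^ 2 ≤ B ^ 2 := by
  -- Truncation in height and in space makes the test function square integrable, so its norm can be
  -- cancelled; Fatou then removes the truncation.
  set k : ℕ → Freq → ℝ≥0∞ := fun n =>
    (Metric.ball 0 n).indicator fun p => min (A p) n with hk
  have hkm : ∀ n, Measurable (k n) := fun n =>
    (hA.min measurable_const).indicator measurableSet_ball
  have hkA : ∀ n p, k n p ≤ A p := by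
    intro n p
    by_cases hp : p ∈ Metric.ball (0 : Freq) n
    · simp [hk, hp]
    · simp [hk, hp]
  have hfin : ∀ n, ∫⁻ p, k n p ^ 2 ≠ ∞ := by
    intro n
    have h1 : ∀ p, k n p ^ 2 ≤
        (Metric.ball (0 : Freq) n).indicator (fun _ => (n : ℝ≥0∞) ^ 2) p := by
      intro p
      by_cases hp : p ∈ Metric.ball (0 : Freq) n
      · rw [Set.indicator_of_mem hp, hk]
        simp only [Set.indicator_of_mem hp]
        gcongr
        exact min_le_right _ _
      · simp [hk, hp]
    refine ne_top_of_le_ne_top ?_ (lintegral_mono h1)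
    rw [lintegral_indicator measurableSet_ball, setLIntegral_const]
    exact ENNReal.mul_ne_top (by finiteness) measure_ball_lt_top.ne
  have hbd : ∀ n, ∫⁻ p, k n p ^ 2 ≤ B ^ 2 := by
    intro n
    set X := ∫⁻ p, k n p ^ 2 with hX
    have h1 : X ≤ B * X ^ (1 / 2 : ℝ) := by
      refine le_trans (lintegral_mono fun p => ?_) (h (k n) (hkm n))
      rw [sq]
      gcongr
      exact hkA n p
    by_cases h0 : X = 0
    · rw [h0]; exact zero_le
    have e : X = X ^ (1 / 2 : ℝ) * X ^ (1 / 2 : ℝ) := by rw [← sq, ENNReal.rpow_half_sq]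
    have hpos : X ^ (1 / 2 : ℝ) ≠ 0 := by simp [h0]
    have hnt : X ^ (1 / 2 : ℝ) ≠ ∞ := ENNReal.rpow_ne_top_of_nonneg (by norm_num) (hfin n)
    have h2 : X ^ (1 / 2 : ℝ) ≤ B := by
      have h3 : X ^ (1 / 2 : ℝ) * X ^ (1 / 2 : ℝ) ≤ B * X ^ (1 / 2 : ℝ) := by rwa [← e]
      exact (ENNReal.mul_le_mul_iff_left hpos hnt).1 h3
    calc X = (X ^ (1 / 2 : ℝ)) ^ 2 := (ENNReal.rpow_half_sq X).symm
      _ ≤ B ^ 2 := by gcongr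
  have hlim : ∀ p, Filter.liminf (fun n => k n p ^ 2) Filter.atTop = A p ^ 2 := by
    intro p
    apply Filter.Tendsto.liminf_eq
    apply ENNReal.Tendsto.pow
    have h1 : Filter.Tendsto (fun n : ℕ => min (A p) (n : ℝ≥0∞)) Filter.atTop (nhds (A p)) := by
      have := (tendsto_const_nhds (x := A p)).min ENNReal.tendsto_nat_nhds_top
      simpa using this
    refine h1.congr' ?_
    obtain ⟨N, hN⟩ := exists_nat_gt ‖p‖
    filter_upwards [Filter.eventually_ge_atTop N] with n hn
    have hp : p ∈ Metric.ball (0 : Freq) n := by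
      rw [mem_ball_zero_iff]
      exact hN.trans_le (by exact_mod_cast hn)
    simp only [hk, Set.indicator_of_mem hp]
  calc ∫⁻ p, A p ^ 2 = ∫⁻ p, Filter.liminf (fun n => k n p ^ 2) Filter.atTop := by
        simp_rw [hlim]
    _ ≤ Filter.liminf (fun n => ∫⁻ p, k n p ^ 2) Filter.atTop :=
        lintegral_liminf_le fun n => (hkm n).pow_const 2
    _ ≤ B ^ 2 := by
        refine Filter.liminf_le_of_frequently_le' (Filter.Frequently.of_forall hbd)

/-- The weight of the Bourgain space on the frequency space. -/
noncomputable def freqWeight (c b b₁ s : ℝ) (p : Freq) : ℝ :=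
  bourgainWeight c b b₁ s p.1 p.2.1 p.2.2

theorem freqWeight_eq (c b b₁ s : ℝ) (p : Freq) : freqWeight c b b₁ s p =
    modulationWeight c b b₁ p *
      bracket (!₂[p.2.1, p.2.2] : EuclideanSpace ℝ (Fin 2)) ^ (2 * s) := by
  unfold freqWeight bourgainWeight modulationWeight innerWeight modulation
  ring

theorem freqWeight_pos (c b b₁ s : ℝ) (p : Freq) : 0 < freqWeight c b b₁ s p := by
  rw [freqWeight_eq]
  have := modulationWeight_pos c b b₁ p
  have := bracket_pos (!₂[p.2.1, p.2.2] : EuclideanSpace ℝ (Fin 2))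
  positivity

@[fun_prop]
theorem measurable_freqWeight (c b b₁ s : ℝ) : Measurable (freqWeight c b b₁ s) := by
  have h : Measurable fun p : Freq => bracket (!₂[p.2.1, p.2.2] : EuclideanSpace ℝ (Fin 2)) := by
    have : (fun p : Freq => bracket (!₂[p.2.1, p.2.2] : EuclideanSpace ℝ (Fin 2))) =
        fun p => Real.sqrt (1 + (p.2.1 ^ 2 + p.2.2 ^ 2)) := by
      ext p
      unfold bracket
      rw [EuclideanSpace.norm_sq_eq]
      simp [Fin.sum_univ_two]
    rw [this]
    fun_prop
  have := funext (freqWeight_eq c b b₁ s)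
  rw [this]
  fun_prop

theorem bracket_add_le {E : Type*} [SeminormedAddCommGroup E] (x y : E) :
    bracket (x + y) ≤ 2 * (bracket x * bracket y) := by
  unfold bracket
  rw [← Real.sqrt_mul (by positivity), Real.sqrt_le_left (by positivity), mul_pow,
    Real.sq_sqrt (by positivity)]
  have h := pow_le_pow_left₀ (norm_nonneg _) (norm_add_le x y) 2
  nlinarith [sq_nonneg (‖x‖ - ‖y‖), sq_nonneg ‖x‖, sq_nonneg ‖y‖,
    mul_nonneg (sq_nonneg ‖x‖) (sq_nonneg ‖y‖)]

theorem bracket_frequency_rpow_le {s : ℝ} (hs : 0 ≤ s) (p q : Freq) :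
    bracket (!₂[(p + q).2.1, (p + q).2.2] : EuclideanSpace ℝ (Fin 2)) ^ (2 * s) ≤
      2 ^ (2 * s) * (bracket (!₂[p.2.1, p.2.2] : EuclideanSpace ℝ (Fin 2)) ^ (2 * s) *
        bracket (!₂[q.2.1, q.2.2] : EuclideanSpace ℝ (Fin 2)) ^ (2 * s)) := by
  have e : (!₂[(p + q).2.1, (p + q).2.2] : EuclideanSpace ℝ (Fin 2)) =
      !₂[p.2.1, p.2.2] + !₂[q.2.1, q.2.2] := by
    ext i; fin_cases i <;> simp
  rw [e]
  have h1 := bracket_pos (!₂[p.2.1, p.2.2] : EuclideanSpace ℝ (Fin 2))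
  have h2 := bracket_pos (!₂[q.2.1, q.2.2] : EuclideanSpace ℝ (Fin 2))
  rw [← Real.mul_rpow h1.le h2.le, ← Real.mul_rpow (by norm_num) (by positivity)]
  exact Real.rpow_le_rpow (bracket_pos _).le (bracket_add_le _ _) (by positivity)

/-- The isotropic weight at the sum is at most a constant times the product of the weights at the
inputs, because `s ≥ 0`; the modulation weights form the kernel. -/
theorem outputWeight_le {b₁ s ε : ℝ} (hs : 0 ≤ s) (c : ℝ) (z : Freq × Freq) :
    ENNReal.ofReal (sumXi z ^ 2 * freqWeight c (-1 / 2 + 2 * ε) b₁ s (z.1 + z.2)) ≤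
      ENNReal.ofReal (2 ^ (2 * s)) * bilinearKernel b₁ ε c z *
        (ENNReal.ofReal (freqWeight c (1 / 2 + ε) b₁ s z.1) *
          ENNReal.ofReal (freqWeight c (1 / 2 + ε) b₁ s z.2)) := by
  have p1 := modulationWeight_pos c (1 / 2 + ε) b₁ z.1
  have p2 := modulationWeight_pos c (1 / 2 + ε) b₁ z.2
  have p3 := modulationWeight_pos c (-1 / 2 + 2 * ε) b₁ (z.1 + z.2)
  have f1 := freqWeight_pos c (1 / 2 + ε) b₁ s z.1
  have h := bracket_frequency_rpow_le hs z.1 z.2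
  unfold bilinearKernel
  rw [← ENNReal.ofReal_mul (by positivity), ← ENNReal.ofReal_mul f1.le,
    ← ENNReal.ofReal_mul (by positivity)]
  apply ENNReal.ofReal_le_ofReal
  simp only [freqWeight_eq]
  calc _ ≤ sumXi z ^ 2 * (modulationWeight c (-1 / 2 + 2 * ε) b₁ (z.1 + z.2) *
        (2 ^ (2 * s) * (bracket (!₂[z.1.2.1, z.1.2.2] : EuclideanSpace ℝ (Fin 2)) ^ (2 * s) *
        bracket (!₂[z.2.2.1, z.2.2.2] : EuclideanSpace ℝ (Fin 2)) ^ (2 * s)))) := by gcongr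
    _ = _ := by
        generalize modulationWeight c (1 / 2 + ε) b₁ z.1 = m₁ at *
        generalize modulationWeight c (1 / 2 + ε) b₁ z.2 = m₂ at *
        field_simp

section
variable {b₁ s ε : ℝ}

/-- The bilinear estimate on the frequency space. -/
theorem exists_freq_convolution_bound (h1 : 1 / 4 < b₁) (h2 : b₁ < 3 / 8) (hs : 0 ≤ s)
    (hε0 : 0 < ε) (hε : ε < 1 / 200) :
    ∃ C : ℝ≥0∞, C ≠ ∞ ∧ ∀ (c : ℝ) (F H : Freq → ℝ≥0∞), Measurable F → Measurable H →
      ∫⁻ p, ENNReal.ofReal (p.2.1 ^ 2 * freqWeight c (-1 / 2 + 2 * ε) b₁ s p) *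
          (∫⁻ q, F q * H (p - q)) ^ 2 ≤
        C * ((∫⁻ p, ENNReal.ofReal (freqWeight c (1 / 2 + ε) b₁ s p) * F p ^ 2) *
          ∫⁻ p, ENNReal.ofReal (freqWeight c (1 / 2 + ε) b₁ s p) * H p ^ 2) := by
  obtain ⟨B, hB, hbd⟩ := exists_trilinearBound_bilinearKernel (b₁ := b₁) (ε := ε) h1 h2 hε0 hε
  set D : ℝ≥0∞ := ENNReal.ofReal (2 ^ (2 * s)) with hD
  refine ⟨(D ^ (1 / 2 : ℝ) * B) ^ 2, by finiteness, fun c F H hF hH => ?_⟩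
  set m : Freq → ℝ≥0∞ := fun p =>
    ENNReal.ofReal (p.2.1 ^ 2 * freqWeight c (-1 / 2 + 2 * ε) b₁ s p) with hm
  set w : Freq → ℝ≥0∞ := fun p => ENNReal.ofReal (freqWeight c (1 / 2 + ε) b₁ s p) with hw
  have hmm : Measurable m := by fun_prop
  have hwm : Measurable w := by fun_prop
  set E : Freq → ℝ≥0∞ := fun p => ∫⁻ q, F q * H (p - q) with hE
  have hEm : Measurable E :=
    Measurable.lintegral_prod_right' (f := fun z : Freq × Freq => F z.2 * H (z.1 - z.2))
      (by fun_prop)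
  set X := ∫⁻ p, w p * F p ^ 2 with hX
  set Y := ∫⁻ p, w p * H p ^ 2 with hY
  have hsq : ∀ p, m p * E p ^ 2 = (m p ^ (1 / 2 : ℝ) * E p) ^ 2 := by
    intro p; rw [mul_pow, ENNReal.rpow_half_sq]
  change ∫⁻ p, m p * E p ^ 2 ≤ (D ^ (1 / 2 : ℝ) * B) ^ 2 * (X * Y)
  simp_rw [hsq]
  have hgoal : (D ^ (1 / 2 : ℝ) * B) ^ 2 * (X * Y) =
      (D ^ (1 / 2 : ℝ) * B * (X ^ (1 / 2 : ℝ) * Y ^ (1 / 2 : ℝ))) ^ 2 := by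
    rw [mul_pow _ (X ^ (1 / 2 : ℝ) * Y ^ (1 / 2 : ℝ)), mul_pow (X ^ (1 / 2 : ℝ)),
      ENNReal.rpow_half_sq, ENNReal.rpow_half_sq]
  rw [hgoal]
  refine lintegral_sq_le_of_forall_lintegral_mul_le (by fun_prop) fun k hk => ?_
  have hpres : MeasurePreserving (fun z : Freq × Freq => (z.2, z.1 - z.2)) volume volume := by
    have := measurePreserving_sub_prod (volume : Measure Freq) (volume : Measure Freq)
    exact (Measure.measurePreserving_swap).comp this
  have key : ∫⁻ z : Freq × Freq, m (z.1 + z.2) ^ (1 / 2 : ℝ) *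
      (F z.1 * H z.2 * k (z.1 + z.2)) = ∫⁻ p, m p ^ (1 / 2 : ℝ) * E p * k p := by
    rw [← hpres.lintegral_comp (by fun_prop), Measure.volume_eq_prod,
      lintegral_prod _ (by fun_prop)]
    refine lintegral_congr fun p => ?_
    simp only [add_sub_cancel]
    have : ∀ q, m p ^ (1 / 2 : ℝ) * (F q * H (p - q) * k p) =
        (m p ^ (1 / 2 : ℝ) * k p) * (F q * H (p - q)) := fun q => by ring
    simp_rw [this]
    rw [lintegral_const_mul _ (by fun_prop)]
    ring
  rw [← key]
  have hmain := ((hbd c).const_mul D (by finiteness)) (fun p => w p ^ (1 / 2 : ℝ) * F p)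
    (fun p => w p ^ (1 / 2 : ℝ) * H p) k (by fun_prop) (by fun_prop) hk
  have e : ∀ K : Freq → ℝ≥0∞, ∫⁻ p, (w p ^ (1 / 2 : ℝ) * K p) ^ 2 = ∫⁻ p, w p * K p ^ 2 := by
    intro K
    refine lintegral_congr fun p => ?_
    rw [mul_pow, ENNReal.rpow_half_sq]
  rw [e, e] at hmain
  refine le_trans (lintegral_mono fun z => ?_) (hmain.trans_eq (by ring))
  have hpt := outputWeight_le (b₁ := b₁) (ε := ε) hs c z
  calc _ ≤ (D * bilinearKernel b₁ ε c z * (w z.1 * w z.2)) ^ (1 / 2 : ℝ) *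
        (F z.1 * H z.2 * k (z.1 + z.2)) := by
        exact mul_le_mul_left (ENNReal.rpow_le_rpow hpt (by norm_num)) _
    _ = _ := by
        rw [ENNReal.mul_rpow_half, ENNReal.mul_rpow_half (w z.1)]
        ring

/-- The angular frequency `2 π k`, in the coordinates `(τ, ξ, η)`. -/
noncomputable def angularFrequency : SpaceTime ≃ₗ[ℝ] Freq where
  toFun k := (2 * Real.pi * k 0, 2 * Real.pi * k 1, 2 * Real.pi * k 2)
  invFun p := !₂[p.1 / (2 * Real.pi), p.2.1 / (2 * Real.pi), p.2.2 / (2 * Real.pi)]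
  left_inv k := by
    have : (2 * Real.pi) ≠ 0 := by positivity
    ext i; fin_cases i <;> simp
  right_inv p := by
    have : (2 * Real.pi) ≠ 0 := by positivity
    simp only [Matrix.cons_val]
    ext <;> simp <;> field_simp
  map_add' k l := by ext <;> simp <;> ring
  map_smul' a k := by ext <;> simp <;> ring

/-- The image measure is a Haar measure, hence a multiple of Lebesgue measure. The value of the
multiple is irrelevant. -/
theorem exists_lintegral_comp_angularFrequency : ∃ a : ℝ≥0∞, a ≠ 0 ∧ a ≠ ∞ ∧
    ∀ Φ : Freq → ℝ≥0∞, ∫⁻ k, Φ (angularFrequency k) = a * ∫⁻ p, Φ p := by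
  set L := angularFrequency.toContinuousLinearEquiv with hL
  have hH : (Measure.map L (volume : Measure SpaceTime)).IsAddHaarMeasure :=
    L.isAddHaarMeasure_map volume
  refine ⟨((Measure.map L (volume : Measure SpaceTime)).addHaarScalarFactor volume : ℝ≥0),
    ?_, ENNReal.coe_ne_top, fun Φ => ?_⟩
  · exact ENNReal.coe_ne_zero.2 (Measure.addHaarScalarFactor_pos_of_isAddHaarMeasure _ _).ne'
  · have h1 := Measure.isAddLeftInvariant_eq_smul
      (Measure.map L (volume : Measure SpaceTime)) (volume : Measure Freq)
    have h2 := L.toHomeomorph.measurableEmbedding.lintegral_map (μ := volume) Φ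
    refine h2.symm.trans ?_
    change ∫⁻ p, Φ p ∂(Measure.map L (volume : Measure SpaceTime)) = _
    conv_lhs => rw [h1, lintegral_smul_measure]
    rfl

/-- The weight of the Bourgain space as a function of the frequency `k`. -/
noncomputable def spaceWeight (c b b₁ s : ℝ) (k : SpaceTime) : ℝ :=
  bourgainWeight c b b₁ s (2 * Real.pi * k 0) (2 * Real.pi * k 1) (2 * Real.pi * k 2)

theorem spaceWeight_eq (c b b₁ s : ℝ) (k : SpaceTime) :
    spaceWeight c b b₁ s k = freqWeight c b b₁ s (angularFrequency k) := rfl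

@[fun_prop]
theorem measurable_angularFrequency_symm : Measurable angularFrequency.symm :=
  angularFrequency.toContinuousLinearEquiv.symm.continuous.measurable

/-- The bilinear estimate for the Fourier transforms. -/
theorem exists_convolution_bound (h1 : 1 / 4 < b₁) (h2 : b₁ < 3 / 8) (hs : 0 ≤ s)
    (hε0 : 0 < ε) (hε : ε < 1 / 200) :
    ∃ C : ℝ≥0∞, C ≠ ∞ ∧ ∀ (c : ℝ) (F H : SpaceTime → ℝ≥0∞), Measurable F → Measurable H →
      ∫⁻ k, ENNReal.ofReal (spaceWeight c (-1 / 2 + 2 * ε) b₁ s k) *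
          (ENNReal.ofReal |2 * Real.pi * k 1| * ∫⁻ l, F l * H (k - l)) ^ 2 ≤
        C * ((∫⁻ k, ENNReal.ofReal (spaceWeight c (1 / 2 + ε) b₁ s k) * F k ^ 2) *
          ∫⁻ k, ENNReal.ofReal (spaceWeight c (1 / 2 + ε) b₁ s k) * H k ^ 2) := by
  obtain ⟨C, hC, hbd⟩ := exists_freq_convolution_bound h1 h2 hs hε0 hε
  obtain ⟨a, ha0, hat, hint⟩ := exists_lintegral_comp_angularFrequency
  -- The left side scales by `a · a²`, the square coming from the convolution, and the right side by
  -- `a²`.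
  refine ⟨a * C, by finiteness, fun c F H hF hH => ?_⟩
  set F' : Freq → ℝ≥0∞ := fun p => F (angularFrequency.symm p) with hF'
  set H' : Freq → ℝ≥0∞ := fun p => H (angularFrequency.symm p) with hH'
  have key := hbd c F' H' (by fun_prop) (by fun_prop)
  have e1 : ∀ k, ∫⁻ l, F l * H (k - l) = a * ∫⁻ q, F' q * H' (angularFrequency k - q) := by
    intro k
    rw [← hint]
    refine lintegral_congr fun l => ?_
    simp [hF', hH']
  have e2 : ∀ K : SpaceTime → ℝ≥0∞,
      ∫⁻ k, ENNReal.ofReal (spaceWeight c (1 / 2 + ε) b₁ s k) * K k ^ 2 =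
      a * ∫⁻ p, ENNReal.ofReal (freqWeight c (1 / 2 + ε) b₁ s p) *
        K (angularFrequency.symm p) ^ 2 := by
    intro K
    rw [← hint]
    refine lintegral_congr fun l => ?_
    simp [spaceWeight_eq]
  have e3 : ∀ k : SpaceTime, ENNReal.ofReal (spaceWeight c (-1 / 2 + 2 * ε) b₁ s k) *
      (ENNReal.ofReal |2 * Real.pi * k 1| * ∫⁻ l, F l * H (k - l)) ^ 2 =
      a ^ 2 * (fun p : Freq =>
        ENNReal.ofReal (p.2.1 ^ 2 * freqWeight c (-1 / 2 + 2 * ε) b₁ s p) *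
          (∫⁻ q, F' q * H' (p - q)) ^ 2) (angularFrequency k) := by
    intro k
    have e4 : (angularFrequency k).2.1 = 2 * Real.pi * k 1 := rfl
    simp only [e4]
    rw [e1, spaceWeight_eq, mul_pow, mul_pow, ENNReal.ofReal_mul (sq_nonneg _),
      ← ENNReal.ofReal_pow (abs_nonneg _), sq_abs]
    ring
  simp_rw [e3]
  rw [lintegral_const_mul' _ _ (by finiteness),
    hint fun p : Freq => ENNReal.ofReal (p.2.1 ^ 2 * freqWeight c (-1 / 2 + 2 * ε) b₁ s p) *
          (∫⁻ q, F' q * H' (p - q)) ^ 2, e2, e2]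
  refine (mul_le_mul_right (mul_le_mul_right key a) (a ^ 2)).trans_eq ?_
  simp only [hF', hH']
  ring

end

/-! ### Fourier transform of a product of square integrable functions -/

/-- Square integrable functions on the space-time. -/
abbrev L2 : Type := Lp ℂ 2 (volume : Measure SpaceTime)

theorem lintegral_enorm_sq_rpow_half (f : L2) :
    (∫⁻ x, ‖f x‖ₑ ^ 2) ^ (1 / 2 : ℝ) = ‖f‖ₑ := by
  rw [Lp.enorm_def, eLpNorm_eq_lintegral_rpow_enorm_toReal (by norm_num) (by norm_num)]
  simp

/-- The convolution of square integrable functions. -/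
noncomputable def convolutionL2 (f g : L2) (k : SpaceTime) : ℂ := ∫ l, f l * g (k - l)

theorem lintegral_enorm_mul_le (f g : L2) (k : SpaceTime) :
    ∫⁻ l, ‖f l‖ₑ * ‖g (k - l)‖ₑ ≤ ‖f‖ₑ * ‖g‖ₑ := by
  have hf := (Lp.stronglyMeasurable f).measurable
  have hg := (Lp.stronglyMeasurable g).measurable
  refine (lintegral_mul_le_sqrt (by fun_prop) (by fun_prop)).trans ?_
  rw [lintegral_sub_left_eq_self (fun l => ‖g l‖ₑ ^ 2), lintegral_enorm_sq_rpow_half,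
    lintegral_enorm_sq_rpow_half]

theorem enorm_convolutionL2_le_lintegral (f g : L2) (k : SpaceTime) :
    ‖convolutionL2 f g k‖ₑ ≤ ∫⁻ l, ‖f l‖ₑ * ‖g (k - l)‖ₑ := by
  refine (enorm_integral_le_lintegral_enorm _).trans_eq ?_
  simp_rw [enorm_mul]

theorem norm_convolutionL2_le (f g : L2) (k : SpaceTime) :
    ‖convolutionL2 f g k‖ ≤ ‖f‖ * ‖g‖ := by
  have h := (enorm_convolutionL2_le_lintegral f g k).trans (lintegral_enorm_mul_le f g k)
  rwa [← ofReal_norm, ← ofReal_norm, ← ofReal_norm, ← ENNReal.ofReal_mul (norm_nonneg _),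
    ENNReal.ofReal_le_ofReal_iff (by positivity)] at h

theorem stronglyMeasurable_convolutionL2 (f g : L2) : StronglyMeasurable (convolutionL2 f g) := by
  have hf := (Lp.stronglyMeasurable f).measurable
  have hg := (Lp.stronglyMeasurable g).measurable
  exact StronglyMeasurable.integral_prod_right'
    (f := fun z : SpaceTime × SpaceTime => f z.2 * g (z.1 - z.2))
    (Measurable.stronglyMeasurable (by fun_prop))

theorem integrable_mul_comp_sub (f g : L2) (k : SpaceTime) :
    Integrable fun l => f l * g (k - l) :=
  MemLp.integrable_mul (Lp.memLp f)
    ((Lp.memLp g).comp_measurePreserving (Measure.measurePreserving_sub_left volume k))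

theorem convolutionL2_add (f g h : L2) (k : SpaceTime) :
    convolutionL2 f (g + h) k = convolutionL2 f g k + convolutionL2 f h k := by
  unfold convolutionL2
  rw [← integral_add (integrable_mul_comp_sub f g k) (integrable_mul_comp_sub f h k)]
  apply integral_congr_ae
  filter_upwards [(Measure.measurePreserving_sub_left volume k).quasiMeasurePreserving.ae
    (Lp.coeFn_add g h)] with l hl
  rw [hl, Pi.add_apply, mul_add]

theorem integrable_schwartz_mul_convolutionL2 (φ : 𝓢(SpaceTime, ℂ)) (f g : L2) :
    Integrable fun k => φ k * convolutionL2 f g k := by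
  refine Integrable.mul_bdd (c := ‖f‖ * ‖g‖) φ.integrable
    (stronglyMeasurable_convolutionL2 f g).aestronglyMeasurable ?_
  exact Filter.Eventually.of_forall (norm_convolutionL2_le f g)

/-- The map is additive in `g` and bounded, as the convolution is bounded pointwise by `‖f‖ ‖g‖`. It
serves the density argument for the product formula. -/
theorem continuous_integral_schwartz_mul_convolutionL2 (φ : 𝓢(SpaceTime, ℂ)) (f : L2) :
    Continuous fun g => ∫ k, φ k * convolutionL2 f g k := by
  let T : L2 →+ ℂ := AddMonoidHom.mk' (fun g => ∫ k, φ k * convolutionL2 f g k) fun g h => by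
    rw [← integral_add (integrable_schwartz_mul_convolutionL2 φ f g)
      (integrable_schwartz_mul_convolutionL2 φ f h)]
    simp_rw [convolutionL2_add, mul_add]
  refine AddMonoidHomClass.continuous_of_bound T ((∫ k, ‖φ k‖) * ‖f‖) fun g => ?_
  have h1 : ∀ k, ‖φ k * convolutionL2 f g k‖ ≤ ‖φ k‖ * (‖f‖ * ‖g‖) := fun k => by
    rw [norm_mul]
    gcongr
    exact norm_convolutionL2_le f g k
  refine (norm_integral_le_of_norm_le (φ.integrable.norm.mul_const _)
    (Filter.Eventually.of_forall h1)).trans_eq ?_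
  rw [integral_mul_const]
  ring

theorem continuous_toTemperedDistribution_smul (χ : 𝓢(SpaceTime, ℂ)) (u : L2) :
    Continuous fun v : L2 => Lp.toTemperedDistribution
      (u • v : Lp ℂ 1 (volume : Measure SpaceTime)) χ := by
  have h1 : Continuous fun v : L2 => (u • v : Lp ℂ 1 (volume : Measure SpaceTime)) := by
    let T : L2 →+ Lp ℂ 1 (volume : Measure SpaceTime) :=
      AddMonoidHom.mk' (fun v => u • v) fun v w => Lp.add_smul u v w
    exact AddMonoidHomClass.continuous_of_bound T ‖u‖ fun v => Lp.norm_smul_le u v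
  have h2 := (PointwiseConvergenceCLM.evalCLM (RingHom.id ℂ) ℂ χ).continuous.comp
    (Lp.toTemperedDistributionCLM ℂ (volume : Measure SpaceTime) 1).continuous
  exact h2.comp h1

theorem integrable_prod_schwartz_mul (φ : 𝓢(SpaceTime, ℂ)) (f g : L2) :
    Integrable (fun z : SpaceTime × SpaceTime => φ z.1 * (f z.2 * g (z.1 - z.2)))
      ((volume : Measure SpaceTime).prod volume) := by
  have hf := (Lp.stronglyMeasurable f).measurable
  have hg := (Lp.stronglyMeasurable g).measurable
  have hφ := φ.continuous.measurable
  refine ⟨Measurable.aestronglyMeasurable (by fun_prop), ?_⟩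
  unfold HasFiniteIntegral
  rw [lintegral_prod _ (by fun_prop)]
  calc _ ≤ ∫⁻ k, ‖φ k‖ₑ * (‖f‖ₑ * ‖g‖ₑ) := by
        refine lintegral_mono fun k => ?_
        simp only [enorm_mul]
        rw [lintegral_const_mul _ (by fun_prop)]
        gcongr
        exact lintegral_enorm_mul_le f g k
    _ < ∞ := by
        rw [lintegral_mul_const _ (by fun_prop)]
        exact ENNReal.mul_lt_top φ.integrable.2 (by finiteness)

/-- The product formula, for a Schwartz factor. -/
theorem toTemperedDistribution_smul_fourier_schwartz (φ ψ : 𝓢(SpaceTime, ℂ)) (f : L2) :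
    Lp.toTemperedDistribution ((𝓕⁻ f : L2) • (𝓕⁻ (ψ.toLp 2 volume) : L2) :
      Lp ℂ 1 (volume : Measure SpaceTime)) (𝓕 φ) =
      ∫ k, φ k * convolutionL2 f (ψ.toLp 2 volume) k := by
  set B : ℂ →L[ℂ] ℂ →L[ℂ] ℂ := ContinuousLinearMap.mul ℂ ℂ with hB
  -- The Schwartz factor is moved onto the test function. Then `𝓕⁻` passes from `f` to `θ`, where it
  -- gives the convolution of `φ` with the reflection of `ψ`, and Fubini reassembles the convolution
  -- with `f`.
  set θ : 𝓢(SpaceTime, ℂ) := SchwartzMap.pairing B (𝓕 φ) (𝓕⁻ ψ) with hθ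
  have e1 : Lp.toTemperedDistribution ((𝓕⁻ f : L2) • (𝓕⁻ (ψ.toLp 2 volume) : L2) :
      Lp ℂ 1 (volume : Measure SpaceTime)) (𝓕 φ) = Lp.toTemperedDistribution (𝓕⁻ f : L2) θ := by
    rw [Lp.toTemperedDistribution_apply, Lp.toTemperedDistribution_apply]
    apply integral_congr_ae
    have h1 := Lp.coeFn_lpSMul (r := 1) (𝓕⁻ f : L2) (𝓕⁻ (ψ.toLp 2 volume) : L2)
    rw [SchwartzMap.toLp_fourierInv_eq] at h1 ⊢
    filter_upwards [h1, (𝓕⁻ ψ).coeFn_toLp 2 volume] with x hx hy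
    rw [hx, Pi.smul_apply', hy, hθ, SchwartzMap.pairing_apply_apply, hB]
    simp only [smul_eq_mul, ContinuousLinearMap.mul_apply']
    ring
  have e2 : 𝓕⁻ θ = SchwartzMap.convolution B φ (𝓕⁻ (𝓕⁻ ψ)) := by
    have := SchwartzMap.fourier_convolution B φ (𝓕⁻ (𝓕⁻ ψ))
    rw [FourierTransform.fourier_fourierInv_eq] at this
    rw [hθ, ← this, FourierTransform.fourierInv_fourier_eq]
  have e3 : ∀ x, (𝓕⁻ (𝓕⁻ ψ)) x = ψ (-x) := by
    intro x
    rw [SchwartzMap.fourierInv_coe, Real.fourierInv_eq_fourier_neg, ← SchwartzMap.fourier_coe,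
      FourierTransform.fourier_fourierInv_eq]
  have e4 : ∀ l, (𝓕⁻ θ) l = ∫ k, φ k * ψ (k - l) := by
    intro l
    rw [e2, SchwartzMap.convolution_apply]
    unfold convolution
    refine integral_congr_ae (Filter.Eventually.of_forall fun k => ?_)
    simp only [hB, ContinuousLinearMap.mul_apply', e3, neg_sub]
  have e5 : ∀ᵐ l, (∫ k, φ k * ψ (k - l)) * f l =
      ∫ k, φ k * (f l * (ψ.toLp 2 volume) (k - l)) := by
    refine Filter.Eventually.of_forall fun l => ?_
    rw [← integral_mul_const]
    apply integral_congr_ae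
    filter_upwards [(measurePreserving_sub_right volume l).quasiMeasurePreserving.ae
      (ψ.coeFn_toLp 2 volume)] with k hk
    rw [hk]; ring
  rw [e1, ← Lp.fourierInv_toTemperedDistribution_eq, TemperedDistribution.fourierInv_apply,
    Lp.toTemperedDistribution_apply]
  simp_rw [smul_eq_mul, e4]
  rw [integral_congr_ae e5, ← integral_integral_swap]
  · refine integral_congr_ae (Filter.Eventually.of_forall fun k => ?_)
    simp only [convolutionL2]
    rw [integral_const_mul]
  · exact integrable_prod_schwartz_mul φ f _

/-- The Fourier transform maps products of square integrable functions to convolutions. -/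
theorem toTemperedDistribution_smul_fourier (φ : 𝓢(SpaceTime, ℂ)) (f g : L2) :
    Lp.toTemperedDistribution ((𝓕⁻ f : L2) • (𝓕⁻ g : L2) :
      Lp ℂ 1 (volume : Measure SpaceTime)) (𝓕 φ) = ∫ k, φ k * convolutionL2 f g k := by
  -- Both sides are continuous in `g` for the `L²` norm, and Schwartz functions are dense.
  refine DenseRange.induction_on (p := fun g : L2 => Lp.toTemperedDistribution
      ((𝓕⁻ f : L2) • (𝓕⁻ g : L2) : Lp ℂ 1 (volume : Measure SpaceTime)) (𝓕 φ) =
      ∫ k, φ k * convolutionL2 f g k)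
    (SchwartzMap.denseRange_toLpCLM (E := SpaceTime) (F := ℂ) (p := 2) (μ := volume)
      ENNReal.ofNat_ne_top) g ?_ ?_
  · apply isClosed_eq
    · exact (continuous_toTemperedDistribution_smul (𝓕 φ) (𝓕⁻ f)).comp
        (Lp.fourierTransformₗᵢ SpaceTime ℂ).symm.continuous
    · exact continuous_integral_schwartz_mul_convolutionL2 φ f
  · intro ψ
    exact toTemperedDistribution_smul_fourier_schwartz φ ψ f

/-- The Fourier transform of the derivative of a product. -/
theorem hasFourierFunction_dx_smul (f g : L2) :
    HasFourierFunction (dx (Lp.toTemperedDistribution ((𝓕⁻ f : L2) • (𝓕⁻ g : L2) :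
      Lp ℂ 1 (volume : Measure SpaceTime))))
      fun k => (2 * Real.pi * Complex.I) * (k 1 : ℂ) * convolutionL2 f g k := by
  have hg : Function.HasTemperateGrowth
      (fun x : SpaceTime => ((inner ℝ x (EuclideanSpace.single 1 1 : SpaceTime) : ℝ) : ℂ)) := by
    fun_prop
  have hin : ∀ x : SpaceTime, inner ℝ x (EuclideanSpace.single 1 1 : SpaceTime) = x 1 := by
    intro x
    simp [EuclideanSpace.inner_single_right]
  refine ⟨?_, fun φ => ?_⟩
  · have h1 := (stronglyMeasurable_convolutionL2 f g).measurable
    exact Measurable.aestronglyMeasurable (by fun_prop)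
  -- The symbol `2πi k₁` of the derivative is absorbed in the test function, so that only the
  -- convolution is left to pair with it.
  · set φ' : 𝓢(SpaceTime, ℂ) := SchwartzMap.smulLeftCLM ℂ
      (fun x : SpaceTime => ((inner ℝ x (EuclideanSpace.single 1 1 : SpaceTime) : ℝ) : ℂ)) φ
      with hφ'
    have hφ1 : ∀ k, φ' k = k 1 * φ k := fun k => by
      rw [hφ', SchwartzMap.smulLeftCLM_apply_apply hg, hin, smul_eq_mul]
    have e : ∀ k, φ k * ((2 * Real.pi * Complex.I) * (k 1 : ℂ) * convolutionL2 f g k) =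
        (2 * Real.pi * Complex.I) * (φ' k * convolutionL2 f g k) := fun k => by
      rw [hφ1]; ring
    simp_rw [e]
    refine ⟨(integrable_schwartz_mul_convolutionL2 φ' f g).const_mul _, ?_⟩
    rw [integral_const_mul, ← toTemperedDistribution_smul_fourier, dx,
      TemperedDistribution.fourier_lineDerivOp_eq]
    rfl

/-! ### Elements of the Bourgain spaces as L² functions, and the conclusion -/

theorem one_le_spaceWeight {c b b₁ s : ℝ} (hb : 0 ≤ b) (hb₁ : 0 ≤ b₁) (hs : 0 ≤ s)
    (k : SpaceTime) : 1 ≤ spaceWeight c b b₁ s k := by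
  unfold spaceWeight bourgainWeight
  have h1 : ∀ {E : Type} [Norm E] (x : E) (e : ℝ), 0 ≤ e → 1 ≤ bracket x ^ (2 * e) :=
    fun x e he => Real.one_le_rpow (one_le_bracket x) (by positivity)
  exact one_le_mul_of_one_le_of_one_le
    (one_le_mul_of_one_le_of_one_le (h1 _ _ hb₁) (h1 _ _ hs)) (h1 _ _ hb)

/-- A function with finite weighted norm which is the Fourier transform of `U` is an `L²`
function. -/
theorem HasFourierFunction.exists_toTemperedDistribution_eq {U : 𝓢'(SpaceTime, ℂ)}
    {g : SpaceTime → ℂ} (hg : HasFourierFunction U g) {w : SpaceTime → ℝ} (hw : ∀ k, 1 ≤ w k)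
    (hfin : ∫⁻ k, ENNReal.ofReal (w k) * ‖g k‖ₑ ^ 2 ≠ ∞) :
    ∃ f : L2, f =ᵐ[volume] g ∧ Lp.toTemperedDistribution f = 𝓕 U := by
  have hg2 : MemLp g 2 volume := by
    refine ⟨hg.1, ?_⟩
    rw [eLpNorm_eq_lintegral_rpow_enorm_toReal (by norm_num) (by norm_num)]
    refine ENNReal.rpow_lt_top_of_nonneg (by norm_num) ?_
    refine ne_top_of_le_ne_top hfin (lintegral_mono fun k => ?_)
    have : (1 : ℝ≥0∞) ≤ ENNReal.ofReal (w k) := ENNReal.one_le_ofReal.2 (hw k)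
    calc ‖g k‖ₑ ^ (2 : ℝ≥0∞).toReal = 1 * ‖g k‖ₑ ^ 2 := by simp
      _ ≤ _ := by gcongr
  refine ⟨hg2.toLp g, hg2.coeFn_toLp, ?_⟩
  ext φ
  rw [Lp.toTemperedDistribution_apply, (hg.2 φ).2]
  apply integral_congr_ae
  filter_upwards [hg2.coeFn_toLp] with k hk
  rw [hk, smul_eq_mul]

theorem toTemperedDistribution_injective {f g : L2}
    (h : Lp.toTemperedDistribution f = Lp.toTemperedDistribution g) : f = g := by
  have hk := Lp.ker_toTemperedDistributionCLM_eq_bot (E := SpaceTime) (F := ℂ) (μ := volume)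
    (p := 2)
  exact LinearMap.ker_eq_bot.1 hk h

/-- Elements of a Bourgain space are square integrable functions, and the norm is the weighted
norm of the Fourier transform. -/
theorem exists_toTemperedDistribution_eq_fourier {c b b₁ s : ℝ} (hb : 0 ≤ b) (hb₁ : 0 ≤ b₁)
    (hs : 0 ≤ s) {U : 𝓢'(SpaceTime, ℂ)} (hU : bourgainNorm c b b₁ s U < ∞) :
    ∃ f : L2, Lp.toTemperedDistribution f = 𝓕 U ∧
      (∫⁻ k, ENNReal.ofReal (spaceWeight c b b₁ s k) * ‖f k‖ₑ ^ 2) ^ (1 / 2 : ℝ) ≤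
        bourgainNorm c b b₁ s U := by
  have hw := one_le_spaceWeight (c := c) hb hb₁ hs
  have hne : ∀ {x : ℝ≥0∞}, x ^ (1 / 2 : ℝ) < ∞ → x ≠ ∞ := by
    rintro x hx rfl
    simp at hx
  have hU' := hU
  unfold bourgainNorm at hU'
  simp only [iInf_lt_iff] at hU'
  obtain ⟨g, hg, hlt⟩ := hU'
  obtain ⟨f, -, hf⟩ := hg.exists_toTemperedDistribution_eq hw (hne hlt)
  refine ⟨f, hf, ?_⟩
  refine le_iInf fun g' => le_iInf fun hg' => ?_
  -- The norm is an infimum over all Fourier functions of `U`. A competitor with infinite weighted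
  -- norm is harmless, and one with finite norm defines the same element of `L²`, by injectivity of
  -- the embedding into distributions.
  by_cases hfin : ∫⁻ k, ENNReal.ofReal (spaceWeight c b b₁ s k) * ‖g' k‖ₑ ^ 2 = ∞
  · change _ ≤ (∫⁻ k, ENNReal.ofReal (spaceWeight c b b₁ s k) * ‖g' k‖ₑ ^ 2) ^ (1 / 2 : ℝ)
    rw [hfin]
    simp
  · obtain ⟨f', hfg, hf'⟩ := hg'.exists_toTemperedDistribution_eq hw hfin
    have : f = f' := toTemperedDistribution_injective (hf.trans hf'.symm)
    subst this
    refine le_of_eq ?_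
    congr 1
    apply lintegral_congr_ae
    filter_upwards [hfg] with k hk
    rw [hk]
    rfl

/-- Elements `U`, `V` of `X^{1/2+ε,b₁,s}` are (unique) `L²` functions `u`, `v`; their product
`u • v` is the pointwise product, an `L¹` function. -/
theorem proposition3 :
    ∃ ε₀ : ℝ, 0 < ε₀ ∧ ∀ b₁ s ε : ℝ, 1 / 4 < b₁ → b₁ < 3 / 8 → 0 ≤ s → 0 < ε → ε < ε₀ →
      ∃ C : ℝ≥0, ∀ (c : ℝ) (U V : 𝓢'(SpaceTime, ℂ)),
        bourgainNorm c (1 / 2 + ε) b₁ s U < ∞ → bourgainNorm c (1 / 2 + ε) b₁ s V < ∞ →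
          ∃ u v : Lp ℂ 2 (volume : Measure SpaceTime),
            Lp.toTemperedDistribution u = U ∧ Lp.toTemperedDistribution v = V ∧
            bourgainNorm c (-1 / 2 + 2 * ε) b₁ s
                (dx (Lp.toTemperedDistribution (u • v : Lp ℂ 1 (volume : Measure SpaceTime))))
              ≤ C * bourgainNorm c (1 / 2 + ε) b₁ s U * bourgainNorm c (1 / 2 + ε) b₁ s V := by
  refine ⟨1 / 200, by norm_num, fun b₁ s ε h1 h2 hs hε0 hε => ?_⟩
  obtain ⟨C, hC, hbd⟩ := exists_convolution_bound h1 h2 hs hε0 hε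
  have hC' : C ^ (1 / 2 : ℝ) ≠ ∞ := ENNReal.rpow_ne_top_of_nonneg (by norm_num) hC
  refine ⟨(C ^ (1 / 2 : ℝ)).toNNReal, fun c U V hU hV => ?_⟩
  obtain ⟨f, hf, hfU⟩ := exists_toTemperedDistribution_eq_fourier (by linarith) (by linarith) hs hU
  obtain ⟨g, hg, hgV⟩ := exists_toTemperedDistribution_eq_fourier (by linarith) (by linarith) hs hV
  refine ⟨𝓕⁻ f, 𝓕⁻ g, ?_, ?_, ?_⟩
  · rw [← Lp.fourierInv_toTemperedDistribution_eq, hf, FourierTransform.fourierInv_fourier_eq]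
  · rw [← Lp.fourierInv_toTemperedDistribution_eq, hg, FourierTransform.fourierInv_fourier_eq]
  -- Since the norm is an infimum, exhibiting one Fourier function of the derivative of the product
  -- bounds it from above.
  refine (iInf₂_le _ (hasFourierFunction_dx_smul f g)).trans ?_
  rw [ENNReal.coe_toNNReal hC']
  have key := hbd c (fun k => ‖f k‖ₑ) (fun k => ‖g k‖ₑ)
    (Lp.stronglyMeasurable f).measurable.enorm (Lp.stronglyMeasurable g).measurable.enorm
  set X := ∫⁻ k, ENNReal.ofReal (spaceWeight c (1 / 2 + ε) b₁ s k) * ‖f k‖ₑ ^ 2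
  set Y := ∫⁻ k, ENNReal.ofReal (spaceWeight c (1 / 2 + ε) b₁ s k) * ‖g k‖ₑ ^ 2
  calc _ ≤ (C * (X * Y)) ^ (1 / 2 : ℝ) := by
        refine ENNReal.rpow_le_rpow (le_trans (lintegral_mono fun k => ?_) key) (by norm_num)
        change ENNReal.ofReal (spaceWeight c (-1 / 2 + 2 * ε) b₁ s k) * _ ≤ _
        gcongr
        rw [enorm_mul]
        refine mul_le_mul' (le_of_eq ?_) (enorm_convolutionL2_le_lintegral f g k)
        rw [← ofReal_norm]
        simp [abs_of_pos Real.pi_pos, abs_mul]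
    _ = C ^ (1 / 2 : ℝ) * X ^ (1 / 2 : ℝ) * Y ^ (1 / 2 : ℝ) := by
        rw [ENNReal.mul_rpow_half, ENNReal.mul_rpow_half, mul_assoc]
    _ ≤ _ := by gcongr
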